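/- All manifolds and maps are smooth ($C^\infty$); manifolds are finite-dimensional, Hausdorff, second countable and without boundary. Let $G\subseteq GL(n,\mathbb R)$ be a closed subgroup with its Lie group structure and Lie algebra $\mathfrak g\subseteq\mathfrak{gl}(n,\mathbb R)$, and let $X$ be a manifold with a right $G$-action and infinitesimal action $\psi(\alpha)_x=\frac{d}{dt}\big|_{t=0}x\exp(t\alpha)$. **Cartan data** on $X$ is a triple $(c,R,F)$ of $G$-equivariant smooth maps $c:X\to\mathrm{Hom}(\wedge^2\mathbb R^n,\mathbb R^n)$, $R:X\to\mathrm{Hom}(\wedge^2\mathbb R^n,\mathfrak g)$ and $F:X\times\mathbb R^n\to TX$ (linear in the fibres, over $\mathrm{id}_X$), i.e. $c(xg)(g^{-1}u,g^{-1}v)=g^{-1}c(x)(u,v)$, $R(xg)(g^{-1}u,g^{-1}v)=\mathrm{Ad}_{g^{-1}}R(x)(u,v)$, $F(xg,g^{-1}u)=F(x,u)\cdot g$. A **$G$-structure with connection** $(P,\theta,\omega)$ is a manifold $P$ with a proper, effective and locally free right $G$-action (so $P\to P/G$ is a principal $G$-bundle over an effective orbifold), a form $\theta\in\Omega^1(P,\mathbb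 R^n)$ that is pointwise surjective, has as kernel exactly the tangent spaces of the orbits, and satisfies $g^*\theta=g^{-1}\theta$, and a form $\omega\in\Omega^1(P,\mathfrak g)$ with $\omega(\alpha_P)=\alpha$ for the infinitesimal generators $\alpha_P$ ($\alpha\in\mathfrak g$) and $g^*\omega=\mathrm{Ad}_{g^{-1}}\omega$. A **solution** for $(c,R,F)$ is a $G$-structure with connection together with a $G$-equivariant map $h:P\to X$ (its classifying map) such that $$d\theta=c(h)(\theta\wedge\theta)-\omega\wedge\theta,\qquad d\omega=R(h)(\theta\wedge\theta)-\omega\wedge\omega,\qquad dh=F(h,\theta)+\psi(h,\omega),$$ where $c(\theta\wedge\theta)(\xi,\zeta)=c(\theta(\xi),\theta(\zeta))$, similarly for $R$, $(\omega\wedge\theta)(\xi,\zeta)=\omega(\xi)\theta(\zeta)-\omega(\zeta)\theta(\xi)$ and $(\omega\wedge\omega)(\xi,\zeta)=[\omega(\xi),\omega(\zeta)]$. A **$G$-structure algebroid with connection** over $X$ is a Lie algebroid $A\to X$ together with: a smooth right $G$-action on $A$ by Lie algebroid automorphisms covering the action on $X$; an injective morphism of Lie algebroids $i:X\rtimes\mathfrak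 g\to A$ over $\mathrm{id}_X$ from the action algebroid such that $\frac{d}{dt}\big|_{t=0}\exp(t\alpha)^*s=[i(\alpha),s]$ for all sections $s$ of $A$ and all $\alpha\in\mathfrak g$; a $G$-equivariant fibrewise surjective $A$-form $\theta:A\to\mathbb R^n$ with $\ker\theta=\mathrm{im}\,i$; and a $G$-equivariant $A$-form $\omega:A\to\mathfrak g$ with $\omega(i(x,\alpha))=\alpha$. Morphisms are the $G$-equivariant morphisms of Lie algebroids that intertwine the maps $i$ and preserve $\theta$ and $\omega$. The tangent algebroid $TP$ of a $G$-structure with connection is an example. A **$G$-realization** of $A$ is a $G$-structure with connection $(P,\theta,\omega)$ together with a morphism $TP\to A$ of $G$-structure algebroids with connection. Such an algebroid is in **canonical form** if its vector bundle is $X\times(\mathbb R^n\oplus\mathfrak g)$, the action is $(x,u,\alpha)g=(xg,g^{-1}u,\mathrm{Ad}_{g^{-1}}\alpha)$, $i(x,\alpha)=(x,0,\alpha)$, and $\theta,\omega$ are the projections. It is **defined by** $(c,R,F)$ if moreover its anchor is $(u,\alpha)\mapsto F(u)+\psi(\alpha)$ and on constant sections $$[(u,\alpha),(v,\beta)]=(\alpha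 v-\beta u-c(u,v),\ [\alpha,\beta]-R(u,v)).$$ **Theorem.** 1. If for every $x\in X$ the Cartan data $(c,R,F)$ has a solution whose classifying map has $x$ in its image, then there is exactly one $G$-structure algebroid with connection in canonical form that is defined by $(c,R,F)$. 2. Conversely, for every $G$-structure algebroid with connection $A\to X$ there is exactly one Cartan data $(c,R,F)$ on $X$ that defines a $G$-structure algebroid with connection $A'$ in canonical form for which $\xi\mapsto(x,\theta(\xi),\omega(\xi))$, $\xi\in A_x$, is an isomorphism $A\to A'$ of $G$-structure algebroids with connection. 3. Let $A$ be a $G$-structure algebroid with connection in canonical form that is defined by the Cartan data $(c,R,F)$. Then solutions for $(c,R,F)$ are in one-to-one correspondence with $G$-realizations of $A$: for every manifold $P$ with right $G$-action, there is a bijection from solutions with total space $P$ to $G$-realizations with total space $P$, sending $(P,\theta,\omega,h)$ to the same $(P,\theta,\omega)$ with the bundle map $\Phi=(\theta,\omega):TP\to A$ covering $h$. -/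

import Mathlib

open scoped Manifold ContDiff RightActions Bundle
open Bundle

namespace CartanProblem

open NormedSpace Filter Topology

/-- Euclidean space `ℝⁿ`. -/
abbrev Vec (n : ℕ) := EuclideanSpace ℝ (Fin n)

/-- The general linear group `GL(n, ℝ)`, with its topology as the group of units of the algebra of
linear maps of `ℝⁿ`. -/
abbrev GLn (n : ℕ) := (Vec n →L[ℝ] Vec n)ˣ

instance completeSpace_end (n : ℕ) : CompleteSpace (Vec n →L[ℝ] Vec n) := inferInstance

instance hasSummableGeomSeries_end (n : ℕ) : HasSummableGeomSeries (Vec n →L[ℝ] Vec n) :=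
  inferInstance

section Algebra
variable {A : Type*} [NormedRing A] [NormedAlgebra ℝ A] [CompleteSpace A]

/-- The exponential of an element of a real Banach algebra, as a unit. -/
noncomputable def expUnit (a : A) : Aˣ where
  val := exp a
  inv := exp (-a)
  val_inv := by
    have : NormedAlgebra ℚ A := NormedAlgebra.restrictScalars ℚ ℝ A
    rw [← exp_add_of_commute (Commute.neg_right (Commute.refl a)), add_neg_cancel, exp_zero]
  inv_val := by
    have : NormedAlgebra ℚ A := NormedAlgebra.restrictScalars ℚ ℝ A
    rw [← exp_add_of_commute (Commute.neg_left (Commute.refl a)), neg_add_cancel, exp_zero]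

theorem expUnit_smul_zero (t : ℝ) : expUnit (t • (0 : A)) = 1 := by
  ext1; simp [expUnit]

theorem expUnit_zero_smul (a : A) : expUnit ((0 : ℝ) • a) = 1 := by
  ext1; simp [expUnit]

theorem expUnit_conj (g : Aˣ) (a : A) (t : ℝ) :
    expUnit (t • ((g : A) * a * (↑(g⁻¹) : A))) = g * expUnit (t • a) * g⁻¹ := by
  have : NormedAlgebra ℚ A := NormedAlgebra.restrictScalars ℚ ℝ A
  ext1
  simp only [expUnit, Units.val_mul]
  rw [← exp_units_conj]
  simp

theorem hasDerivAt_exp_line (a : A) : HasDerivAt (fun s : ℝ => exp (s • a)) a 0 := by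
  simpa using hasDerivAt_exp_smul_const (𝕂 := ℝ) a (0:ℝ)

theorem hasDerivAt_expUnit_mul (a b : A) :
    HasDerivAt (fun s : ℝ => ((expUnit (s • a) * expUnit (s • b) : Aˣ) : A)) (a + b) 0 := by
  have := (hasDerivAt_exp_line a).mul (hasDerivAt_exp_line b)
  simp only [zero_smul, exp_zero, one_mul, mul_one] at this
  exact this

theorem hasDerivAt_expUnit_conj (a b : A) :
    HasDerivAt (fun s : ℝ => (expUnit (s • a) : A) * b * (↑(expUnit (s • a))⁻¹ : A))
      (a * b - b * a) 0 := by
  have := ((hasDerivAt_exp_line a).mul_const b).mul (hasDerivAt_exp_line (-a))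
  simp only [zero_smul, exp_zero, one_mul, mul_one, mul_neg, ← sub_eq_add_neg] at this
  refine this.congr_of_eventuallyEq (Eventually.of_forall fun s => ?_)
  simp [expUnit]

end Algebra

theorem pow_sub_pow_norm_le {A : Type*} [NormedRing A] (a b : A) (M : ℝ) (hM : 1 ≤ M)
    (ha : ∀ x : A, ‖a * x‖ ≤ M * ‖x‖) (hb : ∀ x : A, ‖x * b‖ ≤ M * ‖x‖) (m : ℕ) :
    ‖a ^ m - b ^ m‖ ≤ m * M ^ m * ‖a - b‖ := by
  induction m with
  | zero => simp
  | succ m ih =>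
    have hM0 : (0:ℝ) ≤ M := by linarith
    have hpow : ∀ x : A, ∀ j : ℕ, ‖x * b ^ j‖ ≤ M ^ j * ‖x‖ := by
      intro x j
      induction j with
      | zero => simp
      | succ j ihj =>
        rw [pow_succ, ← mul_assoc]
        calc _ ≤ M * ‖x * b ^ j‖ := hb _
          _ ≤ M * (M ^ j * ‖x‖) := by gcongr
          _ = _ := by ring
    have e : a ^ (m+1) - b ^ (m+1) = a * (a ^ m - b ^ m) + (a - b) * b ^ m := by
      rw [pow_succ' a, pow_succ' b]; noncomm_ring
    rw [e]
    calc _ ≤ ‖a * (a ^ m - b ^ m)‖ + ‖(a - b) * b ^ m‖ := norm_add_le _ _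
      _ ≤ M * (m * M ^ m * ‖a - b‖) + M ^ m * ‖a - b‖ := by
        gcongr
        · exact (ha _).trans (by gcongr)
        · exact hpow _ _
      _ ≤ M * (m * M ^ m * ‖a - b‖) + M ^ (m+1) * ‖a - b‖ := by
        gcongr
        exact m.le_succ
      _ = _ := by push_cast; ring

/-- If `γ` is a curve with `γ 0 = 1` and velocity `a` at `0`, then `γ (1/m) ^ m → exp a`. -/
theorem tendsto_curve_pow {A : Type*} [NormedRing A] [NormedAlgebra ℝ A] [CompleteSpace A]
    (γ : ℝ → A) (a : A) (h0 : γ 0 = 1) (hγ : HasDerivAt γ a 0) :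
    Tendsto (fun m : ℕ => γ ((m : ℝ)⁻¹) ^ m) atTop (𝓝 (exp a)) := by
  have hexp := hasDerivAt_exp_line a
  have hinv : Tendsto (fun m : ℕ => ((m : ℝ))⁻¹) atTop (𝓝[≠] 0) := by
    refine tendsto_nhdsWithin_iff.mpr ⟨tendsto_inv_atTop_nhds_zero_nat, ?_⟩
    filter_upwards [eventually_gt_atTop 0] with m hm
    have : (m:ℝ) ≠ 0 := by positivity
    simpa using this.symm ∘ Eq.symm
  have key : ∀ δ : ℝ → A, δ 0 = 1 → HasDerivAt δ a 0 →
      Tendsto (fun m : ℕ => (m:ℝ) • (δ ((m:ℝ)⁻¹) - 1)) atTop (𝓝 a) := by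
    intro δ h hδ
    have := (hasDerivAt_iff_tendsto_slope.mp hδ).comp hinv
    refine this.congr fun m => ?_
    simp [slope_def_module, h]
  have k1 := key γ h0 hγ
  have k2 := key _ (by simp) hexp
  have kd : Tendsto (fun m : ℕ => (m:ℝ) * ‖γ ((m:ℝ)⁻¹) - exp ((m:ℝ)⁻¹ • a)‖) atTop (𝓝 0) := by
    have := (k1.sub k2).norm
    simp only [sub_self, norm_zero] at this
    refine this.congr fun m => ?_
    rw [← smul_sub, sub_sub_sub_cancel_right, norm_smul]; simp
  set C := ‖a‖ + 1
  have hC : 0 < C := by positivity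
  have bnd : ∀ δ : ℝ → A, Tendsto (fun m : ℕ => (m:ℝ) • (δ ((m:ℝ)⁻¹) - 1)) atTop (𝓝 a) →
      ∀ᶠ m : ℕ in atTop, ‖δ ((m:ℝ)⁻¹) - 1‖ ≤ C / m := by
    intro δ h
    filter_upwards [h.norm.eventually (gt_mem_nhds (show ‖a‖ < C by simp [C])),
      eventually_gt_atTop 0] with m hm hm0
    rw [norm_smul] at hm
    have : (0:ℝ) < m := by exact_mod_cast hm0
    rw [le_div_iff₀ this]
    simp at hm
    linarith
  have lim : Tendsto (fun m : ℕ => γ ((m : ℝ)⁻¹) ^ m - exp ((m:ℝ)⁻¹ • a) ^ m) atTop (𝓝 0) := by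
    rw [tendsto_zero_iff_norm_tendsto_zero]
    have up : Tendsto (fun m : ℕ => Real.exp C * ((m:ℝ) * ‖γ ((m:ℝ)⁻¹) - exp ((m:ℝ)⁻¹ • a)‖))
        atTop (𝓝 0) := by simpa using kd.const_mul (Real.exp C)
    refine squeeze_zero' (Eventually.of_forall fun _ => norm_nonneg _) ?_ up
    filter_upwards [bnd _ k1, bnd (fun t => exp (t • a)) k2, eventually_gt_atTop 0] with m h1 h2 hm0
    have hm : (0:ℝ) < m := by exact_mod_cast hm0
    have hl := pow_sub_pow_norm_le (γ ((m:ℝ)⁻¹)) (exp ((m:ℝ)⁻¹ • a)) (1 + C / m)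
      (by have : 0 ≤ C / m := by positivity
          linarith) ?_ ?_ m
    · refine hl.trans ?_
      have : (1 + C / m) ^ m ≤ Real.exp C := by
        have h3 : 1 + C / m ≤ Real.exp (C / m) := by linarith [Real.add_one_le_exp (C / m)]
        calc (1 + C / m) ^ m ≤ Real.exp (C / m) ^ m := by gcongr
          _ = Real.exp C := by rw [← Real.exp_nat_mul]; congr 1; field_simp
      calc _ = (1 + C / m) ^ m * ((m:ℝ) * ‖γ ((m:ℝ)⁻¹) - exp ((m:ℝ)⁻¹ • a)‖) := by ring
        _ ≤ _ := by gcongr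
    · intro x
      calc _ = ‖x + (γ ((m:ℝ)⁻¹) - 1) * x‖ := by congr 1; noncomm_ring
        _ ≤ ‖x‖ + C / m * ‖x‖ := (norm_add_le _ _).trans (by
            gcongr; exact (norm_mul_le _ _).trans (by gcongr))
        _ = _ := by ring
    · intro x
      calc _ = ‖x + x * (exp ((m:ℝ)⁻¹ • a) - 1)‖ := by congr 1; noncomm_ring
        _ ≤ ‖x‖ + ‖x‖ * (C / m) := (norm_add_le _ _).trans (by
            gcongr; exact (norm_mul_le _ _).trans (by gcongr))
        _ = _ := by ring
  have := lim.add_const (exp a)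
  rw [zero_add] at this
  refine this.congr' ?_
  filter_upwards [eventually_gt_atTop 0] with m hm0
  have hm : (m:ℝ) ≠ 0 := by positivity
  have : NormedAlgebra ℚ A := NormedAlgebra.restrictScalars ℚ ℝ A
  rw [← exp_nsmul, ← Nat.cast_smul_eq_nsmul ℝ, smul_smul, mul_inv_cancel₀ hm, one_smul]
  abel


section LieAlg
variable {n : ℕ} (G : ClosedSubgroup (GLn n))

theorem expUnit_mem_of_curve (γ : ℝ → GLn n) (a : Vec n →L[ℝ] Vec n) (hG : ∀ t, γ t ∈ G)
    (h0 : γ 0 = 1) (hγ : HasDerivAt (fun t => (γ t : Vec n →L[ℝ] Vec n)) a 0) :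
    expUnit a ∈ G := by
  have h := tendsto_curve_pow (fun t => (γ t : Vec n →L[ℝ] Vec n)) a (by simp [h0]) hγ
  have h2 : Tendsto (fun m : ℕ => γ ((m:ℝ)⁻¹) ^ m) atTop (𝓝 (expUnit a)) := by
    rw [Units.isOpenEmbedding_val.isEmbedding.tendsto_nhds_iff]
    simpa [Function.comp_def, expUnit] using h
  exact G.isClosed'.mem_of_tendsto h2 (Eventually.of_forall fun m => pow_mem (hG _) m)

/-- The Lie algebra of the closed subgroup `G ⊆ GL(n, ℝ)`: the matrices `a` with `exp (t a) ∈ G` for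
all real `t`. -/
noncomputable def lieAlg : Submodule ℝ (Vec n →L[ℝ] Vec n) where
  carrier := {a | ∀ t : ℝ, expUnit (t • a) ∈ G}
  zero_mem' := fun t => by rw [expUnit_smul_zero]; exact one_mem G
  smul_mem' := fun c a ha t => by rw [smul_smul]; exact ha _
  add_mem' := by
    intro a b ha hb t
    refine expUnit_mem_of_curve G (fun s => expUnit (s • t • a) * expUnit (s • t • b)) _
      (fun s => mul_mem ?_ ?_) ?_ ?_
    · rw [smul_smul]; exact ha _
    · rw [smul_smul]; exact hb _
    · rw [expUnit_zero_smul, expUnit_zero_smul, one_mul]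
    · rw [smul_add]; exact hasDerivAt_expUnit_mul _ _

theorem lieAlg_conj {g : GLn n} (hg : g ∈ G) {a : Vec n →L[ℝ] Vec n} (ha : a ∈ lieAlg G) :
    (g : Vec n →L[ℝ] Vec n) * a * (↑(g⁻¹) : Vec n →L[ℝ] Vec n) ∈ lieAlg G := fun t => by
  rw [expUnit_conj]
  exact mul_mem (mul_mem hg (ha t)) (inv_mem hg)

theorem lieAlg_bracket {a b : Vec n →L[ℝ] Vec n} (ha : a ∈ lieAlg G) (hb : b ∈ lieAlg G) :
    a * b - b * a ∈ lieAlg G := by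
  have hcl : IsClosed (lieAlg G : Set (Vec n →L[ℝ] Vec n)) := Submodule.closed_of_finiteDimensional _
  have hs := hasDerivAt_iff_tendsto_slope.mp (hasDerivAt_expUnit_conj a b)
  refine hcl.mem_of_tendsto hs (Eventually.of_forall fun s => ?_)
  rw [slope_def_module]
  exact (lieAlg G).smul_mem _ ((lieAlg G).sub_mem (lieAlg_conj G (ha _) hb) (lieAlg_conj G (ha _) hb))
end LieAlg

variable {n : ℕ} (G : ClosedSubgroup (GLn n))

/-- The Lie algebra `𝔤` as a normed space. -/
def LieAlg : Type := lieAlg G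

noncomputable instance : NormedAddCommGroup (LieAlg G) :=
  inferInstanceAs (NormedAddCommGroup (lieAlg G))

noncomputable instance : NormedSpace ℝ (LieAlg G) :=
  inferInstanceAs (NormedSpace ℝ (lieAlg G))

instance : FiniteDimensional ℝ (LieAlg G) :=
  inferInstanceAs (FiniteDimensional ℝ (lieAlg G))

variable {G}

/-- The inclusion `𝔤 ⊆ 𝔤𝔩(n, ℝ)`. -/
def LieAlg.toEnd (α : LieAlg G) : Vec n →L[ℝ] Vec n := Subtype.val (p := (· ∈ lieAlg G)) α

/-- The inclusion `G ⊆ GL(n, ℝ)`, with values in the linear maps of `ℝⁿ`. -/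
def toEnd (g : G) : Vec n →L[ℝ] Vec n := ((g : GLn n) : Vec n →L[ℝ] Vec n)

/-- `exp : 𝔤 → G`. -/
noncomputable def lieExp (α : LieAlg G) : G :=
  ⟨expUnit α.toEnd, by have := α.2 1; rwa [one_smul] at this⟩

/-- The commutator bracket `[α, β] = α β - β α` of `𝔤`. -/
noncomputable def lieBr (α β : LieAlg G) : LieAlg G :=
  ⟨α.toEnd * β.toEnd - β.toEnd * α.toEnd, lieAlg_bracket G α.2 β.2⟩

/-- `Ad_g α = g α g⁻¹`. -/
noncomputable def Ad (g : G) (α : LieAlg G) : LieAlg G :=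
  ⟨toEnd g * α.toEnd * toEnd g⁻¹, lieAlg_conj G g.2 α.2⟩

variable (G)

/-! ### Smooth right actions

Manifolds are modelled on `ℝᵈ`, without boundary. A right action of `G` is an action of `Gᵐᵒᵖ`,
and `x <• g` is notation for `MulOpposite.op g • x`. -/

/-- The right action of the `k`-dimensional Lie group `G` on the `d`-manifold `X` is smooth. -/
class SmoothRightAction (k d : ℕ) [ChartedSpace (Vec k) G] (X : Type*) [TopologicalSpace X]
    [ChartedSpace (Vec d) X] [MulAction (G)ᵐᵒᵖ X] : Prop where
  contMDiff_act : ContMDiff ((𝓡 d).prod (𝓡 k)) (𝓡 d) ∞ (fun p : X × G => p.1 <• p.2)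

variable {G} in
/-- The infinitesimal action `ψ(α)_x = d/dt|_{t=0} x · exp(tα)`. -/
noncomputable def infAct (d : ℕ) {X : Type*} [TopologicalSpace X]
    [ChartedSpace (Vec d) X] [MulAction (G)ᵐᵒᵖ X] (α : LieAlg G) (x : X) :
    TangentSpace (𝓡 d) x :=
  mfderiv 𝓘(ℝ, ℝ) (𝓡 d) (fun t : ℝ => x <• lieExp (t • α)) 0 (1 : ℝ)

/-! ### Lie algebroids -/

section Algebroid

variable (d : ℕ) {X : Type*} [TopologicalSpace X] [ChartedSpace (Vec d) X] [IsManifold (𝓡 d) ∞ X]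
  (FA : Type*) [NormedAddCommGroup FA] [NormedSpace ℝ FA]
  (A : X → Type*) [∀ x, AddCommGroup (A x)] [∀ x, Module ℝ (A x)] [∀ x, TopologicalSpace (A x)]
  [TopologicalSpace (TotalSpace FA A)] [FiberBundle FA A] [VectorBundle ℝ FA A]

/-- Smooth sections of the vector bundle `A → X` (with model fibre `FA`). -/
abbrev Sec := ContMDiffSection (𝓡 d) FA ∞ A

variable {d FA A} in
/-- The product `f s` of a smooth function and a smooth section. -/
noncomputable def smulSec (f : C^∞⟮𝓡 d, X; ℝ⟯) (s : Sec d FA A) : Sec d FA A :=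
  ⟨fun x => f x • s x, f.contMDiff.smul_section s.contMDiff⟩

/-- A Lie algebroid structure on the vector bundle `A → X`: a smooth anchor `ρ : A → TX` and a Lie
bracket on the smooth sections satisfying `[s, f t] = f [s, t] + (ρ(s) f) t`; the anchor maps
brackets of sections to brackets of vector fields. (`ℝ`-bilinearity follows from additivity and
the Leibniz identity.) -/
structure LieAlgebroid where
  anchor : ∀ x : X, A x →L[ℝ] TangentSpace (𝓡 d) x
  anchor_smooth : ContMDiff ((𝓡 d).prod 𝓘(ℝ, FA)) (𝓡 d).tangent ∞
    (fun v : TotalSpace FA A => (⟨v.1, anchor v.1 v.2⟩ : TangentBundle (𝓡 d) X))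
  bracket : Sec d FA A → Sec d FA A → Sec d FA A
  bracket_add : ∀ s t u, bracket s (t + u) = bracket s t + bracket s u
  bracket_skew : ∀ s t, bracket s t = -bracket t s
  leibniz : ∀ (s t : Sec d FA A) (f : C^∞⟮𝓡 d, X; ℝ⟯) (x : X),
    bracket s (smulSec f t) x
      = f x • bracket s t x + mvfderiv (𝓡 d) f x (anchor x (s x)) • t x
  jacobi : ∀ s t u, bracket s (bracket t u) = bracket (bracket s t) u + bracket t (bracket s u)
  anchor_bracket : ∀ (s t : Sec d FA A) (x : X), anchor x (bracket s t x)
    = VectorField.mlieBracket (𝓡 d) (fun y => anchor y (s y)) (fun y => anchor y (t y)) x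

variable {A}

/-- Smoothness of a `W`-valued `A`-form `η` of degree one, seen as a fibrewise linear map
on the total space of `A`. -/
def IsSmoothForm {W : Type*} [NormedAddCommGroup W] [NormedSpace ℝ W]
    (η : ∀ x : X, A x →L[ℝ] W) : Prop :=
  ContMDiff ((𝓡 d).prod 𝓘(ℝ, FA)) 𝓘(ℝ, W) ∞ (fun v : TotalSpace FA A => η v.1 v.2)

variable {d FA}

/-- The algebroid differential of a `W`-valued `A`-form of degree one,
`d_A η (s, t) = ρ(s) η(t) - ρ(t) η(s) - η([s, t])`. -/
noncomputable def LieAlgebroid.dForm (L : LieAlgebroid d FA A)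
    {W : Type*} [NormedAddCommGroup W] [NormedSpace ℝ W]
    (η : ∀ x : X, A x →L[ℝ] W) (s t : Sec d FA A) (x : X) : W :=
  mvfderiv (𝓡 d) (fun y => η y (t y)) x (L.anchor x (s x))
    - mvfderiv (𝓡 d) (fun y => η y (s y)) x (L.anchor x (t x))
    - η x (L.bracket s t x)

/-- The smooth bundle map `(φ, Φ) : A → B` is a morphism of Lie algebroids: pull-back along it
commutes with the algebroid differentials. In degree zero this says that `dφ ∘ ρ_A = ρ_B ∘ Φ`; in
degree one it says `d_A (Φ^* η) = Φ^* (d_B η)`, where the right-hand side at `x` is computed with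
any sections `t`, `t'` of `B` which extend `Φ (s x)` and `Φ (s' x)`. Since `A`-forms are locally
generated in these degrees, this is compatibility with the differentials in all degrees. -/
structure IsLieAlgebroidHom {d' : ℕ} {Y : Type*} [TopologicalSpace Y] [ChartedSpace (Vec d') Y]
    [IsManifold (𝓡 d') ∞ Y] {FB : Type*} [NormedAddCommGroup FB] [NormedSpace ℝ FB]
    {B : Y → Type*} [∀ y, AddCommGroup (B y)] [∀ y, Module ℝ (B y)] [∀ y, TopologicalSpace (B y)]
    [TopologicalSpace (TotalSpace FB B)] [FiberBundle FB B] [VectorBundle ℝ FB B]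
    (L : LieAlgebroid d FA A) (L' : LieAlgebroid d' FB B)
    (φ : X → Y) (Φ : ∀ x, A x →L[ℝ] B (φ x)) : Prop where
  smooth_base : ContMDiff (𝓡 d) (𝓡 d') ∞ φ
  smooth : ContMDiff ((𝓡 d).prod 𝓘(ℝ, FA)) ((𝓡 d').prod 𝓘(ℝ, FB)) ∞
    (fun v : TotalSpace FA A => (⟨φ v.1, Φ v.1 v.2⟩ : TotalSpace FB B))
  anchor_comm : ∀ x ξ, mfderiv (𝓡 d) (𝓡 d') φ x (L.anchor x ξ) = L'.anchor (φ x) (Φ x ξ)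
  d_comm : ∀ η : (∀ y, B y →L[ℝ] ℝ), IsSmoothForm d' FB η →
    ∀ (s s' : Sec d FA A) (x : X) (t t' : Sec d' FB B),
      t (φ x) = Φ x (s x) → t' (φ x) = Φ x (s' x) →
      L.dForm (fun z => (η (φ z)).comp (Φ z)) s s' x = L'.dForm η t t' (φ x)

end Algebroid

theorem isManifold_two (m : ℕ) (P : Type*) [TopologicalSpace P] [ChartedSpace (Vec m) P]
    [IsManifold (𝓡 m) ∞ P] : IsManifold (𝓡 m) (minSmoothness ℝ 2) P := by
  refine IsManifold.of_le (n := ∞) ?_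
  rw [minSmoothness_of_isRCLikeNormedField]; exact ENat.LEInfty.out

theorem contMDiff_bracket {m : ℕ} {P : Type*} [TopologicalSpace P] [ChartedSpace (Vec m) P]
    [IsManifold (𝓡 m) ∞ P] (s t : Sec m (Vec m) (fun p : P => TangentSpace (𝓡 m) p)) :
    ContMDiff (𝓡 m) (𝓡 m).tangent ∞
      (fun p => (⟨p, VectorField.mlieBracket (𝓡 m) s t p⟩ : TangentBundle (𝓡 m) P)) := by
  have := isManifold_two m P
  have : IsManifold (𝓡 m) ((⊤ : ℕ∞) + 1) P := ‹IsManifold (𝓡 m) ∞ P›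
  exact ContDiff.mlieBracket_vectorField (m := (⊤ : ℕ∞)) (n := (⊤ : ℕ∞))
      s.contMDiff t.contMDiff (by rw [minSmoothness_of_isRCLikeNormedField]; exact le_rfl)

/-- The tangent Lie algebroid `TP → P`. -/
noncomputable def tangentAlgebroid (m : ℕ) (P : Type*) [TopologicalSpace P]
    [ChartedSpace (Vec m) P] [IsManifold (𝓡 m) ∞ P] :
    LieAlgebroid m (Vec m) (fun p : P => TangentSpace (𝓡 m) p) where
  anchor _ := ContinuousLinearMap.id ℝ _
  anchor_smooth := contMDiff_id
  bracket s t := ⟨VectorField.mlieBracket (𝓡 m) s t, contMDiff_bracket s t⟩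
  bracket_add s t u := by
    have := isManifold_two m P
    ext p
    exact VectorField.mlieBracket_add_right (t.contMDiff.mdifferentiable (by simp) p)
      (u.contMDiff.mdifferentiable (by simp) p)
  bracket_skew s t := by
    ext p
    exact VectorField.mlieBracket_swap_apply
  leibniz s t f p := by
    have :=  VectorField.mlieBracket_smul_right (V := s) (W := t) (x := p)
      (f.contMDiff.mdifferentiable (by simp) p) (t.contMDiff.mdifferentiable (by simp) p)
    rw [add_comm]
    exact this
  jacobi s t u := by
    have h2 : minSmoothness ℝ 2 ≤ ∞ := by
      rw [minSmoothness_of_isRCLikeNormedField]; exact ENat.LEInfty.out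
    have h3 : minSmoothness ℝ 3 ≤ ∞ := by
      rw [minSmoothness_of_isRCLikeNormedField]; exact WithTop.coe_le_coe.2 (le_top : (3 : ℕ∞) ≤ ⊤)
    have : IsManifold (𝓡 m) (minSmoothness ℝ 3) P := IsManifold.of_le h3
    ext p
    exact VectorField.leibniz_identity_mlieBracket_apply
      ((s.contMDiff p).of_le h2) ((t.contMDiff p).of_le h2) ((u.contMDiff p).of_le h2)
  anchor_bracket s t p := rfl

/-! ### `G`-structure algebroids with connection -/

section GAlgebroid

variable (k d : ℕ) [ChartedSpace (Vec k) G]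
  {X : Type*} [TopologicalSpace X] [ChartedSpace (Vec d) X] [IsManifold (𝓡 d) ∞ X]
  [MulAction (G)ᵐᵒᵖ X]
  (FA : Type*) [NormedAddCommGroup FA] [NormedSpace ℝ FA]
  (A : X → Type*) [∀ x, AddCommGroup (A x)] [∀ x, Module ℝ (A x)] [∀ x, TopologicalSpace (A x)]
  [∀ x, ContinuousSMul ℝ (A x)]
  [TopologicalSpace (TotalSpace FA A)] [FiberBundle FA A] [VectorBundle ℝ FA A]

/-- The data of a `G`-structure algebroid with connection on the vector bundle `A → X`: a Lie
algebroid, a fibrewise linear right action `ξ ⊙ g = act g x ξ` covering the action on `X`, the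
action morphism `i : X ⋊ 𝔤 → A`, the tautological form `taut` and the connection form `conn`. The axioms
are collected in `GAlgData.IsGStructureAlgebroid`. -/
structure GAlgData where
  alg : LieAlgebroid d FA A
  act : ∀ (g : G) (x : X), A x →L[ℝ] A (x <• g)
  i : ∀ x : X, LieAlg G → A x
  taut : ∀ x : X, A x →L[ℝ] Vec n
  conn : ∀ x : X, A x →L[ℝ] LieAlg G

variable {G d FA A}

namespace GAlgData

/-- The `G`-action on `A` is a principal action with action morphism `i`: `G` acts smoothly by Lie
algebroid automorphisms, `i` is an injective morphism of Lie algebroids from the action algebroid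
`X ⋊ 𝔤` (over the identity, so compatibility with brackets is tested on constant sections), and the
infinitesimal action `d/dt|_{t=0} exp(tα)^* s` on sections is `[i(α), s]`. In the last axiom `c t`
is the value of `exp(tα)^* s` at `x`. -/
structure IsGPrincipal (S : GAlgData G d FA A) : Prop where
  act_one : ∀ (x : X) (ξ : A x),
    (⟨x <• (1 : G), S.act 1 x ξ⟩ : TotalSpace FA A) = ⟨x, ξ⟩
  act_mul : ∀ (g h : G) (x : X) (ξ : A x),
    (⟨x <• (g * h), S.act (g * h) x ξ⟩ : TotalSpace FA A)
      = ⟨(x <• g) <• h, S.act h (x <• g) (S.act g x ξ)⟩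
  act_smooth : ContMDiff (((𝓡 d).prod 𝓘(ℝ, FA)).prod (𝓡 k)) ((𝓡 d).prod 𝓘(ℝ, FA)) ∞
    (fun p : TotalSpace FA A × G =>
      (⟨p.1.1 <• p.2, S.act p.2 p.1.1 p.1.2⟩ : TotalSpace FA A))
  act_hom : ∀ g : G, IsLieAlgebroidHom S.alg S.alg (fun x : X => x <• g) (S.act g)
  i_linear : ∀ x, IsLinearMap ℝ (S.i x)
  i_smooth : ContMDiff ((𝓡 d).prod 𝓘(ℝ, LieAlg G)) ((𝓡 d).prod 𝓘(ℝ, FA)) ∞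
    (fun p : X × LieAlg G => (⟨p.1, S.i p.1 p.2⟩ : TotalSpace FA A))
  i_injective : ∀ x, Function.Injective (S.i x)
  i_anchor : ∀ x α, S.alg.anchor x (S.i x α) = infAct d α x
  i_bracket : ∀ (α β : LieAlg G) (σ τ υ : Sec d FA A), (∀ x, σ x = S.i x α) →
    (∀ x, τ x = S.i x β) → (∀ x, υ x = S.i x (lieBr α β)) → S.alg.bracket σ τ = υ
  infinitesimal : ∀ (α : LieAlg G) (σ : Sec d FA A), (∀ x, σ x = S.i x α) →
    ∀ (s : Sec d FA A) (x : X) (c : ℝ → A x),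
      (∀ t : ℝ, S.act (lieExp (t • α)) x (c t) = s (x <• lieExp (t • α))) →
      HasDerivAt c (S.alg.bracket σ s x) 0

/-- `taut` is a tautological form: smooth, fibrewise surjective, strongly horizontal and
`G`-equivariant. -/
structure IsTautological (S : GAlgData G d FA A) : Prop where
  smooth : IsSmoothForm d FA S.taut
  surjective : ∀ x, Function.Surjective (S.taut x)
  horizontal : ∀ x ξ, S.taut x ξ = 0 ↔ ∃ α, ξ = S.i x α
  equivariant : ∀ (g : G) x ξ, S.taut (x <• g) (S.act g x ξ) = toEnd g⁻¹ (S.taut x ξ)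

/-- `conn` is the form of a connection: smooth, vertical and `G`-equivariant. -/
structure IsConnection (S : GAlgData G d FA A) : Prop where
  smooth : IsSmoothForm d FA S.conn
  vertical : ∀ x α, S.conn x (S.i x α) = α
  equivariant : ∀ (g : G) x ξ, S.conn (x <• g) (S.act g x ξ) = Ad g⁻¹ (S.conn x ξ)

/-- `S` is a `G`-structure algebroid with connection (`k` is the dimension of `G`). -/
structure IsGStructureAlgebroid (S : GAlgData G d FA A) : Prop where
  principal : S.IsGPrincipal k
  tautological : S.IsTautological
  connection : S.IsConnection

end GAlgData

/-- The bundle map `(φ, Φ)` is a morphism of `G`-structure algebroids with connection: a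
`G`-equivariant morphism of Lie algebroids which intertwines the action morphisms and
preserves the tautological and connection forms. -/
structure IsGMorphism {d' : ℕ} {Y : Type*} [TopologicalSpace Y] [ChartedSpace (Vec d') Y]
    [IsManifold (𝓡 d') ∞ Y] [MulAction (G)ᵐᵒᵖ Y]
    {FB : Type*} [NormedAddCommGroup FB] [NormedSpace ℝ FB]
    {B : Y → Type*} [∀ y, AddCommGroup (B y)] [∀ y, Module ℝ (B y)] [∀ y, TopologicalSpace (B y)]
    [TopologicalSpace (TotalSpace FB B)] [FiberBundle FB B] [VectorBundle ℝ FB B]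
    (S : GAlgData G d FA A) (S' : GAlgData G d' FB B)
    (φ : X → Y) (Φ : ∀ x, A x →L[ℝ] B (φ x)) : Prop where
  hom : IsLieAlgebroidHom S.alg S'.alg φ Φ
  equivariant : ∀ (g : G) (x : X) (ξ : A x),
    (⟨φ (x <• g), Φ (x <• g) (S.act g x ξ)⟩ : TotalSpace FB B)
      = ⟨φ x <• g, S'.act g (φ x) (Φ x ξ)⟩
  intertwines : ∀ x α, Φ x (S.i x α) = S'.i (φ x) α
  preserves_taut : ∀ x ξ, S'.taut (φ x) (Φ x ξ) = S.taut x ξ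
  preserves_conn : ∀ x ξ, S'.conn (φ x) (Φ x ξ) = S.conn x ξ

end GAlgebroid

/-! ### Cartan data and algebroids in canonical form -/

/-- Cartan data `(G, X, c, R, F)` on the `G`-manifold `X`. -/
structure CartanData (d : ℕ) (X : Type*) [TopologicalSpace X] [ChartedSpace (Vec d) X]
    [IsManifold (𝓡 d) ∞ X] [MulAction (G)ᵐᵒᵖ X] where
  c : X → Vec n [⋀^Fin 2]→L[ℝ] Vec n
  R : X → Vec n [⋀^Fin 2]→L[ℝ] LieAlg G
  F : ∀ x : X, Vec n →L[ℝ] TangentSpace (𝓡 d) x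
  c_smooth : ContMDiff (𝓡 d) 𝓘(ℝ, Vec n [⋀^Fin 2]→L[ℝ] Vec n) ∞ c
  R_smooth : ContMDiff (𝓡 d) 𝓘(ℝ, Vec n [⋀^Fin 2]→L[ℝ] LieAlg G) ∞ R
  F_smooth : ContMDiff ((𝓡 d).prod 𝓘(ℝ, Vec n)) (𝓡 d).tangent ∞
    (fun p : X × Vec n => (⟨p.1, F p.1 p.2⟩ : TangentBundle (𝓡 d) X))
  c_equivariant : ∀ (g : G) (x : X) (u v : Vec n),
    c (x <• g) ![toEnd g⁻¹ u, toEnd g⁻¹ v] = toEnd g⁻¹ (c x ![u, v])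
  R_equivariant : ∀ (g : G) (x : X) (u v : Vec n),
    R (x <• g) ![toEnd g⁻¹ u, toEnd g⁻¹ v] = Ad g⁻¹ (R x ![u, v])
  F_equivariant : ∀ (g : G) (x : X) (u : Vec n),
    F (x <• g) (toEnd g⁻¹ u) = mfderiv (𝓡 d) (𝓡 d) (fun y : X => y <• g) x (F x u)

section Canonical

variable {d : ℕ} {X : Type*} [TopologicalSpace X] [ChartedSpace (Vec d) X]
  [IsManifold (𝓡 d) ∞ X] [MulAction (G)ᵐᵒᵖ X]

/-- The trivial bundle `X × (ℝⁿ ⊕ 𝔤) → X`. -/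
abbrev CanonicalBundle (X : Type*) : X → Type _ := Bundle.Trivial X (Vec n × LieAlg G)

/-- Constant sections of the trivial bundle. -/
noncomputable def constSec (d : ℕ) {X : Type*} [TopologicalSpace X] [ChartedSpace (Vec d) X]
    (w : Vec n × LieAlg G) : Sec d (Vec n × LieAlg G) (CanonicalBundle G X) :=
  ⟨fun _ => w, fun x => (contMDiffAt_section (IB := 𝓡 d) (F := Vec n × LieAlg G)
    (E := CanonicalBundle G X) (s := fun _ => w) x).mpr
    (show ContMDiffAt (𝓡 d) 𝓘(ℝ, Vec n × LieAlg G) ∞ (fun _ => w) x from contMDiffAt_const)⟩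

variable {G}

/-- A `G`-structure algebroid with connection on the trivial bundle `X × (ℝⁿ ⊕ 𝔤)` is in canonical
form: the action is `(x, u, α) g = (x g, g⁻¹ u, Ad_{g⁻¹} α)`, the action morphism is the
inclusion, and `taut` and `conn` are the projections. -/
structure GAlgData.IsCanonicalForm
    (S : GAlgData G d (Vec n × LieAlg G) (CanonicalBundle G X)) : Prop where
  act_eq : ∀ (g : G) (x : X) (u : Vec n) (α : LieAlg G),
    S.act g x (u, α) = (toEnd g⁻¹ u, Ad g⁻¹ α)
  i_eq : ∀ (x : X) (α : LieAlg G), S.i x α = (0, α)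
  taut_eq : ∀ (x : X) (u : Vec n) (α : LieAlg G), S.taut x (u, α) = u
  conn_eq : ∀ (x : X) (u : Vec n) (α : LieAlg G), S.conn x (u, α) = α

/-- The anchor and the bracket of the algebroid `X × (ℝⁿ ⊕ 𝔤)` are those defined by the Cartan data
`D`: the anchor is `(u, α) ↦ F(u) + ψ(α)` and the bracket of constant sections is
`[(u, α), (v, β)] = (α v - β u - c(u, v), [α, β] - R(u, v))`. -/
structure GAlgData.IsDefinedBy
    (S : GAlgData G d (Vec n × LieAlg G) (CanonicalBundle G X)) (D : CartanData G d X) : Prop where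
  anchor_eq : ∀ (x : X) (u : Vec n) (α : LieAlg G),
    S.alg.anchor x (u, α) = D.F x u + infAct d α x
  bracket_eq : ∀ (u v : Vec n) (α β : LieAlg G) (x : X),
    S.alg.bracket (constSec G d (u, α)) (constSec G d (v, β)) x
      = (α.toEnd v - β.toEnd u - D.c x ![u, v],
          lieBr α β - D.R x ![u, v])

end Canonical

/-! ### Solutions and `G`-realizations -/

section Solutions

variable (k m : ℕ) [ChartedSpace (Vec k) G]
  (P : Type*) [TopologicalSpace P] [ChartedSpace (Vec m) P] [IsManifold (𝓡 m) ∞ P]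
  [MulAction (G)ᵐᵒᵖ P]

/-- A `G`-structure with connection whose total space is the manifold `P`: a smooth principal
(that is, proper, effective and locally free) right action of `G` on `P`, so that `P → P / G`
is a principal `G`-bundle over an effective orbifold, with a tautological form `θ = taut` (pointwise
surjective, strongly horizontal and equivariant), and a connection form `ω = conn` (vertical and
equivariant). -/
structure GStructureWithConnection where
  smooth_action : SmoothRightAction G k m P
  proper : ProperSMul (G)ᵐᵒᵖ P
  effective : ∀ g : G, (∀ p : P, p <• g = p) → g = 1
  locallyFree : ∀ p : P, ∃ U ∈ nhds (1 : G), ∀ g ∈ U, p <• g = p → g = 1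
  taut : ∀ p : P, TangentSpace (𝓡 m) p →L[ℝ] Vec n
  conn : ∀ p : P, TangentSpace (𝓡 m) p →L[ℝ] LieAlg G
  taut_smooth : IsSmoothForm m (Vec m) taut
  taut_surjective : ∀ p, Function.Surjective (taut p)
  taut_horizontal : ∀ p ξ, taut p ξ = 0 ↔ ∃ α : LieAlg G, ξ = infAct m α p
  taut_equivariant : ∀ (g : G) (p : P) ξ,
    taut (p <• g) (mfderiv (𝓡 m) (𝓡 m) (fun q : P => q <• g) p ξ) = toEnd g⁻¹ (taut p ξ)
  conn_smooth : IsSmoothForm m (Vec m) conn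
  conn_vertical : ∀ (p : P) (α : LieAlg G), conn p (infAct m α p) = α
  conn_equivariant : ∀ (g : G) (p : P) ξ,
    conn (p <• g) (mfderiv (𝓡 m) (𝓡 m) (fun q : P => q <• g) p ξ) = Ad g⁻¹ (conn p ξ)

variable {G k m P}

/-- The `G`-structure algebroid with connection `TP → P` of a `G`-structure with connection: the
tangent algebroid with the tangent lift of the action and the infinitesimal action. -/
noncomputable def GStructureWithConnection.tangentData (Q : GStructureWithConnection G k m P) :
    GAlgData G m (Vec m) (fun p : P => TangentSpace (𝓡 m) p) where
  alg := tangentAlgebroid m P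
  act g p := mfderiv (𝓡 m) (𝓡 m) (fun q : P => q <• g) p
  i p α := infAct m α p
  taut := Q.taut
  conn := Q.conn

variable {d : ℕ} {X : Type*} [TopologicalSpace X] [ChartedSpace (Vec d) X]
  [IsManifold (𝓡 d) ∞ X] [MulAction (G)ᵐᵒᵖ X]

variable (k m P) in
/-- A solution, with total space `P`, of the realization problem with Cartan data `D`: a
`G`-structure with connection and an equivariant map `h : P → X` satisfying the structure equations
`dθ = c(h)(θ ∧ θ) - ω ∧ θ`, `dω = R(h)(θ ∧ θ) - ω ∧ ω` and `dh = F(h, θ) + ψ(h, ω)`, where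
`(ω ∧ θ)(s, t) = ω(s) θ(t) - ω(t) θ(s)`, `(ω ∧ ω)(s, t) = [ω(s), ω(t)]` and
`c(θ ∧ θ)(s, t) = c(θ(s), θ(t))`. -/
structure Solution (D : CartanData G d X) extends GStructureWithConnection G k m P where
  h : P → X
  h_smooth : ContMDiff (𝓡 m) (𝓡 d) ∞ h
  h_equivariant : ∀ (g : G) (p : P), h (p <• g) = h p <• g
  structure_taut : ∀ (s t : Sec m (Vec m) (fun p : P => TangentSpace (𝓡 m) p)) (p : P),
    (tangentAlgebroid m P).dForm taut s t p
      = D.c (h p) ![taut p (s p), taut p (t p)]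
        - ((conn p (s p)).toEnd (taut p (t p)) - (conn p (t p)).toEnd (taut p (s p)))
  structure_conn : ∀ (s t : Sec m (Vec m) (fun p : P => TangentSpace (𝓡 m) p)) (p : P),
    (tangentAlgebroid m P).dForm conn s t p
      = D.R (h p) ![taut p (s p), taut p (t p)] - lieBr (conn p (s p)) (conn p (t p))
  structure_h : ∀ (p : P) (ξ : TangentSpace (𝓡 m) p),
    mfderiv (𝓡 m) (𝓡 d) h p ξ = D.F (h p) (taut p ξ) + infAct d (conn p ξ) (h p)

variable {FA : Type*} [NormedAddCommGroup FA] [NormedSpace ℝ FA]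
  {A : X → Type*} [∀ x, AddCommGroup (A x)] [∀ x, Module ℝ (A x)] [∀ x, TopologicalSpace (A x)]
  [TopologicalSpace (TotalSpace FA A)] [FiberBundle FA A] [VectorBundle ℝ FA A]

variable (k m P) in
/-- A `G`-realization, with total space `P`, of the `G`-structure algebroid with connection `S`: a
`G`-structure with connection and a morphism `(φ, Φ) : TP → A` of `G`-structure algebroids
with connection. -/
structure GRealization (S : GAlgData G d FA A) extends GStructureWithConnection G k m P where
  φ : P → X
  Φ : ∀ p : P, TangentSpace (𝓡 m) p →L[ℝ] A (φ p)
  morphism : IsGMorphism toGStructureWithConnection.tangentData S φ Φ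

/-- The realization problem for `D` has a solution whose classifying map has `x` in its image. -/
def HasSolutionThrough.{w} (k : ℕ) [ChartedSpace (Vec k) G] (D : CartanData G d X) (x : X) :
    Prop :=
  ∃ (m : ℕ) (P : Type w) (_ : TopologicalSpace P) (_ : T2Space P)
    (_ : SecondCountableTopology P) (_ : ChartedSpace (Vec m) P) (_ : IsManifold (𝓡 m) ∞ P)
    (_ : MulAction (G)ᵐᵒᵖ P) (sol : Solution k m P D), x ∈ Set.range sol.h

end Solutions

end CartanProblem

universe uX uF uA uP w

/-! Put `V = ℝⁿ ⊕ 𝔤`. Cartan data amount to a candidate anchor `F + ψ` on the trivial bundle `X × V`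
together with a candidate bracket `cartanBr` of constant sections. The Leibniz rule leaves only one
extension to all sections, `[s, t] = br(s, t) + ρ(s) t - ρ(t) s`, whence the uniqueness in part 1
(`FrameData.bracket_eq`). For this bracket only the Jacobi identity and the compatibility of the
anchor with brackets can fail. Once these hold, the axioms involving `G` follow from the
equivariance of `c`, `R` and `F`.

All three parts rest on one notion, `IsFrameLift`: an algebroid `L → P`, a map `h : P → X` and a
fibrewise bijective form `T : L → V` with `dh ∘ ρ = (F + ψ)(h, T)` and `dT = -br(h)(T, T)`. For `L =
TP` and `T = (θ, ω)` these are precisely the three structure equations of a solution. A section `s`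
of `X × V` lifts to the section `T⁻¹(s ∘ h)` of `L`, and the equations say that the bracket of two
lifts is the lift of the bracket (`IsFrameLift.exists_lift`). The Jacobi identity and the anchor
identity therefore descend from `L` to every point of `h(P)`. Both are equalities at points of `X`,
so solutions through all points give part 1.

For part 2 the algebroid `A` is itself a frame lift, over the identity of `X`. Its coframe `(θ, ω)`
trivializes `A`, and the differential of the coframe is tensorial. When one argument is vertical, it
is fixed by the infinitesimal action axiom; on two horizontal arguments its components are taken as
`c` and `R` (`torsion_eq_cartanBr`). The same descent then produces `A'`.

For part 3, a frame lift is the same as a fibrewise bijective algebroid morphism into the algebroid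
defined by the data (`IsFrameLift.isLieAlgebroidHom`, `IsLieAlgebroidHom.isFrameLift`). A morphism
preserving `θ` and `ω` into a canonical form must be `(θ, ω)`, so a realization contains nothing
beyond a solution. -/

namespace CartanProblem

open NormedSpace Filter Topology

set_option linter.unusedSectionVars false

/-! ### Derivatives along vector fields and Lie brackets on manifolds -/

section Calculus

variable {d : ℕ} {X : Type*} [TopologicalSpace X] [ChartedSpace (Vec d) X]
  {W : Type*} [NormedAddCommGroup W] [NormedSpace ℝ W]

theorem mvfderiv_clm_comp {W' : Type*} [NormedAddCommGroup W'] [NormedSpace ℝ W'] {f : X → W}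
    {x : X} (ℓ : W →L[ℝ] W') (hf : MDifferentiableAt (𝓡 d) 𝓘(ℝ, W) f x)
    (v : TangentSpace (𝓡 d) x) :
    mvfderiv (𝓡 d) (fun y => ℓ (f y)) x v = ℓ (mvfderiv (𝓡 d) f x v) := by
  have := mfderiv_comp_apply (I := 𝓡 d) (I' := 𝓘(ℝ, W)) (I'' := 𝓘(ℝ, W')) x
    (g := ℓ) (f := f) ℓ.differentiableAt.mdifferentiableAt hf v
  rw [mfderiv_eq_fderiv, ContinuousLinearMap.fderiv] at this
  exact this

theorem mvfderiv_congr {f g : X → W} {x : X} (h : f =ᶠ[𝓝 x] g) (v : TangentSpace (𝓡 d) x) :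
    mvfderiv (𝓡 d) f x v = mvfderiv (𝓡 d) g x v :=
  DFunLike.congr_fun h.mfderiv_eq v

variable [IsManifold (𝓡 d) ∞ X]

theorem isManifold_one (m : ℕ) (P : Type*) [TopologicalSpace P] [ChartedSpace (Vec m) P]
    [IsManifold (𝓡 m) ∞ P] : IsManifold (𝓡 m) 1 P :=
  IsManifold.of_le (n := ∞) (by simp)

theorem contMDiffAt_mvfderiv_apply {f : X → W} {V : ∀ x : X, TangentSpace (𝓡 d) x} {x : X}
    (hf : ContMDiffAt (𝓡 d) 𝓘(ℝ, W) ∞ f x)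
    (hV : ContMDiffAt (𝓡 d) (𝓡 d).tangent ∞
      (fun y => (⟨y, V y⟩ : TangentBundle (𝓡 d) X)) x) :
    ContMDiffAt (𝓡 d) 𝓘(ℝ, W) ∞ (fun y => mvfderiv (𝓡 d) f y (V y)) x := by
  have h := hf.mfderiv_const (m := ∞) (by simp)
  have := h.clm_apply_of_inCoordinates (E₁ := fun x : X => TangentSpace (𝓡 d) x)
    (E₂ := fun w : W => TangentSpace 𝓘(ℝ, W) w) hV hf
  exact (contMDiff_snd_tangentBundle_modelSpace (n := ∞) W 𝓘(ℝ, W)).contMDiffAt.comp x this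

/-- On functions, the Lie bracket of vector fields acts as the commutator. -/
theorem mvfderiv_mlieBracket {g : X → W} {V U : ∀ x : X, TangentSpace (𝓡 d) x} {x : X}
    (hg : ContMDiffAt (𝓡 d) 𝓘(ℝ, W) ∞ g x)
    (hV : ContMDiffAt (𝓡 d) (𝓡 d).tangent ∞
      (fun y => (⟨y, V y⟩ : TangentBundle (𝓡 d) X)) x)
    (hU : ContMDiffAt (𝓡 d) (𝓡 d).tangent ∞
      (fun y => (⟨y, U y⟩ : TangentBundle (𝓡 d) X)) x) :
    mvfderiv (𝓡 d) g x (VectorField.mlieBracket (𝓡 d) V U x)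
      = mvfderiv (𝓡 d) (fun y => mvfderiv (𝓡 d) g y (U y)) x (V x)
        - mvfderiv (𝓡 d) (fun y => mvfderiv (𝓡 d) g y (V y)) x (U x) := by
  have i2 := isManifold_two d X
  have i1 := isManifold_one d X
  set φ := extChartAt (𝓡 d) x with hφ
  set y₀ := φ x with hy₀
  have hx : φ.symm y₀ = x := extChartAt_to_inv x
  have hop : IsOpen φ.target := isOpen_extChartAt_target x
  have hy₀t : y₀ ∈ φ.target := mem_extChartAt_target x
  have hsm : ∀ y ∈ φ.target, ContMDiffAt 𝓘(ℝ, Vec d) (𝓡 d) ∞ φ.symm y := fun y hy =>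
    (contMDiffOn_extChartAt_symm x).contMDiffAt (hop.mem_nhds hy)
  have hinv : ∀ y ∈ φ.target, (mfderiv 𝓘(ℝ, Vec d) (𝓡 d) φ.symm y).IsInvertible := fun y hy => by
    have := isInvertible_mfderivWithin_extChartAt_symm (I := 𝓡 d) hy
    rwa [ModelWithCorners.range_eq_univ, mfderivWithin_univ] at this
  -- Pull-back of fields to the chart, retyped as maps `Vec d → Vec d`. The existential keeps it
  -- opaque, so that it unfolds only through `hpb`.
  obtain ⟨pb, hpb⟩ : ∃ pb : (∀ x : X, TangentSpace (𝓡 d) x) → Vec d → Vec d,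
      ∀ Z, pb Z = VectorField.mpullback 𝓘(ℝ, Vec d) (𝓡 d) φ.symm Z := ⟨_, fun _ => rfl⟩
  obtain ⟨gh, hgh⟩ : ∃ gh : Vec d → W, gh = fun y => g (φ.symm y) := ⟨_, rfl⟩
  have hghd : ContDiffAt ℝ ∞ gh y₀ := by
    rw [← contMDiffAt_iff_contDiffAt, hgh]
    exact ContMDiffAt.comp y₀ (by rwa [hx]) (hsm y₀ hy₀t)
  have hdiff : ∀ Z : ∀ x : X, TangentSpace (𝓡 d) x,
      ContMDiffAt (𝓡 d) (𝓡 d).tangent ∞ (fun y => (⟨y, Z y⟩ : TangentBundle (𝓡 d) X)) x →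
      DifferentiableAt ℝ (pb Z) y₀ := by
    intro Z hZ
    have h1 : ContMDiffAt 𝓘(ℝ, Vec d) 𝓘(ℝ, Vec d).tangent 1 _ y₀ :=
      ContMDiffAt.mpullback_vectorField_preimage (I := 𝓘(ℝ, Vec d)) (I' := 𝓡 d)
      (f := φ.symm) (V := Z) (n := ∞) (m := 1) (x₀ := y₀) (by rw [hx]; exact hZ.of_le (by simp))
      (hsm y₀ hy₀t) (hinv y₀ hy₀t) (by
        rw [one_add_one_eq_two]; exact ENat.LEInfty.out)
    have h2 := (contMDiff_snd_tangentBundle_modelSpace (n := 1) (Vec d) 𝓘(ℝ, Vec d)).contMDiffAt.comp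
      y₀ h1
    rw [hpb]
    exact (contMDiffAt_iff_contDiffAt.1 h2).differentiableAt (by simp)
  have hlift : ∀ Z : ∀ x : X, TangentSpace (𝓡 d) x, ∀ y ∈ φ.target,
      mfderiv 𝓘(ℝ, Vec d) (𝓡 d) φ.symm y (pb Z y) = Z (φ.symm y) := by
    intro Z y hy
    rw [hpb, VectorField.mpullback_apply, (hinv y hy).self_apply_inverse]
  -- Naturality of the bracket under the inverse chart; in the model space it is the bracket of
  -- ordinary calculus.
  have key : pb (VectorField.mlieBracket (𝓡 d) V U) y₀
      = VectorField.lieBracket ℝ (pb V) (pb U) y₀ := by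
    simp only [hpb]
    rw [VectorField.mpullback_mlieBracket (I := 𝓘(ℝ, Vec d)) (I' := 𝓡 d) (n := ∞)
      (f := φ.symm) (V := V) (W := U) (x₀ := y₀)
      (by rw [hx]; exact hV.mdifferentiableAt (by simp))
      (by rw [hx]; exact hU.mdifferentiableAt (by simp)) (hsm y₀ hy₀t)
      (by rw [minSmoothness_of_isRCLikeNormedField]; exact ENat.LEInfty.out),
      ← VectorField.mlieBracketWithin_univ, VectorField.mlieBracketWithin_eq_lieBracketWithin]
    exact congrFun VectorField.lieBracketWithin_univ y₀
  have hchain : ∀ {f : X → W} (y : Vec d) (_ : y ∈ φ.target)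
      (_ : MDifferentiableAt (𝓡 d) 𝓘(ℝ, W) f (φ.symm y)) (Z : ∀ x : X, TangentSpace (𝓡 d) x),
      fderiv ℝ (fun y => f (φ.symm y)) y (pb Z y) = mvfderiv (𝓡 d) f (φ.symm y) (Z (φ.symm y)) := by
    intro f y hy hf Z
    rw [← hlift Z y hy, ← mfderiv_eq_fderiv]
    exact mfderiv_comp_apply y hf ((hsm y hy).mdifferentiableAt (by simp)) (pb Z y)
  have hev : ∀ᶠ y in 𝓝 y₀, y ∈ φ.target ∧ MDifferentiableAt (𝓡 d) 𝓘(ℝ, W) g (φ.symm y) := by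
    have h0 : ∀ᶠ y in 𝓝 y₀, y ∈ φ.target := hop.mem_nhds hy₀t
    refine h0.and ?_
    have h1 : ∀ᶠ z in 𝓝 x, ContMDiffAt (𝓡 d) 𝓘(ℝ, W) 1 g z :=
      (contMDiffAt_iff_contMDiffAt_nhds (n := 1) (by simp)).1 (hg.of_le (by simp))
    have h2 : Tendsto φ.symm (𝓝 y₀) (𝓝 x) := by
      have := (hsm y₀ hy₀t).continuousAt
      rwa [ContinuousAt, hx] at this
    exact (h2.eventually h1).mono fun y hy => hy.mdifferentiableAt (by simp)
  have hfield : ∀ Z : ∀ x : X, TangentSpace (𝓡 d) x,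
      (fun y => mvfderiv (𝓡 d) g (φ.symm y) (Z (φ.symm y)))
        =ᶠ[𝓝 y₀] fun y => fderiv ℝ gh y (pb Z y) := by
    intro Z
    filter_upwards [hev] with y hy
    rw [hgh, hchain y hy.1 hy.2]
  have hsecond : ∀ Z Y : ∀ x : X, TangentSpace (𝓡 d) x,
      ContMDiffAt (𝓡 d) (𝓡 d).tangent ∞ (fun y => (⟨y, Z y⟩ : TangentBundle (𝓡 d) X)) x →
      mvfderiv (𝓡 d) (fun y => mvfderiv (𝓡 d) g y (Z y)) x (Y x)
        = fderiv ℝ (fun y => fderiv ℝ gh y (pb Z y)) y₀ (pb Y y₀) := by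
    intro Z Y hZ
    rw [← (hfield Z).fderiv_eq, hchain (f := fun y => mvfderiv (𝓡 d) g y (Z y)) y₀ hy₀t (by
      rw [hx]; exact (contMDiffAt_mvfderiv_apply hg hZ).mdifferentiableAt (by simp)), hx]
  rw [hsecond U V hU, hsecond V U hV]
  have hl : mvfderiv (𝓡 d) g x (VectorField.mlieBracket (𝓡 d) V U x)
      = fderiv ℝ gh y₀ (VectorField.lieBracket ℝ (pb V) (pb U) y₀) := by
    rw [← key, hgh, hchain y₀ hy₀t (by rw [hx]; exact hg.mdifferentiableAt (by simp)), hx]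
  have hd2 : DifferentiableAt ℝ (fderiv ℝ gh) y₀ :=
    (hghd.fderiv_right (m := 1) (by rw [one_add_one_eq_two]; exact ENat.LEInfty.out)).differentiableAt
      (by simp)
  -- In the commutator the two second-order terms cancel by symmetry of the second derivative; the
  -- first-order terms form the bracket.
  have hsymm : IsSymmSndFDerivAt ℝ gh y₀ := hghd.isSymmSndFDerivAt (by
    rw [minSmoothness_of_isRCLikeNormedField]; exact ENat.LEInfty.out)
  have hprod : ∀ (Z : Vec d → Vec d) (v : Vec d), DifferentiableAt ℝ Z y₀ →
      fderiv ℝ (fun y => fderiv ℝ gh y (Z y)) y₀ v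
        = fderiv ℝ gh y₀ (fderiv ℝ Z y₀ v) + fderiv ℝ (fderiv ℝ gh) y₀ v (Z y₀) := by
    intro Z v hZ
    rw [fderiv_clm_apply hd2 hZ]
    rfl
  rw [hl, hprod (pb U) (pb V y₀) (hdiff U hU), hprod (pb V) (pb U y₀) (hdiff V hV),
    hsymm (pb V y₀) (pb U y₀), VectorField.lieBracket_eq, map_sub]
  abel

/-- Brackets of related vector fields are related. -/
theorem mfderiv_mlieBracket_of_related {m : ℕ} {P : Type*} [TopologicalSpace P]
    [ChartedSpace (Vec m) P] [IsManifold (𝓡 m) ∞ P] {h : P → X}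
    {V U : ∀ p : P, TangentSpace (𝓡 m) p} {V' U' : ∀ x : X, TangentSpace (𝓡 d) x}
    (hh : ContMDiff (𝓡 m) (𝓡 d) ∞ h)
    (hV : ContMDiff (𝓡 m) (𝓡 m).tangent ∞ (fun y => (⟨y, V y⟩ : TangentBundle (𝓡 m) P)))
    (hU : ContMDiff (𝓡 m) (𝓡 m).tangent ∞ (fun y => (⟨y, U y⟩ : TangentBundle (𝓡 m) P)))
    (hV' : ContMDiff (𝓡 d) (𝓡 d).tangent ∞ (fun y => (⟨y, V' y⟩ : TangentBundle (𝓡 d) X)))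
    (hU' : ContMDiff (𝓡 d) (𝓡 d).tangent ∞ (fun y => (⟨y, U' y⟩ : TangentBundle (𝓡 d) X)))
    (hVV' : ∀ p, mfderiv (𝓡 m) (𝓡 d) h p (V p) = V' (h p))
    (hUU' : ∀ p, mfderiv (𝓡 m) (𝓡 d) h p (U p) = U' (h p)) (p : P) :
    mfderiv (𝓡 m) (𝓡 d) h p (VectorField.mlieBracket (𝓡 m) V U p)
      = VectorField.mlieBracket (𝓡 d) V' U' (h p) := by
  have i1 := isManifold_one d X
  set ψ := extChartAt (𝓡 d) (h p) with hψ
  have hψs : ∀ y ∈ ψ.source, ContMDiffAt (𝓡 d) 𝓘(ℝ, Vec d) ∞ ψ y := fun y hy =>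
    contMDiffAt_extChartAt' (by rwa [← extChartAt_source (𝓡 d)])
  have hps : h p ∈ ψ.source := mem_extChartAt_source (h p)
  have hψp := hψs _ hps
  have hinj : Function.Injective (mvfderiv (𝓡 d) ψ (h p)) :=
    (isInvertible_mfderiv_extChartAt hps).injective
  have hchain : ∀ {f : X → Vec d} (q : P)
      (_ : MDifferentiableAt (𝓡 d) 𝓘(ℝ, Vec d) f (h q)) (v : TangentSpace (𝓡 m) q),
      mvfderiv (𝓡 m) (fun q => f (h q)) q v
        = mvfderiv (𝓡 d) f (h q) (mfderiv (𝓡 m) (𝓡 d) h q v) := by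
    intro f q hf v
    exact mfderiv_comp_apply q hf ((hh q).mdifferentiableAt (by simp)) v
  -- The derivative of a chart at `h p` is injective, so it suffices to compare the two vectors on
  -- the chart viewed as a function. There both brackets become commutators of derivations, which
  -- are matched by the chain rule.
  apply hinj
  rw [mvfderiv_mlieBracket hψp (hV' _) (hU' _), ← hchain p (hψp.mdifferentiableAt (by simp)),
    mvfderiv_mlieBracket (g := fun q => ψ (h q)) (hψp.comp p (hh p)) (hV _) (hU _)]
  have hfield : ∀ (Z : ∀ p : P, TangentSpace (𝓡 m) p) (Z' : ∀ x : X, TangentSpace (𝓡 d) x),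
      (∀ p, mfderiv (𝓡 m) (𝓡 d) h p (Z p) = Z' (h p)) →
      (fun q => mvfderiv (𝓡 m) (fun q => ψ (h q)) q (Z q)) =ᶠ[𝓝 p]
        fun q => mvfderiv (𝓡 d) ψ (h q) (Z' (h q)) := by
    intro Z Z' hZ
    have : ∀ᶠ q in 𝓝 p, h q ∈ ψ.source :=
      (hh p).continuousAt.eventually ((isOpen_extChartAt_source (h p)).mem_nhds hps)
    filter_upwards [this] with q hq
    rw [hchain q ((hψs _ hq).mdifferentiableAt (by simp)), hZ]
  have hsecond : ∀ (Z Y : ∀ p : P, TangentSpace (𝓡 m) p) (Z' Y' : ∀ x : X, TangentSpace (𝓡 d) x),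
      ContMDiff (𝓡 d) (𝓡 d).tangent ∞ (fun y => (⟨y, Z' y⟩ : TangentBundle (𝓡 d) X)) →
      (∀ p, mfderiv (𝓡 m) (𝓡 d) h p (Z p) = Z' (h p)) →
      (∀ p, mfderiv (𝓡 m) (𝓡 d) h p (Y p) = Y' (h p)) →
      mvfderiv (𝓡 m) (fun q => mvfderiv (𝓡 m) (fun q => ψ (h q)) q (Z q)) p (Y p)
        = mvfderiv (𝓡 d) (fun y => mvfderiv (𝓡 d) ψ y (Z' y)) (h p) (Y' (h p)) := by
    intro Z Y Z' Y' hZ' hZ hY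
    rw [← hY p, ← hchain p ((contMDiffAt_mvfderiv_apply hψp (hZ' _)).mdifferentiableAt (by simp))]
    exact mvfderiv_congr (hfield Z Z' hZ) _
  congr 1
  · exact hsecond U V U' V' hU' hUU' hVV'
  · exact hsecond V U V' U' hV' hVV' hUU'

end Calculus

/-! ### Smoothness of maps into spaces of linear and alternating maps -/

section FiniteDimensional

variable {E H M : Type*} [NormedAddCommGroup E] [NormedSpace ℝ E] [TopologicalSpace H]
  {I : ModelWithCorners ℝ E H} [TopologicalSpace M] [ChartedSpace H M]
  {V W Z : Type*} [NormedAddCommGroup V] [NormedSpace ℝ V] [NormedAddCommGroup W] [NormedSpace ℝ W]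
  [FiniteDimensional ℝ W] [NormedAddCommGroup Z] [NormedSpace ℝ Z]

/-- A map into a normed space is smooth if its image under an injective linear map to a
finite-dimensional space is. -/
theorem contMDiffAt_of_injective_linear (ev : Z →ₗ[ℝ] W) (hev : Function.Injective ev) {f : M → Z}
    {x : M} (hf : ContMDiffAt I 𝓘(ℝ, W) ∞ (fun y => ev (f y)) x) :
    ContMDiffAt I 𝓘(ℝ, Z) ∞ f x := by
  obtain ⟨L, hL⟩ := ev.exists_leftInverse_of_injective (LinearMap.ker_eq_bot.2 hev)
  have h : f = fun y => LinearMap.toContinuousLinearMap L (ev (f y)) := by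
    ext1 y
    exact (LinearMap.congr_fun hL (f y)).symm
  rw [h]
  exact (LinearMap.toContinuousLinearMap L).contDiff.contMDiff.contMDiffAt.comp x hf

/-- Evaluation on a basis embeds the space of linear maps into a finite power of `W`. -/
theorem contMDiffAt_clm_of_apply [FiniteDimensional ℝ V] {f : M → V →L[ℝ] W} {x : M}
    (hf : ∀ v, ContMDiffAt I 𝓘(ℝ, W) ∞ (fun y => f y v) x) :
    ContMDiffAt I 𝓘(ℝ, V →L[ℝ] W) ∞ f x := by
  let b := Module.finBasis ℝ V
  let ev : (V →L[ℝ] W) →ₗ[ℝ] (Fin (Module.finrank ℝ V) → W) :=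
    { toFun := fun L i => L (b i)
      map_add' := fun _ _ => rfl
      map_smul' := fun _ _ => rfl }
  refine contMDiffAt_of_injective_linear ev (fun L L' h => ?_) (contMDiffAt_pi_space.2 fun i => hf _)
  exact ContinuousLinearMap.coe_injective (b.ext fun i => congrFun h i)

theorem contMDiffAt_alternating_of_apply {n : ℕ} {f : M → Vec n [⋀^Fin 2]→L[ℝ] W} {x : M}
    (hf : ∀ u v, ContMDiffAt I 𝓘(ℝ, W) ∞ (fun y => f y ![u, v]) x) :
    ContMDiffAt I 𝓘(ℝ, Vec n [⋀^Fin 2]→L[ℝ] W) ∞ f x := by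
  let b := (EuclideanSpace.basisFun (Fin n) ℝ).toBasis
  let ev : (Vec n [⋀^Fin 2]→L[ℝ] W) →ₗ[ℝ] (Fin n → Fin n → W) :=
    { toFun := fun L i j => L ![b i, b j]
      map_add' := fun _ _ => rfl
      map_smul' := fun _ _ => rfl }
  refine contMDiffAt_of_injective_linear ev (fun L L' h => ?_)
    (contMDiffAt_pi_space.2 fun i => contMDiffAt_pi_space.2 fun j => hf _ _)
  apply ContinuousAlternatingMap.toAlternatingMap_injective
  refine b.ext_alternating fun v _ => ?_
  have := congrFun (congrFun h (v 0)) (v 1)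
  have e : (fun i => b (v i)) = ![b (v 0), b (v 1)] := by
    ext1 i; fin_cases i <;> rfl
  rw [e]
  exact this

end FiniteDimensional

/-! ### Trivial bundles and fibrewise bijective forms -/

section Bundles

variable {d : ℕ} {X : Type*} [TopologicalSpace X] [ChartedSpace (Vec d) X]
  {V V₁ V₂ : Type*} [NormedAddCommGroup V] [NormedSpace ℝ V] [NormedAddCommGroup V₁]
  [NormedSpace ℝ V₁] [NormedAddCommGroup V₂] [NormedSpace ℝ V₂]
  {E H M : Type*} [NormedAddCommGroup E] [NormedSpace ℝ E] [TopologicalSpace H]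
  {I : ModelWithCorners ℝ E H} [TopologicalSpace M] [ChartedSpace H M]

theorem contMDiffAt_trivial_totalSpace {b : M → X} {f : M → V₁ × V₂} {p : M} :
    ContMDiffAt I ((𝓡 d).prod 𝓘(ℝ, V₁ × V₂)) ∞
        (fun q => (⟨b q, f q⟩ : TotalSpace (V₁ × V₂) (Bundle.Trivial X (V₁ × V₂)))) p
      ↔ ContMDiffAt I (𝓡 d) ∞ b p ∧ ContMDiffAt I 𝓘(ℝ, V₁ × V₂) ∞ f p := by
  rw [contMDiffAt_totalSpace]
  rfl

theorem contMDiff_trivial_totalSpace {b : M → X} {f : M → V₁ × V₂} :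
    ContMDiff I ((𝓡 d).prod 𝓘(ℝ, V₁ × V₂)) ∞
        (fun q => (⟨b q, f q⟩ : TotalSpace (V₁ × V₂) (Bundle.Trivial X (V₁ × V₂))))
      ↔ ContMDiff I (𝓡 d) ∞ b ∧ ContMDiff I 𝓘(ℝ, V₁ × V₂) ∞ f := by
  simp only [ContMDiff, contMDiffAt_trivial_totalSpace, forall_and]

theorem contMDiff_trivial_snd : ContMDiff ((𝓡 d).prod 𝓘(ℝ, V₁ × V₂)) 𝓘(ℝ, V₁ × V₂) ∞
    (fun v : TotalSpace (V₁ × V₂) (Bundle.Trivial X (V₁ × V₂)) => (v.2 : V₁ × V₂)) :=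
  (contMDiff_trivial_totalSpace (b := fun v : TotalSpace (V₁ × V₂) (Bundle.Trivial X (V₁ × V₂)) => v.1)
    (f := fun v : TotalSpace (V₁ × V₂) (Bundle.Trivial X (V₁ × V₂)) => v.2)).1 contMDiff_id |>.2

/-- Smooth functions as sections of the trivial bundle. -/
def trivSec (f : X → V₁ × V₂) (hf : ContMDiff (𝓡 d) 𝓘(ℝ, V₁ × V₂) ∞ f) : Sec d (V₁ × V₂) (Bundle.Trivial X (V₁ × V₂)) :=
  ⟨f, contMDiff_trivial_totalSpace.2 ⟨contMDiff_id, hf⟩⟩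

theorem contMDiff_trivial_section (s : Sec d (V₁ × V₂) (Bundle.Trivial X (V₁ × V₂))) :
    ContMDiff (𝓡 d) 𝓘(ℝ, V₁ × V₂) ∞ (fun x => (s x : V₁ × V₂)) :=
  (contMDiff_trivial_totalSpace.1 s.contMDiff).2

variable {FA : Type*} [NormedAddCommGroup FA] [NormedSpace ℝ FA] [FiniteDimensional ℝ FA]
  [FiniteDimensional ℝ V]
  {A : X → Type*} [∀ x, AddCommGroup (A x)] [∀ x, Module ℝ (A x)] [∀ x, TopologicalSpace (A x)]
  [TopologicalSpace (TotalSpace FA A)] [FiberBundle FA A] [VectorBundle ℝ FA A]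
  [ContMDiffVectorBundle ∞ FA A (𝓡 d)]

/-- A smooth form which is bijective on fibres is a trivialization of the vector bundle. -/
theorem exists_inverse_form (T : ∀ x, A x →L[ℝ] V) (hT : IsSmoothForm d FA T)
    (hb : ∀ x, Function.Bijective (T x)) :
    ∃ Ti : ∀ x, V →L[ℝ] A x, (∀ x ξ, Ti x (T x ξ) = ξ) ∧ (∀ x v, T x (Ti x v) = v) ∧
      ContMDiff ((𝓡 d).prod 𝓘(ℝ, V)) ((𝓡 d).prod 𝓘(ℝ, FA)) ∞
        (fun p : X × V => (⟨p.1, Ti p.1 p.2⟩ : TotalSpace FA A)) := by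
  classical
  have key : ∀ x₀ x, x ∈ (trivializationAt FA A x₀).baseSet → ∃ e : A x ≃L[ℝ] FA,
      (∀ ξ, e ξ = (trivializationAt FA A x₀ ⟨x, ξ⟩).2) ∧
      ∀ w, e.symm w = (trivializationAt FA A x₀).symm x w := fun x₀ x hx =>
    ⟨(trivializationAt FA A x₀).continuousLinearEquivAt ℝ x hx, fun _ => rfl, fun _ => rfl⟩
  choose e he hes using key
  have hloc : ∀ x₀ x hx, ∃ M : FA ≃L[ℝ] V, ∀ w, M w = T x ((e x₀ x hx).symm w) := fun x₀ x hx =>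
    ⟨(LinearEquiv.ofBijective ((T x).comp ((e x₀ x hx).symm : FA →L[ℝ] A x)).toLinearMap
      ((hb x).comp (e x₀ x hx).symm.bijective)).toContinuousLinearEquiv, fun _ => rfl⟩
  choose M hM using hloc
  have hself : ∀ x, x ∈ (trivializationAt FA A x).baseSet := mem_baseSet_trivializationAt FA A
  -- At each `x` the trivialization centred at `x` is used. The choice is immaterial because `Ti x`
  -- inverts `T x`; near `x₀` it may thus be computed in the single trivialization centred at `x₀`,
  -- where smoothness is proved.
  let Ti : ∀ x, V →L[ℝ] A x := fun x =>
    ((e x x (hself x)).symm : FA →L[ℝ] A x).comp ((M x x (hself x)).symm : V →L[ℝ] FA)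
  have hTTi : ∀ x v, T x (Ti x v) = v := fun x v => by
    change T x ((e x x (hself x)).symm ((M x x (hself x)).symm v)) = v
    rw [← hM, ContinuousLinearEquiv.apply_symm_apply]
  have hTiT : ∀ x ξ, Ti x (T x ξ) = ξ := fun x ξ => (hb x).1 (hTTi _ _)
  refine ⟨Ti, hTiT, hTTi, fun p₀ => ?_⟩
  obtain ⟨x₀, v₀⟩ := p₀
  rw [contMDiffAt_totalSpace]
  refine ⟨contMDiff_fst.contMDiffAt, ?_⟩
  set t := trivializationAt FA A x₀ with ht
  have hopen : t.baseSet ∈ 𝓝 x₀ := t.open_baseSet.mem_nhds (hself x₀)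
  -- The form read in the trivialization, with junk value `0` off the base set, which does not
  -- affect germs at `x₀`. Its inverse is smooth because inversion is smooth at an invertible
  -- operator.
  have hMs : ContMDiffAt (𝓡 d) 𝓘(ℝ, FA →L[ℝ] V) ∞
      (fun x => if h : x ∈ t.baseSet then (M x₀ x h : FA →L[ℝ] V) else 0) x₀ := by
    refine contMDiffAt_clm_of_apply fun w => ?_
    have h1 : ContMDiffAt (𝓡 d) ((𝓡 d).prod 𝓘(ℝ, FA)) ∞
        (fun x => (⟨x, t.symm x w⟩ : TotalSpace FA A)) x₀ := by
      have h2 := (t.contMDiffOn_symm (n := ∞) (IB := 𝓡 d)).contMDiffAt (x := (x₀, w))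
        (t.open_target.mem_nhds (by rw [t.mem_target]; exact hself x₀))
      have h3 : ContMDiffAt (𝓡 d) ((𝓡 d).prod 𝓘(ℝ, FA)) ∞ (fun x : X => (x, w)) x₀ :=
        contMDiffAt_id.prodMk contMDiffAt_const
      refine (h2.comp x₀ h3).congr_of_eventuallyEq ?_
      filter_upwards [hopen] with x hx
      exact t.mk_symm hx w
    refine ((hT _).comp x₀ h1).congr_of_eventuallyEq ?_
    filter_upwards [hopen] with x hx
    simp only [hx, dif_pos]
    change M x₀ x hx w = T x (t.symm x w)
    rw [hM, hes]
  have hinv := (contDiffAt_map_inverse (n := ∞) (M x₀ x₀ (hself x₀))).contMDiffAt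
  have hMi : ContMDiffAt ((𝓡 d).prod 𝓘(ℝ, V)) 𝓘(ℝ, V →L[ℝ] FA) ∞ (fun p : X × V =>
      ContinuousLinearMap.inverse
        (if h : p.1 ∈ t.baseSet then (M x₀ p.1 h : FA →L[ℝ] V) else 0)) (x₀, v₀) := by
    have h4 : ContMDiffAt ((𝓡 d).prod 𝓘(ℝ, V)) 𝓘(ℝ, FA →L[ℝ] V) ∞ (fun p : X × V =>
        if h : p.1 ∈ t.baseSet then (M x₀ p.1 h : FA →L[ℝ] V) else 0) (x₀, v₀) :=
      ContMDiffAt.comp (x₀, v₀) (g := fun x =>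
        if h : x ∈ t.baseSet then (M x₀ x h : FA →L[ℝ] V) else 0) hMs contMDiffAt_fst
    refine ContMDiffAt.comp (x₀, v₀) (g := ContinuousLinearMap.inverse) ?_ h4
    have h5 : (x₀, v₀).1 ∈ t.baseSet := hself x₀
    simp only [h5, dif_pos]
    exact hinv
  refine (hMi.clm_apply contMDiffAt_snd).congr_of_eventuallyEq ?_
  filter_upwards [(continuous_fst.tendsto (x₀, v₀)).eventually hopen] with p hp
  have hp' : p.1 ∈ t.baseSet := hp
  simp only [hp', dif_pos, ContinuousLinearMap.inverse_equiv]
  rw [← he x₀ p.1 hp', ContinuousLinearEquiv.coe_coe, ContinuousLinearEquiv.eq_symm_apply, hM,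
    ContinuousLinearEquiv.symm_apply_apply, hTTi]

end Bundles

/-! ### The adjoint action, the exponential map and the infinitesimal action -/

section LieGroupMaps

variable {n : ℕ} {G : ClosedSubgroup (GLn n)}

theorem end_smul_mul (r : ℝ) (a b : Vec n →L[ℝ] Vec n) : (r • a) * b = r • (a * b) := rfl

theorem end_mul_smul (r : ℝ) (a b : Vec n →L[ℝ] Vec n) : a * (r • b) = r • (a * b) :=
  ContinuousLinearMap.ext fun v => map_smul a r (b v)

theorem LieAlg.toEnd_injective : Function.Injective (LieAlg.toEnd (G := G)) :=
  Subtype.val_injective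

/-- The inclusion `𝔤 ⊆ 𝔤𝔩(n, ℝ)` as a linear map. -/
def LieAlg.toEndₗ : LieAlg G →ₗ[ℝ] (Vec n →L[ℝ] Vec n) where
  toFun := LieAlg.toEnd
  map_add' _ _ := rfl
  map_smul' _ _ := rfl

@[simp] theorem LieAlg.toEnd_add (α β : LieAlg G) : (α + β).toEnd = α.toEnd + β.toEnd := rfl
@[simp] theorem LieAlg.toEnd_sub (α β : LieAlg G) : (α - β).toEnd = α.toEnd - β.toEnd := rfl
@[simp] theorem LieAlg.toEnd_neg (α : LieAlg G) : (-α).toEnd = -α.toEnd := rfl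
@[simp] theorem LieAlg.toEnd_smul (r : ℝ) (α : LieAlg G) : (r • α).toEnd = r • α.toEnd := rfl

theorem LieAlg.contDiff_toEnd : ContDiff ℝ ∞ (LieAlg.toEnd (G := G)) :=
  (LinearMap.toContinuousLinearMap (LieAlg.toEndₗ (G := G))).contDiff

@[simp] theorem toEnd_lieBr (α β : LieAlg G) :
    (lieBr α β).toEnd = α.toEnd * β.toEnd - β.toEnd * α.toEnd := rfl

@[simp] theorem toEnd_Ad (g : G) (α : LieAlg G) :
    (Ad g α).toEnd = toEnd g * α.toEnd * toEnd g⁻¹ := rfl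

@[simp] theorem toEnd_one : toEnd (1 : G) = 1 := rfl
@[simp] theorem toEnd_mul (g h : G) : toEnd (g * h) = toEnd g * toEnd h := rfl

theorem toEnd_inv_mul (g : G) : toEnd g⁻¹ * toEnd g = 1 := by
  rw [← toEnd_mul, inv_mul_cancel, toEnd_one]

theorem toEnd_mul_inv (g : G) : toEnd g * toEnd g⁻¹ = 1 := by
  rw [← toEnd_mul, mul_inv_cancel, toEnd_one]

theorem toEnd_inv_apply_apply (g : G) (v : Vec n) : toEnd g⁻¹ (toEnd g v) = v :=
  DFunLike.congr_fun (toEnd_inv_mul g) v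

theorem toEnd_apply_inv_apply (g : G) (v : Vec n) : toEnd g (toEnd g⁻¹ v) = v :=
  DFunLike.congr_fun (toEnd_mul_inv g) v

@[simp] theorem Ad_one (α : LieAlg G) : Ad 1 α = α :=
  LieAlg.toEnd_injective (by simp)

theorem Ad_mul (g h : G) (α : LieAlg G) : Ad (g * h) α = Ad g (Ad h α) :=
  LieAlg.toEnd_injective (by simp [mul_assoc])

theorem Ad_add (g : G) (α β : LieAlg G) : Ad g (α + β) = Ad g α + Ad g β :=
  LieAlg.toEnd_injective (by simp [mul_add, add_mul])

theorem Ad_smul (g : G) (r : ℝ) (α : LieAlg G) : Ad g (r • α) = r • Ad g α :=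
  LieAlg.toEnd_injective (by
    rw [toEnd_Ad, LieAlg.toEnd_smul, end_mul_smul, end_smul_mul, LieAlg.toEnd_smul, toEnd_Ad])

theorem Ad_inv_Ad (g : G) (α : LieAlg G) : Ad g⁻¹ (Ad g α) = α := by
  rw [← Ad_mul, inv_mul_cancel, Ad_one]

theorem Ad_lieBr (g : G) (α β : LieAlg G) : Ad g (lieBr α β) = lieBr (Ad g α) (Ad g β) := by
  apply LieAlg.toEnd_injective
  have h : ∀ a b : Vec n →L[ℝ] Vec n,
      toEnd g * a * toEnd g⁻¹ * (toEnd g * b * toEnd g⁻¹) = toEnd g * (a * b) * toEnd g⁻¹ := by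
    intro a b
    calc _ = toEnd g * a * (toEnd g⁻¹ * toEnd g) * b * toEnd g⁻¹ := by simp only [mul_assoc]
      _ = _ := by rw [toEnd_inv_mul]; simp only [mul_assoc, mul_one]
  simp only [toEnd_Ad, toEnd_lieBr, h, mul_sub, sub_mul]

theorem toEnd_Ad_apply (g : G) (α : LieAlg G) (v : Vec n) :
    (Ad g α).toEnd (toEnd g v) = toEnd g (α.toEnd v) := by
  change toEnd g (α.toEnd (toEnd g⁻¹ (toEnd g v))) = _
  rw [toEnd_inv_apply_apply]

theorem toEnd_lieExp (α : LieAlg G) : toEnd (lieExp α) = exp α.toEnd := rfl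

theorem toEnd_lieExp_inv (α : LieAlg G) : toEnd (lieExp α)⁻¹ = exp (-α.toEnd) := rfl

@[simp] theorem lieExp_zero : lieExp (0 : LieAlg G) = 1 := by
  have h := expUnit_smul_zero (A := Vec n →L[ℝ] Vec n) 1
  rw [smul_zero] at h
  exact Subtype.ext h

/-- Exponentiation commutes with conjugation. In this form it moves a group element past a
one-parameter subgroup, as needed to translate orbit curves. -/
theorem mul_lieExp (g : G) (α : LieAlg G) : lieExp α * g = g * lieExp (Ad g⁻¹ α) := by
  apply Subtype.ext
  have h := expUnit_conj (g : GLn n)⁻¹ α.toEnd 1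
  rw [one_smul, one_smul, inv_inv] at h
  change expUnit α.toEnd * (g : GLn n) = g * expUnit (Ad g⁻¹ α).toEnd
  have e : (Ad g⁻¹ α).toEnd = ((g : GLn n)⁻¹ : GLn n) * α.toEnd * ((g : GLn n) : Vec n →L[ℝ] Vec n) := by
    rw [toEnd_Ad, inv_inv]; rfl
  rw [e, h]
  group

theorem lieBr_add_left (α β γ : LieAlg G) : lieBr (α + β) γ = lieBr α γ + lieBr β γ :=
  LieAlg.toEnd_injective (by simp [add_mul, mul_add]; abel)

theorem lieBr_skew (α β : LieAlg G) : lieBr α β = -lieBr β α :=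
  LieAlg.toEnd_injective (by simp)

theorem lieBr_smul_left (r : ℝ) (α β : LieAlg G) : lieBr (r • α) β = r • lieBr α β :=
  LieAlg.toEnd_injective (by
    rw [toEnd_lieBr, LieAlg.toEnd_smul, end_mul_smul, end_smul_mul, LieAlg.toEnd_smul, toEnd_lieBr,
      smul_sub])

section Smooth

variable {E H M : Type*} [NormedAddCommGroup E] [NormedSpace ℝ E] [TopologicalSpace H]
  {I : ModelWithCorners ℝ E H} [TopologicalSpace M] [ChartedSpace H M]

theorem contMDiffAt_lieAlg {f : M → LieAlg G} {x : M}
    (hf : ContMDiffAt I 𝓘(ℝ, Vec n →L[ℝ] Vec n) ∞ (fun y => (f y).toEnd) x) :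
    ContMDiffAt I 𝓘(ℝ, LieAlg G) ∞ f x :=
  contMDiffAt_of_injective_linear LieAlg.toEndₗ LieAlg.toEnd_injective hf

theorem contMDiffAt_toEnd_lieAlg {f : M → LieAlg G} {x : M}
    (hf : ContMDiffAt I 𝓘(ℝ, LieAlg G) ∞ f x) :
    ContMDiffAt I 𝓘(ℝ, Vec n →L[ℝ] Vec n) ∞ (fun y => (f y).toEnd) x :=
  LieAlg.contDiff_toEnd.contMDiff.contMDiffAt.comp x hf

theorem contMDiffAt_end_mul {f g : M → Vec n →L[ℝ] Vec n} {x : M}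
    (hf : ContMDiffAt I 𝓘(ℝ, Vec n →L[ℝ] Vec n) ∞ f x)
    (hg : ContMDiffAt I 𝓘(ℝ, Vec n →L[ℝ] Vec n) ∞ g x) :
    ContMDiffAt I 𝓘(ℝ, Vec n →L[ℝ] Vec n) ∞ (fun y => f y * g y) x :=
  hf.clm_comp hg

variable {k : ℕ} [ChartedSpace (Vec k) G]

theorem contMDiff_toEnd
    (hG : Manifold.IsSmoothEmbedding (𝓡 k) 𝓘(ℝ, Vec n →L[ℝ] Vec n) ∞ (fun g : G => toEnd g)) :
    ContMDiff (𝓡 k) 𝓘(ℝ, Vec n →L[ℝ] Vec n) ∞ (fun g : G => toEnd g) :=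
  hG.contMDiff

/-- Smoothness into `G` can be tested after the immersion into the endomorphisms once continuity is
known. There the map is the exponential series, which is analytic; continuity comes from the
embedding. -/
theorem contMDiff_lieExp [IsManifold (𝓡 k) ∞ G]
    (hG : Manifold.IsSmoothEmbedding (𝓡 k) 𝓘(ℝ, Vec n →L[ℝ] Vec n) ∞ (fun g : G => toEnd g)) :
    ContMDiff 𝓘(ℝ, LieAlg G) (𝓡 k) ∞ (lieExp (G := G)) := by
  have h : ContMDiff 𝓘(ℝ, LieAlg G) 𝓘(ℝ, Vec n →L[ℝ] Vec n) ∞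
      ((fun g : G => toEnd g) ∘ lieExp (G := G)) := by
    refine ContDiff.contMDiff (ContDiff.comp (g := exp) ?_ LieAlg.contDiff_toEnd)
    exact contDiff_iff_contDiffAt.2 fun x => (exp_analytic (𝕂 := ℝ) x).contDiffAt
  exact (ContMDiff.iff_comp_isImmersion hG.isImmersion).2
    ⟨hG.isEmbedding.continuous_iff.2 h.continuous, h⟩

theorem contMDiffAt_Ad_inv [LieGroup (𝓡 k) ∞ G]
    (hG : Manifold.IsSmoothEmbedding (𝓡 k) 𝓘(ℝ, Vec n →L[ℝ] Vec n) ∞ (fun g : G => toEnd g))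
    {g : M → G} {f : M → LieAlg G} {x : M} (hg : ContMDiffAt I (𝓡 k) ∞ g x)
    (hf : ContMDiffAt I 𝓘(ℝ, LieAlg G) ∞ f x) :
    ContMDiffAt I 𝓘(ℝ, LieAlg G) ∞ (fun y => Ad (g y)⁻¹ (f y)) x := by
  apply contMDiffAt_lieAlg
  have h1 := (contMDiff_toEnd hG).contMDiffAt.comp x hg.inv
  have h2 := (contMDiff_toEnd hG).contMDiffAt.comp x hg
  refine (contMDiffAt_end_mul (contMDiffAt_end_mul h1 (contMDiffAt_toEnd_lieAlg hf)) h2).congr_of_eventuallyEq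
    (Eventually.of_forall fun y => ?_)
  simp

end Smooth

section InfinitesimalAction

variable {k d : ℕ} [ChartedSpace (Vec k) G]
  {X : Type*} [TopologicalSpace X] [ChartedSpace (Vec d) X]
  [MulAction (G)ᵐᵒᵖ X]

theorem act_mul_right (x : X) (g h : G) : x <• (g * h) = (x <• g) <• h := by
  rw [MulOpposite.op_mul, mul_smul]

theorem act_lieExp_zero (x : X) : x <• lieExp (0 : LieAlg G) = x := by
  rw [lieExp_zero, MulOpposite.op_one, one_smul]

theorem tangentBundle_mk_eq {x y : X} {v w : Vec d} (hxy : x = y) (hvw : v = w) :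
    (⟨x, v⟩ : TangentBundle (𝓡 d) X) = ⟨y, w⟩ := by
  subst hxy hvw; rfl

theorem contMDiff_act_right (k : ℕ) [ChartedSpace (Vec k) G] [SmoothRightAction G k d X] (g : G) :
    ContMDiff (𝓡 d) (𝓡 d) ∞ (fun x : X => x <• g) :=
  (SmoothRightAction.contMDiff_act (G := G) (k := k) (d := d) (X := X)).comp
    (contMDiff_id.prodMk contMDiff_const)

variable [LieGroup (𝓡 k) ∞ G] [SmoothRightAction G k d X]

theorem contMDiff_act_lieExp
    (hG : Manifold.IsSmoothEmbedding (𝓡 k) 𝓘(ℝ, Vec n →L[ℝ] Vec n) ∞ (fun g : G => toEnd g)) :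
    ContMDiff ((𝓡 d).prod 𝓘(ℝ, LieAlg G)) (𝓡 d) ∞
      (fun p : X × LieAlg G => p.1 <• lieExp p.2) :=
  (SmoothRightAction.contMDiff_act (G := G) (k := k) (d := d) (X := X)).comp
    (contMDiff_fst.prodMk ((contMDiff_lieExp hG).comp contMDiff_snd))

theorem contMDiff_orbit
    (hG : Manifold.IsSmoothEmbedding (𝓡 k) 𝓘(ℝ, Vec n →L[ℝ] Vec n) ∞ (fun g : G => toEnd g))
    (x : X) : ContMDiff 𝓘(ℝ, LieAlg G) (𝓡 d) ∞ (fun β : LieAlg G => x <• lieExp β) :=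
  (contMDiff_act_lieExp hG).comp (contMDiff_const.prodMk contMDiff_id)

/-- The infinitesimal action `α ↦ ψ(α)_x` as a continuous linear map. -/
noncomputable def infActL (d : ℕ) {X : Type*} [TopologicalSpace X]
    [ChartedSpace (Vec d) X] [MulAction (G)ᵐᵒᵖ X] (x : X) :
    LieAlg G →L[ℝ] TangentSpace (𝓡 d) x :=
  mfderiv 𝓘(ℝ, LieAlg G) (𝓡 d) (fun β : LieAlg G => x <• lieExp β) 0

theorem mdifferentiableAt_smul_const (α : LieAlg G) (t : ℝ) :
    MDifferentiableAt 𝓘(ℝ, ℝ) 𝓘(ℝ, LieAlg G) (fun t : ℝ => t • α) t :=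
  (differentiableAt_id.smul_const α).mdifferentiableAt

/-- Chain rule along `t ↦ tα` for the orbit map `β ↦ x · exp β`. It is the source of the linearity
of `ψ(α)_x` in `α`, which is not visible in the definition by curves. -/
theorem infAct_eq
    (hG : Manifold.IsSmoothEmbedding (𝓡 k) 𝓘(ℝ, Vec n →L[ℝ] Vec n) ∞ (fun g : G => toEnd g))
    (α : LieAlg G) (x : X) : infAct d α x = infActL d x α := by
  have h := mfderiv_comp_apply_of_eq (I := 𝓘(ℝ, ℝ)) (I' := 𝓘(ℝ, LieAlg G)) (I'' := 𝓡 d) (0 : ℝ)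
    (f := fun t : ℝ => t • α) (g := fun β : LieAlg G => x <• lieExp β) (y := 0)
    ((contMDiff_orbit hG x).mdifferentiable (by simp) 0)
    (mdifferentiableAt_smul_const α 0) (zero_smul ℝ α) (1 : ℝ)
  refine h.trans (congrArg _ ?_)
  rw [mfderiv_eq_fderiv]
  change fderiv ℝ (fun t : ℝ => t • α) 0 1 = α
  rw [fderiv_smul_const differentiableAt_id]
  simp

theorem mdifferentiableAt_orbit_line
    (hG : Manifold.IsSmoothEmbedding (𝓡 k) 𝓘(ℝ, Vec n →L[ℝ] Vec n) ∞ (fun g : G => toEnd g))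
    (α : LieAlg G) (x : X) (t : ℝ) :
    MDifferentiableAt 𝓘(ℝ, ℝ) (𝓡 d) (fun t : ℝ => x <• lieExp (t • α)) t :=
  MDifferentiableAt.comp t ((contMDiff_orbit hG x).mdifferentiable (by simp) (t • α))
    (mdifferentiableAt_smul_const α t)

/-- By `mul_lieExp`, translation by `g` carries the curve `x · exp(tα)` to the orbit curve of `x g`
in the direction `Ad_{g⁻¹} α`. -/
theorem mfderiv_act_infAct
    (hG : Manifold.IsSmoothEmbedding (𝓡 k) 𝓘(ℝ, Vec n →L[ℝ] Vec n) ∞ (fun g : G => toEnd g))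
    (g : G) (α : LieAlg G) (x : X) :
    mfderiv (𝓡 d) (𝓡 d) (fun y : X => y <• g) x (infAct d α x)
      = infAct d (Ad g⁻¹ α) (x <• g) := by
  have h := mfderiv_comp_apply_of_eq (I := 𝓘(ℝ, ℝ)) (I' := 𝓡 d) (I'' := 𝓡 d) (0 : ℝ)
    (f := fun t : ℝ => x <• lieExp (t • α)) (g := fun y : X => y <• g) (y := x)
    ((contMDiff_act_right k g).mdifferentiable (by simp) x)
    (mdifferentiableAt_orbit_line hG α x 0)
    (by rw [zero_smul, act_lieExp_zero]) (1 : ℝ)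
  refine h.symm.trans ?_
  have e : (fun y : X => y <• g) ∘ (fun t : ℝ => x <• lieExp (t • α))
      = fun t : ℝ => (x <• g) <• lieExp (t • Ad g⁻¹ α) := by
    ext1 t
    change (x <• lieExp (t • α)) <• g = _
    rw [← act_mul_right, ← act_mul_right, mul_lieExp, Ad_smul]
  exact congrArg (fun f : ℝ → X => (mfderiv 𝓘(ℝ, ℝ) (𝓡 d) f 0 (1 : ℝ) : Vec d)) e

/-- Joint smoothness: `ψ(α)_x` is the tangent map of `(x, β) ↦ x · exp β` at `(x, 0)`, applied to
the vector `(0, α)`, and tangent maps of smooth maps are smooth. -/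
theorem contMDiff_infAct [IsManifold (𝓡 d) ∞ X]
    (hG : Manifold.IsSmoothEmbedding (𝓡 k) 𝓘(ℝ, Vec n →L[ℝ] Vec n) ∞ (fun g : G => toEnd g)) :
    ContMDiff ((𝓡 d).prod 𝓘(ℝ, LieAlg G)) (𝓡 d).tangent ∞
      (fun p : X × LieAlg G => (⟨p.1, infAct d p.2 p.1⟩ : TangentBundle (𝓡 d) X)) := by
  have i1 := isManifold_one d X
  have h1 := (contMDiff_act_lieExp (X := X) (d := d) hG).contMDiff_tangentMap (m := ∞) (by simp)
  have h2 : ContMDiff ((𝓡 d).prod 𝓘(ℝ, LieAlg G)) 𝓘(ℝ, LieAlg G).tangent ∞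
      (fun p : X × LieAlg G => (⟨0, p.2⟩ : TangentBundle 𝓘(ℝ, LieAlg G) (LieAlg G))) := by
    intro p
    rw [contMDiffAt_totalSpace]
    refine ⟨contMDiffAt_const, ?_⟩
    simpa using contMDiffAt_snd
  have h3 : ContMDiff ((𝓡 d).prod 𝓘(ℝ, LieAlg G)) (𝓡 d).tangent ∞
      (fun p : X × LieAlg G => (⟨p.1, 0⟩ : TangentBundle (𝓡 d) X)) :=
    (contMDiff_zeroSection ℝ (fun x : X => TangentSpace (𝓡 d) x)).comp contMDiff_fst
  have h4 := h1.comp ((contMDiff_equivTangentBundleProd_symm (I := 𝓡 d) (M := X)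
    (I' := 𝓘(ℝ, LieAlg G)) (M' := LieAlg G) (n := ∞)).comp (h3.prodMk h2))
  convert h4 using 1
  ext1 p
  refine tangentBundle_mk_eq (act_lieExp_zero p.1).symm ?_
  have h5 := mfderiv_comp_apply_of_eq (I := 𝓘(ℝ, LieAlg G)) (I' := (𝓡 d).prod 𝓘(ℝ, LieAlg G))
    (I'' := 𝓡 d) (0 : LieAlg G)
    (f := fun β : LieAlg G => (p.1, β)) (g := fun q : X × LieAlg G => q.1 <• lieExp q.2)
    (y := (p.1, 0))
    ((contMDiff_act_lieExp hG).mdifferentiable (by simp) _)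
    (mdifferentiableAt_const.prodMk mdifferentiableAt_id) rfl p.2
  rw [infAct_eq hG]
  refine h5.trans (congrArg _ ?_)
  rw [mfderiv_prod_right]
  rfl

end InfinitesimalAction
end LieGroupMaps

/-! ### The algebroid differential of one-forms: tensoriality and pull-back -/

section Forms

variable {d : ℕ} {X : Type*} [TopologicalSpace X] [ChartedSpace (Vec d) X]
  {V W : Type*} [NormedAddCommGroup V] [NormedSpace ℝ V] [NormedAddCommGroup W] [NormedSpace ℝ W]

theorem mvfderiv_clm_apply {f : X → V →L[ℝ] W} {a : X → V} {x : X}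
    (hf : MDifferentiableAt (𝓡 d) 𝓘(ℝ, V →L[ℝ] W) f x)
    (ha : MDifferentiableAt (𝓡 d) 𝓘(ℝ, V) a x) (v : TangentSpace (𝓡 d) x) :
    mvfderiv (𝓡 d) (fun y => f y (a y)) x v
      = mvfderiv (𝓡 d) f x v (a x) + f x (mvfderiv (𝓡 d) a x v) := by
  have hB := isBoundedBilinearMap_apply (𝕜 := ℝ) (E := V) (F := W)
  have h := mfderiv_comp_apply (I := 𝓡 d) (I' := 𝓘(ℝ, (V →L[ℝ] W) × V)) (I'' := 𝓘(ℝ, W)) x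
    (f := fun y => (f y, a y)) (g := fun q : (V →L[ℝ] W) × V => q.1 q.2)
    (hB.differentiableAt _).mdifferentiableAt (hf.prodMk_space ha) v
  rw [mfderiv_eq_fderiv, hB.fderiv] at h
  have h1 : mvfderiv (𝓡 d) (fun y => (f y, a y)) x v
      = (mvfderiv (𝓡 d) f x v, mvfderiv (𝓡 d) a x v) := by
    have h2 := mvfderiv_clm_comp (ContinuousLinearMap.fst ℝ (V →L[ℝ] W) V) (hf.prodMk_space ha) v
    have h3 := mvfderiv_clm_comp (ContinuousLinearMap.snd ℝ (V →L[ℝ] W) V) (hf.prodMk_space ha) v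
    exact Prod.ext h2.symm h3.symm
  have h4 : mvfderiv (𝓡 d) (fun y => f y (a y)) x v
      = hB.deriv (f x, a x) (mvfderiv (𝓡 d) (fun y => (f y, a y)) x v) := h
  rw [h4, h1]
  exact add_comm _ _

theorem mvfderiv_add_apply {f g : X → W} {x : X} (hf : MDifferentiableAt (𝓡 d) 𝓘(ℝ, W) f x)
    (hg : MDifferentiableAt (𝓡 d) 𝓘(ℝ, W) g x) (v : TangentSpace (𝓡 d) x) :
    mvfderiv (𝓡 d) (fun y => f y + g y) x v = mvfderiv (𝓡 d) f x v + mvfderiv (𝓡 d) g x v :=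
  DFunLike.congr_fun (mvfderiv_add hf hg) v

theorem mvfderiv_smul_apply {f : X → ℝ} {g : X → W} {x : X}
    (hf : MDifferentiableAt (𝓡 d) 𝓘(ℝ, ℝ) f x)
    (hg : MDifferentiableAt (𝓡 d) 𝓘(ℝ, W) g x) (v : TangentSpace (𝓡 d) x) :
    mvfderiv (𝓡 d) (fun y => f y • g y) x v
      = f x • mvfderiv (𝓡 d) g x v + mvfderiv (𝓡 d) f x v • g x :=
  DFunLike.congr_fun (mvfderiv_smul hf hg) v

theorem mvfderiv_const_apply (c : W) {x : X} (v : TangentSpace (𝓡 d) x) :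
    mvfderiv (𝓡 d) (fun _ : X => c) x v = 0 :=
  DFunLike.congr_fun (mvfderiv_const c) v

variable [IsManifold (𝓡 d) ∞ X] {FA : Type*} [NormedAddCommGroup FA] [NormedSpace ℝ FA]
  {A : X → Type*} [∀ x, AddCommGroup (A x)] [∀ x, Module ℝ (A x)] [∀ x, TopologicalSpace (A x)]
  [TopologicalSpace (TotalSpace FA A)] [FiberBundle FA A] [VectorBundle ℝ FA A]

theorem IsSmoothForm.contMDiff_apply {η : ∀ x, A x →L[ℝ] W} (hη : IsSmoothForm d FA η)
    (s : Sec d FA A) : ContMDiff (𝓡 d) 𝓘(ℝ, W) ∞ (fun x => η x (s x)) :=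
  ContMDiff.comp (g := fun v : TotalSpace FA A => η v.1 v.2) hη s.contMDiff

theorem IsSmoothForm.mdifferentiableAt {η : ∀ x, A x →L[ℝ] W} (hη : IsSmoothForm d FA η)
    (s : Sec d FA A) (x : X) : MDifferentiableAt (𝓡 d) 𝓘(ℝ, W) (fun x => η x (s x)) x :=
  (hη.contMDiff_apply s).mdifferentiable (by simp) x

namespace LieAlgebroid

variable (L : LieAlgebroid d FA A) {η : ∀ x, A x →L[ℝ] W}

theorem dForm_skew (s t : Sec d FA A) (x : X) : L.dForm η s t x = -L.dForm η t s x := by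
  have h : L.bracket s t x = -L.bracket t s x := by rw [L.bracket_skew s t]; rfl
  simp only [dForm, h, map_neg]
  abel

theorem dForm_add (hη : IsSmoothForm d FA η) (s t u : Sec d FA A) (x : X) :
    L.dForm η s (t + u) x = L.dForm η s t x + L.dForm η s u x := by
  have h : L.bracket s (t + u) x = L.bracket s t x + L.bracket s u x := by
    rw [L.bracket_add s t u]; rfl
  have h2 : ∀ y, (t + u) y = t y + u y := fun _ => rfl
  simp only [dForm, h, h2, map_add]
  rw [mvfderiv_add_apply (hη.mdifferentiableAt t x) (hη.mdifferentiableAt u x)]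
  abel

/-- The derivative of `f` from the product rule cancels against the anchor term of the Leibniz
identity. With `dForm_skew` this makes the differential tensorial in both arguments. -/
theorem dForm_smul (hη : IsSmoothForm d FA η) (s t : Sec d FA A) (f : C^∞⟮𝓡 d, X; ℝ⟯) (x : X) :
    L.dForm η s (smulSec f t) x = f x • L.dForm η s t x := by
  have h2 : ∀ y, smulSec f t y = f y • t y := fun _ => rfl
  simp only [dForm, L.leibniz, h2, map_smul, map_add]
  rw [mvfderiv_smul_apply (f.contMDiff.mdifferentiable (by simp) x) (hη.mdifferentiableAt t x)]
  simp only [smul_sub]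
  abel

section Frame

variable [FiniteDimensional ℝ V] {T : ∀ x, A x →L[ℝ] V} {e : V → Sec d FA A}

/-- The section `t` is a combination of frame sections whose smooth coefficients are the coordinates
of `T t`; tensoriality in `t` then gives the value. -/
theorem dForm_eq_of_frame_right (hη : IsSmoothForm d FA η) (hT : IsSmoothForm d FA T)
    (hinj : ∀ x, Function.Injective (T x)) (he : ∀ v x, T x (e v x) = v)
    (s : Sec d FA A) (x : X) (β : V →ₗ[ℝ] W) (h : ∀ v, L.dForm η s (e v) x = β v)
    (t : Sec d FA A) : L.dForm η s t x = β (T x (t x)) := by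
  let b := Module.finBasis ℝ V
  let f : Fin (Module.finrank ℝ V) → C^∞⟮𝓡 d, X; ℝ⟯ := fun i =>
    ⟨fun y => b.coord i (T y (t y)),
      (LinearMap.toContinuousLinearMap (b.coord i)).contDiff.contMDiff.comp (hT.contMDiff_apply t)⟩
  have ht : t = ∑ i, smulSec (f i) (e (b i)) := by
    ext y
    apply hinj y
    have h1 : (∑ i, smulSec (f i) (e (b i))) y = ∑ i, f i y • e (b i) y := by
      have := map_sum (ContMDiffSection.coeAddHom (𝓡 d) FA ∞ A) (fun i => smulSec (f i) (e (b i)))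
        Finset.univ
      refine (congrFun this y).trans ?_
      rw [Finset.sum_apply]; rfl
    rw [h1, map_sum]
    simp only [map_smul, he]
    exact (b.sum_repr (T y (t y))).symm
  let Δ : Sec d FA A →+ W := AddMonoidHom.mk' (fun t => L.dForm η s t x)
    fun t u => L.dForm_add hη s t u x
  have h2 : L.dForm η s t x = ∑ i, f i x • β (b i) := by
    conv_lhs => rw [ht]
    refine (map_sum Δ _ _).trans (Finset.sum_congr rfl fun i _ => ?_)
    exact (L.dForm_smul hη s _ _ x).trans (by rw [h])
  rw [h2]
  conv_rhs => rw [← b.sum_repr (T x (t x)), map_sum]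
  refine Finset.sum_congr rfl fun i _ => ?_
  rw [map_smul]; rfl

/-- The differential of a form is determined by its values on a global frame. -/
theorem dForm_eq_of_frame (hη : IsSmoothForm d FA η) (hT : IsSmoothForm d FA T)
    (hinj : ∀ x, Function.Injective (T x)) (he : ∀ v x, T x (e v x) = v)
    (x : X) (β : V →ₗ[ℝ] V →ₗ[ℝ] W) (h : ∀ v w, L.dForm η (e v) (e w) x = β v w)
    (s t : Sec d FA A) : L.dForm η s t x = β (T x (s x)) (T x (t x)) := by
  refine L.dForm_eq_of_frame_right hη hT hinj he s x (β (T x (s x))) (fun w => ?_) t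
  rw [dForm_skew, L.dForm_eq_of_frame_right hη hT hinj he (e w) x (-β.flip w) (fun v => ?_) s]
  · simp
  · rw [dForm_skew, h]; simp

end Frame

end LieAlgebroid

section Pullback

variable {d' : ℕ} {Y : Type*} [TopologicalSpace Y] [ChartedSpace (Vec d') Y]
  [IsManifold (𝓡 d') ∞ Y] {V₁ V₂ : Type*}
  [NormedAddCommGroup V₁] [NormedSpace ℝ V₁] [FiniteDimensional ℝ V₁] [NormedAddCommGroup V₂]
  [NormedSpace ℝ V₂] [FiniteDimensional ℝ V₂]

/-- A form on a trivial bundle as a map into the linear maps. -/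
abbrev trivFormFun {V₁ V₂ W Y : Type*} [NormedAddCommGroup V₁] [NormedSpace ℝ V₁]
    [NormedAddCommGroup V₂] [NormedSpace ℝ V₂] [NormedAddCommGroup W] [NormedSpace ℝ W]
    (η : ∀ y, Bundle.Trivial Y (V₁ × V₂) y →L[ℝ] W) : Y → (V₁ × V₂) →L[ℝ] W := η

theorem contMDiff_form_trivial [FiniteDimensional ℝ W]
    {η : ∀ y : Y, Bundle.Trivial Y (V₁ × V₂) y →L[ℝ] W} (hη : IsSmoothForm d' (V₁ × V₂) η) :
    ContMDiff (𝓡 d') 𝓘(ℝ, (V₁ × V₂) →L[ℝ] W) ∞ (trivFormFun η) := fun _ =>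
  contMDiffAt_clm_of_apply fun v =>
    (hη.contMDiff_apply (trivSec (fun _ => v) contMDiff_const)).contMDiffAt

/-- Product rule for `η ∘ φ`, a map into linear maps, applied to `Φ`. The result involves the source
algebroid only through `dφ ∘ ρ` and the differential of `Φ`, so morphism conditions need checking
only on these two. -/
theorem LieAlgebroid.dForm_comp [FiniteDimensional ℝ W] (L : LieAlgebroid d FA A)
    {φ : X → Y} (hφ : ContMDiff (𝓡 d) (𝓡 d') ∞ φ) {Φ : ∀ x, A x →L[ℝ] V₁ × V₂} (hΦ : IsSmoothForm d FA Φ)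
    {η : ∀ y : Y, Bundle.Trivial Y (V₁ × V₂) y →L[ℝ] W} (hη : IsSmoothForm d' (V₁ × V₂) η) (s t : Sec d FA A) (x : X) :
    L.dForm (W := W) (fun z => ContinuousLinearMap.comp (η (φ z)) (Φ z)) s t x
      = mvfderiv (𝓡 d') (trivFormFun η) (φ x)
          (mfderiv (𝓡 d) (𝓡 d') φ x (L.anchor x (s x))) (Φ x (t x))
        - mvfderiv (𝓡 d') (trivFormFun η) (φ x)
          (mfderiv (𝓡 d) (𝓡 d') φ x (L.anchor x (t x))) (Φ x (s x))
        + η (φ x) (L.dForm Φ s t x) := by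
  have hη' := contMDiff_form_trivial hη
  have key : ∀ (u : Sec d FA A) (v : TangentSpace (𝓡 d) x),
      mvfderiv (𝓡 d) (fun z => η (φ z) (Φ z (u z))) x v
        = mvfderiv (𝓡 d') (trivFormFun η) (φ x) (mfderiv (𝓡 d) (𝓡 d') φ x v) (Φ x (u x))
          + η (φ x) (mvfderiv (𝓡 d) (fun z => Φ z (u z)) x v) := by
    intro u v
    have h1 : MDifferentiableAt (𝓡 d) 𝓘(ℝ, (V₁ × V₂) →L[ℝ] W) (fun z => trivFormFun η (φ z)) x :=
      (hη'.comp hφ).mdifferentiable (by simp) x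
    refine (mvfderiv_clm_apply h1 (hΦ.mdifferentiableAt u x) v).trans ?_
    congr 2
    exact mfderiv_comp_apply x (hη'.mdifferentiable (by simp) (φ x))
      (hφ.mdifferentiable (by simp) x) v
  simp only [dForm, ContinuousLinearMap.comp_apply]
  rw [key, key]
  erw [map_sub, map_sub]
  abel

/-- The identity of `V₁ × V₂` as a form on a trivial bundle. -/
abbrev trivForm (V₁ V₂ : Type*) [NormedAddCommGroup V₁] [NormedSpace ℝ V₁] [NormedAddCommGroup V₂]
    [NormedSpace ℝ V₂] {Y : Type*} (y : Y) : Bundle.Trivial Y (V₁ × V₂) y →L[ℝ] V₁ × V₂ :=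
  ContinuousLinearMap.id ℝ (V₁ × V₂)

theorem isSmoothForm_trivForm : IsSmoothForm d' (V₁ × V₂) (trivForm V₁ V₂ (Y := Y)) := contMDiff_trivial_snd

/-- A bundle map to a trivial bundle is compatible with differentials of all forms if it is so for
the constant forms. -/
theorem dForm_comm_of_structure_equation (L : LieAlgebroid d FA A)
    (L' : LieAlgebroid d' (V₁ × V₂) (Bundle.Trivial Y (V₁ × V₂)))
    {φ : X → Y} (hφ : ContMDiff (𝓡 d) (𝓡 d') ∞ φ)
    {Φ : ∀ x, A x →L[ℝ] V₁ × V₂} (hΦ : IsSmoothForm d FA Φ)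
    (hanchor : ∀ x ξ, mfderiv (𝓡 d) (𝓡 d') φ x (L.anchor x ξ) = L'.anchor (φ x) (Φ x ξ))
    (B : Y → V₁ × V₂ → V₁ × V₂ → V₁ × V₂) (hB : ∀ s t x, L.dForm Φ s t x = -B (φ x) (Φ x (s x)) (Φ x (t x)))
    (hB' : ∀ s t y, L'.dForm (trivForm V₁ V₂) s t y = -B y (s y) (t y))
    {η : ∀ y : Y, Bundle.Trivial Y (V₁ × V₂) y →L[ℝ] ℝ} (hη : IsSmoothForm d' (V₁ × V₂) η)
    (s s' : Sec d FA A) (x : X) (t t' : Sec d' (V₁ × V₂) (Bundle.Trivial Y (V₁ × V₂)))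
    (ht : t (φ x) = Φ x (s x)) (ht' : t' (φ x) = Φ x (s' x)) :
    L.dForm (W := ℝ) (fun z => ContinuousLinearMap.comp (η (φ z)) (Φ z)) s s' x
      = L'.dForm η t t' (φ x) := by
  -- The right-hand side is the same formula for the identity of `Y` and the identity form, so the
  -- two sides agree term by term.
  have h := L'.dForm_comp (W := ℝ) (φ := id) contMDiff_id isSmoothForm_trivForm hη t t' (φ x)
  rw [L.dForm_comp (W := ℝ) hφ hΦ hη, hanchor, hanchor, hB]
  refine Eq.trans ?_ h.symm
  rw [hB', mfderiv_id, ht, ht']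
  rfl

end Pullback

end Forms

/-! ### Brackets on a trivial bundle determined by constant sections -/

section FrameData

variable {d : ℕ} {X : Type*} [TopologicalSpace X] [ChartedSpace (Vec d) X] [IsManifold (𝓡 d) ∞ X]
  {V V₁ V₂ : Type*} [NormedAddCommGroup V] [NormedSpace ℝ V] [NormedAddCommGroup V₁]
  [NormedSpace ℝ V₁] [NormedAddCommGroup V₂] [NormedSpace ℝ V₂]

variable (d X V) in
/-- The anchor and the brackets of constant sections of an algebroid on a trivial bundle. -/
structure FrameData where
  anchor : ∀ x : X, V →L[ℝ] TangentSpace (𝓡 d) x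
  anchor_smooth : ContMDiff ((𝓡 d).prod 𝓘(ℝ, V)) (𝓡 d).tangent ∞
    (fun p : X × V => (⟨p.1, anchor p.1 p.2⟩ : TangentBundle (𝓡 d) X))
  br : X → V →L[ℝ] V →L[ℝ] V
  br_smooth : ContMDiff (𝓡 d) 𝓘(ℝ, V →L[ℝ] V →L[ℝ] V) ∞ br
  br_skew : ∀ x v w, br x v w = -br x w v

namespace FrameData

theorem contMDiff_anchor_apply (K : FrameData d X V) {f : X → V} (hf : ContMDiff (𝓡 d) 𝓘(ℝ, V) ∞ f) :
    ContMDiff (𝓡 d) (𝓡 d).tangent ∞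
      (fun x => (⟨x, K.anchor x (f x)⟩ : TangentBundle (𝓡 d) X)) :=
  K.anchor_smooth.comp (contMDiff_id.prodMk hf)

variable (K : FrameData d X (V₁ × V₂))

/-- The bracket of sections determined by the brackets of constant sections. -/
noncomputable def bracket (s t : Sec d (V₁ × V₂) (Bundle.Trivial X (V₁ × V₂))) : Sec d (V₁ × V₂) (Bundle.Trivial X (V₁ × V₂)) :=
  trivSec (fun x => K.br x (s x) (t x)
      + mvfderiv (𝓡 d) (fun y => (t y : V₁ × V₂)) x (K.anchor x (s x))
      - mvfderiv (𝓡 d) (fun y => (s y : V₁ × V₂)) x (K.anchor x (t x))) <| by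
    have hs := contMDiff_trivial_section s
    have ht := contMDiff_trivial_section t
    refine (((K.br_smooth.clm_apply hs).clm_apply ht).add fun x => ?_).sub fun x => ?_
    · exact contMDiffAt_mvfderiv_apply (ht x) (K.contMDiff_anchor_apply hs x)
    · exact contMDiffAt_mvfderiv_apply (hs x) (K.contMDiff_anchor_apply ht x)

theorem bracket_apply (s t : Sec d (V₁ × V₂) (Bundle.Trivial X (V₁ × V₂))) (x : X) :
    K.bracket s t x = K.br x (s x) (t x)
      + mvfderiv (𝓡 d) (fun y => (t y : V₁ × V₂)) x (K.anchor x (s x))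
      - mvfderiv (𝓡 d) (fun y => (s y : V₁ × V₂)) x (K.anchor x (t x)) := rfl

theorem mdifferentiableAt_trivial_section (s : Sec d (V₁ × V₂) (Bundle.Trivial X (V₁ × V₂))) (x : X) :
    MDifferentiableAt (𝓡 d) 𝓘(ℝ, V₁ × V₂) (fun x => (s x : V₁ × V₂)) x :=
  (contMDiff_trivial_section s).mdifferentiable (by simp) x

/-- The Lie algebroid on a trivial bundle with given brackets of constant sections. -/
noncomputable def toLieAlgebroid
    (hJ : ∀ s t u, K.bracket s (K.bracket t u)
      = K.bracket (K.bracket s t) u + K.bracket t (K.bracket s u))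
    (hA : ∀ (s t : Sec d (V₁ × V₂) (Bundle.Trivial X (V₁ × V₂))) (x : X), K.anchor x (K.bracket s t x)
      = VectorField.mlieBracket (𝓡 d) (fun y => K.anchor y (s y)) (fun y => K.anchor y (t y)) x) :
    LieAlgebroid d (V₁ × V₂) (Bundle.Trivial X (V₁ × V₂)) where
  anchor := K.anchor
  anchor_smooth := K.anchor_smooth.comp
    (f := fun v : TotalSpace (V₁ × V₂) (Bundle.Trivial X (V₁ × V₂)) => ((v.1, v.2) : X × (V₁ × V₂)))
    ((contMDiff_proj (Bundle.Trivial X (V₁ × V₂))).prodMk contMDiff_trivial_snd)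
  bracket := K.bracket
  bracket_add s t u := by
    refine ContMDiffSection.ext fun x => ?_
    change (_ : V₁ × V₂) = (_ : V₁ × V₂) + _
    rw [bracket_apply, bracket_apply, bracket_apply]
    have h : ∀ y, (t + u) y = t y + u y := fun _ => rfl
    simp only [h, map_add]
    rw [mvfderiv_add_apply (mdifferentiableAt_trivial_section t x)
      (mdifferentiableAt_trivial_section u x)]
    abel
  bracket_skew s t := by
    refine ContMDiffSection.ext fun x => ?_
    change (_ : V₁ × V₂) = -(_ : V₁ × V₂)
    rw [bracket_apply, bracket_apply, K.br_skew]
    abel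
  leibniz s t f x := by
    have h : ∀ y, smulSec f t y = f y • t y := fun _ => rfl
    rw [bracket_apply, bracket_apply]
    simp only [h, map_smul]
    rw [mvfderiv_smul_apply (f.contMDiff.mdifferentiable (by simp) x)
      (mdifferentiableAt_trivial_section t x)]
    simp only [smul_sub, smul_add]
    abel
  jacobi := hJ
  anchor_bracket := hA

variable [FiniteDimensional ℝ V₁] [FiniteDimensional ℝ V₂]

/-- The differential of the tautological form of an algebroid on a trivial bundle. -/
theorem dForm_trivForm (L : LieAlgebroid d (V₁ × V₂) (Bundle.Trivial X (V₁ × V₂)))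
    (hL : ∀ v w x, L.bracket (trivSec (fun _ => v) contMDiff_const)
      (trivSec (fun _ => w) contMDiff_const) x = K.br x v w)
    (s t : Sec d (V₁ × V₂) (Bundle.Trivial X (V₁ × V₂))) (x : X) :
    L.dForm (trivForm V₁ V₂) s t x = -K.br x (s x) (t x) := by
  refine L.dForm_eq_of_frame (e := fun v => trivSec (fun _ => v) contMDiff_const)
    isSmoothForm_trivForm isSmoothForm_trivForm (fun x => Function.injective_id) (fun v x => rfl)
    x (-((ContinuousLinearMap.coeLM ℝ).comp (K.br x).toLinearMap)) (fun v w => ?_) s t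
  have h : L.dForm (trivForm V₁ V₂) (trivSec (fun _ => v) contMDiff_const)
      (trivSec (fun _ => w) contMDiff_const) x
      = mvfderiv (𝓡 d) (fun _ : X => w) x (L.anchor x v)
        - mvfderiv (𝓡 d) (fun _ : X => v) x (L.anchor x w) - K.br x v w :=
    congrArg _ (hL v w x)
  rw [h, mvfderiv_const_apply, mvfderiv_const_apply]
  simp

/-- The identity form returns the section itself, so its differential is the two derivative terms
minus the bracket. That differential is tensorial and hence known from constant sections; solving
for the bracket leaves no freedom. -/
theorem bracket_eq (L : LieAlgebroid d (V₁ × V₂) (Bundle.Trivial X (V₁ × V₂)))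
    (hanchor : ∀ x v, L.anchor x v = K.anchor x v)
    (hL : ∀ v w x, L.bracket (trivSec (fun _ => v) contMDiff_const)
      (trivSec (fun _ => w) contMDiff_const) x = K.br x v w) :
    L.bracket = K.bracket := by
  funext s t
  refine ContMDiffSection.ext fun x => ?_
  have h := K.dForm_trivForm L hL s t x
  have h2 : L.dForm (trivForm V₁ V₂) s t x
      = mvfderiv (𝓡 d) (fun y => (t y : V₁ × V₂)) x (L.anchor x (s x))
        - mvfderiv (𝓡 d) (fun y => (s y : V₁ × V₂)) x (L.anchor x (t x)) - (L.bracket s t x : V₁ × V₂) := rfl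
  rw [h2, hanchor, hanchor] at h
  rw [bracket_apply]
  generalize (L.bracket s t x : V₁ × V₂) = z at h ⊢
  rw [sub_eq_iff_eq_add] at h
  rw [add_sub_assoc, h]
  abel

end FrameData
end FrameData

/-! ### Descent of the algebroid identities along a frame lift -/

section Lift

variable {d m : ℕ} {X P : Type*} [TopologicalSpace X] [ChartedSpace (Vec d) X]
  [IsManifold (𝓡 d) ∞ X] [TopologicalSpace P] [ChartedSpace (Vec m) P] [IsManifold (𝓡 m) ∞ P]
  {V V₁ V₂ : Type*} [NormedAddCommGroup V] [NormedSpace ℝ V] [NormedAddCommGroup V₁]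
  [NormedSpace ℝ V₁] [NormedAddCommGroup V₂] [NormedSpace ℝ V₂]
  {FB : Type*} [NormedAddCommGroup FB] [NormedSpace ℝ FB]
  {B : P → Type*} [∀ x, AddCommGroup (B x)] [∀ x, Module ℝ (B x)] [∀ x, TopologicalSpace (B x)]
  [TopologicalSpace (TotalSpace FB B)] [FiberBundle FB B] [VectorBundle ℝ FB B]

/-- The algebroid `L` over `P` is, through the form `T` and the map `h : P → X`, a pull-back of the
bracket on `X × V` given by `K`: `T` is fibrewise bijective and satisfies the structure
equations. -/
structure IsFrameLift (L : LieAlgebroid m FB B) (K : FrameData d X V) (h : P → X)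
    (T : ∀ p, B p →L[ℝ] V) : Prop where
  smooth_base : ContMDiff (𝓡 m) (𝓡 d) ∞ h
  smooth : IsSmoothForm m FB T
  bijective : ∀ p, Function.Bijective (T p)
  anchor : ∀ p ξ, mfderiv (𝓡 m) (𝓡 d) h p (L.anchor p ξ) = K.anchor (h p) (T p ξ)
  structure_eq : ∀ s t p, L.dForm T s t p = -K.br (h p) (T p (s p)) (T p (t p))

namespace IsFrameLift

variable {L : LieAlgebroid m FB B} {K : FrameData d X (V₁ × V₂)} {h : P → X} {T : ∀ p, B p →L[ℝ] V₁ × V₂}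
  [FiniteDimensional ℝ V₁] [FiniteDimensional ℝ V₂] [FiniteDimensional ℝ FB] [ContMDiffVectorBundle ∞ FB B (𝓡 m)]

/-- The lift of `s` is `T⁻¹(s ∘ h)`. On two lifts the structure equation determines `T` of their
bracket: by the anchor equation and the chain rule, the derivatives of `T` along lifts are
derivatives on `X` along `K.anchor`, so the terms assemble to `K.bracket`. -/
theorem exists_lift (H : IsFrameLift L K h T) :
    ∃ lift : Sec d (V₁ × V₂) (Bundle.Trivial X (V₁ × V₂)) → Sec m FB B,
      (∀ s p, T p (lift s p) = s (h p)) ∧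
      ∀ s t, L.bracket (lift s) (lift t) = lift (K.bracket s t) := by
  obtain ⟨Ti, hTiT, hTTi, hTi⟩ := exists_inverse_form T H.smooth H.bijective
  let lift : Sec d (V₁ × V₂) (Bundle.Trivial X (V₁ × V₂)) → Sec m FB B := fun s =>
    ⟨fun p => Ti p (s (h p)), hTi.comp
      (contMDiff_id.prodMk ((contMDiff_trivial_section s).comp H.smooth_base))⟩
  have hlift : ∀ s p, T p (lift s p) = s (h p) := fun s p => hTTi _ _
  refine ⟨lift, hlift, fun s t => ?_⟩
  ext p
  apply (H.bijective p).1
  rw [hlift, FrameData.bracket_apply]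
  have h1 := H.structure_eq (lift s) (lift t) p
  have key : ∀ u v : Sec d (V₁ × V₂) (Bundle.Trivial X (V₁ × V₂)),
      mvfderiv (𝓡 m) (fun q => T q (lift u q)) p (L.anchor p (lift v p))
        = mvfderiv (𝓡 d) (fun y => (u y : V₁ × V₂)) (h p) (K.anchor (h p) (v (h p))) := by
    intro u v
    have e : (fun q => T q (lift u q)) = fun q => (u (h q) : V₁ × V₂) := funext fun q => hlift u q
    rw [e, ← hlift v p, ← H.anchor]
    exact mfderiv_comp_apply p (FrameData.mdifferentiableAt_trivial_section u (h p))
      (H.smooth_base.mdifferentiable (by simp) p) _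
  rw [LieAlgebroid.dForm, key, key, hlift, hlift, sub_eq_iff_eq_add] at h1
  rw [add_sub_assoc, h1]
  abel

/-- The Jacobi identity of `L` for three lifts, read through `T` at `p`. -/
theorem jacobi (H : IsFrameLift L K h T) (s t u : Sec d (V₁ × V₂) (Bundle.Trivial X (V₁ × V₂))) (p : P) :
    K.bracket s (K.bracket t u) (h p)
      = (K.bracket (K.bracket s t) u + K.bracket t (K.bracket s u)) (h p) := by
  obtain ⟨lift, hlift, hbr⟩ := H.exists_lift
  have hj := L.jacobi (lift s) (lift t) (lift u)
  simp only [hbr] at hj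
  have hj' := congrArg (fun σ : Sec m FB B => T p (σ p)) hj
  have e : T p ((lift (K.bracket (K.bracket s t) u) + lift (K.bracket t (K.bracket s u))) p)
      = T p (lift (K.bracket (K.bracket s t) u) p) + T p (lift (K.bracket t (K.bracket s u)) p) :=
    map_add _ _ _
  simp only [e, hlift] at hj'
  exact hj'

/-- The vector field given by the anchor of a lift is `h`-related to the field given by `K.anchor`
on the original section, and brackets of related fields are related. -/
theorem anchor_bracket (H : IsFrameLift L K h T) (s t : Sec d (V₁ × V₂) (Bundle.Trivial X (V₁ × V₂))) (p : P) :
    K.anchor (h p) (K.bracket s t (h p))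
      = VectorField.mlieBracket (𝓡 d) (fun y => K.anchor y (s y)) (fun y => K.anchor y (t y))
        (h p) := by
  obtain ⟨lift, hlift, hbr⟩ := H.exists_lift
  rw [← hlift, ← H.anchor, ← hbr, L.anchor_bracket]
  refine mfderiv_mlieBracket_of_related H.smooth_base
    (L.anchor_smooth.comp (lift s).contMDiff) (L.anchor_smooth.comp (lift t).contMDiff)
    (K.contMDiff_anchor_apply (contMDiff_trivial_section s))
    (K.contMDiff_anchor_apply (contMDiff_trivial_section t)) (fun q => ?_) (fun q => ?_) p
  · rw [H.anchor, hlift]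
  · rw [H.anchor, hlift]

end IsFrameLift

end Lift

section Sum

variable {d : ℕ} {X : Type*} [TopologicalSpace X] [ChartedSpace (Vec d) X]
  {FA : Type*} [NormedAddCommGroup FA] [NormedSpace ℝ FA]
  {A : X → Type*} [∀ x, AddCommGroup (A x)] [∀ x, Module ℝ (A x)] [∀ x, TopologicalSpace (A x)]
  [TopologicalSpace (TotalSpace FA A)] [FiberBundle FA A] [VectorBundle ℝ FA A]
  {E H M : Type*} [NormedAddCommGroup E] [NormedSpace ℝ E] [TopologicalSpace H]
  {I : ModelWithCorners ℝ E H} [TopologicalSpace M] [ChartedSpace H M]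

theorem contMDiff_add_totalSpace {b : M → X} {ξ ζ : ∀ p, A (b p)}
    (hξ : ContMDiff I ((𝓡 d).prod 𝓘(ℝ, FA)) ∞ (fun p => (⟨b p, ξ p⟩ : TotalSpace FA A)))
    (hζ : ContMDiff I ((𝓡 d).prod 𝓘(ℝ, FA)) ∞ (fun p => (⟨b p, ζ p⟩ : TotalSpace FA A))) :
    ContMDiff I ((𝓡 d).prod 𝓘(ℝ, FA)) ∞ (fun p => (⟨b p, ξ p + ζ p⟩ : TotalSpace FA A)) := by
  intro p
  have h1 := contMDiffAt_totalSpace.1 (hξ p)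
  have h2 := contMDiffAt_totalSpace.1 (hζ p)
  refine contMDiffAt_totalSpace.2 ⟨h1.1, (h1.2.add h2.2).congr_of_eventuallyEq ?_⟩
  have hb : ∀ᶠ q in 𝓝 p, b q ∈ (trivializationAt FA A (b p)).baseSet :=
    h1.1.continuousAt.eventually
      ((trivializationAt FA A (b p)).open_baseSet.mem_nhds (mem_baseSet_trivializationAt FA A (b p)))
  filter_upwards [hb] with q hq
  exact ((trivializationAt FA A (b p)).linear ℝ hq).map_add (ξ q) (ζ q)

end Sum

/-! ### The bilinear bracket and the frame data of Cartan data -/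

section CanonicalForm

variable {n k d : ℕ} {G : ClosedSubgroup (GLn n)} [ChartedSpace (Vec k) G] [LieGroup (𝓡 k) ∞ G]
  {X : Type*} [TopologicalSpace X] [ChartedSpace (Vec d) X] [IsManifold (𝓡 d) ∞ X]
  [MulAction (G)ᵐᵒᵖ X] [SmoothRightAction G k d X]

theorem alternating_add_left {W : Type*} [NormedAddCommGroup W] [NormedSpace ℝ W]
    (c : Vec n [⋀^Fin 2]→L[ℝ] W) (u v w : Vec n) : c ![u + v, w] = c ![u, w] + c ![v, w] := by
  have h := c.map_update_add ![u, w] 0 u v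
  have e : ∀ x, Function.update ![u, w] 0 x = ![x, w] := fun x => by
    ext1 i; fin_cases i <;> rfl
  rwa [e, e, e] at h

theorem alternating_smul_left {W : Type*} [NormedAddCommGroup W] [NormedSpace ℝ W]
    (c : Vec n [⋀^Fin 2]→L[ℝ] W) (r : ℝ) (u w : Vec n) : c ![r • u, w] = r • c ![u, w] := by
  have h := c.map_update_smul ![u, w] 0 r u
  have e : ∀ x, Function.update ![u, w] 0 x = ![x, w] := fun x => by
    ext1 i; fin_cases i <;> rfl
  rwa [e, e] at h

theorem alternating_skew {W : Type*} [NormedAddCommGroup W] [NormedSpace ℝ W]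
    (c : Vec n [⋀^Fin 2]→L[ℝ] W) (u v : Vec n) : c ![u, v] = -c ![v, u] := by
  have h := c.toAlternatingMap.map_swap ![v, u] (show (0 : Fin 2) ≠ 1 by decide)
  have e : (![v, u] ∘ Equiv.swap (0 : Fin 2) 1) = ![u, v] := by
    ext1 i; fin_cases i <;> simp
  rw [e] at h
  exact h

theorem alternating_zero_left {W : Type*} [NormedAddCommGroup W] [NormedSpace ℝ W]
    (c : Vec n [⋀^Fin 2]→L[ℝ] W) (w : Vec n) : c ![0, w] = 0 :=
  c.map_coord_zero (0 : Fin 2) rfl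

/-- The bracket of constant sections defined by the values of `c` and `R` at a point. -/
noncomputable def cartanBr (c : Vec n [⋀^Fin 2]→L[ℝ] Vec n) (R : Vec n [⋀^Fin 2]→L[ℝ] LieAlg G)
    (v w : Vec n × LieAlg G) : Vec n × LieAlg G :=
  (v.2.toEnd w.1 - w.2.toEnd v.1 - c ![v.1, w.1], lieBr v.2 w.2 - R ![v.1, w.1])

theorem cartanBr_skew (c : Vec n [⋀^Fin 2]→L[ℝ] Vec n) (R : Vec n [⋀^Fin 2]→L[ℝ] LieAlg G)
    (v w : Vec n × LieAlg G) : cartanBr c R v w = -cartanBr c R w v := by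
  simp only [cartanBr, Prod.neg_mk, alternating_skew c v.1 w.1, alternating_skew R v.1 w.1,
    lieBr_skew v.2 w.2]
  congr 1 <;> abel

theorem cartanBr_add_left (c : Vec n [⋀^Fin 2]→L[ℝ] Vec n) (R : Vec n [⋀^Fin 2]→L[ℝ] LieAlg G)
    (v v' w : Vec n × LieAlg G) :
    cartanBr c R (v + v') w = cartanBr c R v w + cartanBr c R v' w := by
  simp only [cartanBr, Prod.fst_add, Prod.snd_add, alternating_add_left, lieBr_add_left,
    LieAlg.toEnd_add, add_apply, map_add, Prod.mk_add_mk]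
  congr 1 <;> abel

theorem cartanBr_smul_left (c : Vec n [⋀^Fin 2]→L[ℝ] Vec n) (R : Vec n [⋀^Fin 2]→L[ℝ] LieAlg G)
    (r : ℝ) (v w : Vec n × LieAlg G) : cartanBr c R (r • v) w = r • cartanBr c R v w := by
  simp only [cartanBr, Prod.smul_fst, Prod.smul_snd, alternating_smul_left, lieBr_smul_left,
    LieAlg.toEnd_smul, smul_apply, map_smul, Prod.smul_mk, smul_sub]

/-- `cartanBr` as a bilinear map. -/
noncomputable def cartanBrₗ (c : Vec n [⋀^Fin 2]→L[ℝ] Vec n) (R : Vec n [⋀^Fin 2]→L[ℝ] LieAlg G) :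
    (Vec n × LieAlg G) →ₗ[ℝ] (Vec n × LieAlg G) →ₗ[ℝ] Vec n × LieAlg G :=
  LinearMap.mk₂ ℝ (cartanBr c R) (cartanBr_add_left c R) (cartanBr_smul_left c R)
    (fun v w w' => by
      rw [cartanBr_skew, cartanBr_add_left, cartanBr_skew c R v w, cartanBr_skew c R v w']; abel)
    (fun r v w => by
      rw [cartanBr_skew, cartanBr_smul_left, cartanBr_skew c R v w, smul_neg])

/-- `cartanBr` as a continuous bilinear map. -/
noncomputable def cartanBrL (c : Vec n [⋀^Fin 2]→L[ℝ] Vec n) (R : Vec n [⋀^Fin 2]→L[ℝ] LieAlg G) :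
    (Vec n × LieAlg G) →L[ℝ] (Vec n × LieAlg G) →L[ℝ] Vec n × LieAlg G :=
  LinearMap.toContinuousLinearMap
    ((LinearMap.toContinuousLinearMap (𝕜 := ℝ) (E := Vec n × LieAlg G)
      (F' := Vec n × LieAlg G)).toLinearMap ∘ₗ cartanBrₗ c R)

theorem contMDiffAt_alternating_apply {W : Type*} [NormedAddCommGroup W] [NormedSpace ℝ W]
    {c : X → Vec n [⋀^Fin 2]→L[ℝ] W} {x : X}
    (hc : ContMDiffAt (𝓡 d) 𝓘(ℝ, Vec n [⋀^Fin 2]→L[ℝ] W) ∞ c x) (u v : Vec n) :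
    ContMDiffAt (𝓡 d) 𝓘(ℝ, W) ∞ (fun y => c y ![u, v]) x :=
  (ContinuousAlternatingMap.apply ℝ (Vec n) W ![u, v]).contDiff.contMDiff.contMDiffAt.comp x hc

/-- The frame data of Cartan data. -/
noncomputable def CartanData.frame (D : CartanData G d X)
    (hG : Manifold.IsSmoothEmbedding (𝓡 k) 𝓘(ℝ, Vec n →L[ℝ] Vec n) ∞ (fun g : G => toEnd g)) :
    FrameData d X (Vec n × LieAlg G) where
  anchor x := (D.F x).coprod (infActL d x)
  anchor_smooth := by
    have h1 : ContMDiff ((𝓡 d).prod 𝓘(ℝ, Vec n × LieAlg G)) (𝓡 d).tangent ∞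
        (fun p : X × (Vec n × LieAlg G) => (⟨p.1, D.F p.1 p.2.1⟩ : TangentBundle (𝓡 d) X)) :=
      D.F_smooth.comp (f := fun p : X × (Vec n × LieAlg G) => (p.1, p.2.1))
        (contMDiff_fst.prodMk (contDiff_fst.contMDiff.comp contMDiff_snd))
    have h2 : ContMDiff ((𝓡 d).prod 𝓘(ℝ, Vec n × LieAlg G)) (𝓡 d).tangent ∞
        (fun p : X × (Vec n × LieAlg G) =>
          (⟨p.1, infActL d p.1 p.2.2⟩ : TangentBundle (𝓡 d) X)) := by
      have h3 := (contMDiff_infAct (X := X) (d := d) hG).comp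
        (f := fun p : X × (Vec n × LieAlg G) => (p.1, p.2.2))
        (contMDiff_fst.prodMk (contDiff_snd.contMDiff.comp contMDiff_snd))
      refine h3.congr fun p => ?_
      rw [Function.comp_apply, infAct_eq hG]
    exact contMDiff_add_totalSpace h1 h2
  br x := cartanBrL (D.c x) (D.R x)
  br_smooth x := by
    refine contMDiffAt_clm_of_apply fun v => contMDiffAt_clm_of_apply fun w => ?_
    exact (contMDiffAt_const.sub (contMDiffAt_alternating_apply (D.c_smooth x) _ _)).prodMk_space
      (contMDiffAt_const.sub (contMDiffAt_alternating_apply (D.R_smooth x) _ _))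
  br_skew x v w := cartanBr_skew _ _ v w

end CanonicalForm

/-! ### Derivatives and equivariance of the linear `G`-action on `ℝⁿ ⊕ 𝔤` -/

section Exponential

variable {A : Type*} [NormedRing A] [NormedAlgebra ℝ A] [CompleteSpace A]

theorem hasDerivAt_exp_conj (a : A) {b : ℝ → A} {b' : A} (hb : HasDerivAt b b' 0) :
    HasDerivAt (fun t : ℝ => exp (t • a) * b t * exp (t • -a)) (a * b 0 - b 0 * a + b') 0 := by
  have h := ((hasDerivAt_exp_line a).mul hb).mul (hasDerivAt_exp_line (-a))
  simp only [Pi.mul_apply, zero_smul, exp_zero] at h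
  refine h.congr_deriv ?_
  noncomm_ring

theorem hasDerivAt_exp_apply {E : Type*} [NormedAddCommGroup E] [NormedSpace ℝ E] [CompleteSpace E]
    (a : E →L[ℝ] E) {u : ℝ → E} {u' : E} (hu : HasDerivAt u u' 0) :
    HasDerivAt (fun t : ℝ => exp (t • a) (u t)) (a (u 0) + u') 0 := by
  have h := (hasDerivAt_exp_line a).clm_apply hu
  simp only [zero_smul, exp_zero] at h
  exact h

end Exponential

section Equivariance

variable {n : ℕ} {G : ClosedSubgroup (GLn n)}

theorem hasDerivAt_lieAlg {f : ℝ → LieAlg G} {α : LieAlg G} {t : ℝ}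
    (h : HasDerivAt (fun s => (f s).toEnd) α.toEnd t) : HasDerivAt f α t := by
  obtain ⟨L, hL⟩ := (LieAlg.toEndₗ (G := G)).exists_leftInverse_of_injective
    (LinearMap.ker_eq_bot.2 LieAlg.toEnd_injective)
  have h' := (LinearMap.toContinuousLinearMap L).hasFDerivAt.comp_hasDerivAt t h
  have e : ∀ β : LieAlg G, L β.toEnd = β := LinearMap.congr_fun hL
  simpa [Function.comp_def, e] using h'

/-- The linear map `(u, α) ↦ (g⁻¹ u, Ad_{g⁻¹} α)`. -/
noncomputable def canonicalAct (g : G) : (Vec n × LieAlg G) →L[ℝ] Vec n × LieAlg G :=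
  (toEnd g⁻¹).prodMap (LinearMap.toContinuousLinearMap
    { toFun := Ad g⁻¹
      map_add' := Ad_add g⁻¹
      map_smul' := Ad_smul g⁻¹ })

theorem canonicalAct_apply (g : G) (v : Vec n × LieAlg G) :
    canonicalAct g v = (toEnd g⁻¹ v.1, Ad g⁻¹ v.2) := rfl

/-- Besides the equivariance of `c` and `R`, only two facts enter: `Ad` respects brackets, and `Ad_g
α` acts on `g v` as `g (α v)`. This is why the canonical action preserves the bracket. -/
theorem canonicalAct_cartanBr {c c' : Vec n [⋀^Fin 2]→L[ℝ] Vec n}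
    {R R' : Vec n [⋀^Fin 2]→L[ℝ] LieAlg G} (g : G)
    (hc : ∀ u v, c' ![toEnd g⁻¹ u, toEnd g⁻¹ v] = toEnd g⁻¹ (c ![u, v]))
    (hR : ∀ u v, R' ![toEnd g⁻¹ u, toEnd g⁻¹ v] = Ad g⁻¹ (R ![u, v])) (v w : Vec n × LieAlg G) :
    canonicalAct g (cartanBr c R v w) = cartanBr c' R' (canonicalAct g v) (canonicalAct g w) := by
  have h : ∀ α β, Ad g⁻¹ (α - β) = Ad g⁻¹ α - Ad g⁻¹ β := fun α β =>
    LieAlg.toEnd_injective (by simp only [toEnd_Ad, LieAlg.toEnd_sub, mul_sub, sub_mul])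
  simp only [canonicalAct_apply, cartanBr, map_sub, toEnd_Ad_apply, hc, hR, h, Ad_lieBr]

/-- Both `c` and `R` vanish on a zero horizontal part. What remains is the infinitesimal action of
`α` on `ℝⁿ ⊕ 𝔤`, which links the bracket with the derivative of the group action. -/
theorem cartanBr_vertical_left (c : Vec n [⋀^Fin 2]→L[ℝ] Vec n) (R : Vec n [⋀^Fin 2]→L[ℝ] LieAlg G)
    (α : LieAlg G) (v : Vec n × LieAlg G) :
    cartanBr c R (0, α) v = (α.toEnd v.1, lieBr α v.2) := by
  simp only [cartanBr, alternating_zero_left, map_zero, sub_zero]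

/-- The derivative at `0` of a curve `v` whose translates `exp(tα)⁻¹ v(t)` are known. -/
theorem hasDerivAt_of_canonicalAct (α : LieAlg G) {a c : ℝ → Vec n × LieAlg G}
    {a' : Vec n × LieAlg G} (ha : HasDerivAt a a' 0)
    (hc : ∀ t, canonicalAct (lieExp (t • α)) (c t) = a t) :
    HasDerivAt c ((α.toEnd (a 0).1, lieBr α (a 0).2) + a') 0 := by
  have h1 : HasDerivAt (fun t => (a t).1) a'.1 0 :=
    (ContinuousLinearMap.fst ℝ (Vec n) (LieAlg G)).hasFDerivAt.comp_hasDerivAt 0 ha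
  have h2 : HasDerivAt (fun t => (a t).2.toEnd) a'.2.toEnd 0 :=
    ((LinearMap.toContinuousLinearMap (LieAlg.toEndₗ (G := G))).comp
      (ContinuousLinearMap.snd ℝ (Vec n) (LieAlg G))).hasFDerivAt.comp_hasDerivAt 0 ha
  -- Undoing the translation: `c t` is `a t` acted on by `exp(tα)`, linearly on `ℝⁿ` and by
  -- conjugation on `𝔤`.
  have e1 : ∀ t, (c t).1 = exp (t • α.toEnd) (a t).1 := fun t => by
    rw [← hc t, canonicalAct_apply]
    exact (toEnd_apply_inv_apply (lieExp (t • α)) _).symm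
  have e2 : ∀ t, (c t).2.toEnd = exp (t • α.toEnd) * (a t).2.toEnd * exp (t • -α.toEnd) := by
    intro t
    have h3 : (c t).2 = Ad (lieExp (t • α)) (a t).2 := by
      have h4 := Ad_inv_Ad (lieExp (t • α))⁻¹ (c t).2
      rw [inv_inv] at h4
      rw [← hc t, canonicalAct_apply, h4]
    rw [h3, toEnd_Ad, toEnd_lieExp, toEnd_lieExp_inv, LieAlg.toEnd_smul, smul_neg]
  refine HasDerivAt.prodMk ?_ ?_
  · exact (hasDerivAt_exp_apply α.toEnd h1).congr_of_eventuallyEq (Eventually.of_forall e1)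
  · apply hasDerivAt_lieAlg
    refine ((hasDerivAt_exp_conj α.toEnd h2).congr_of_eventuallyEq
      (Eventually.of_forall e2)).congr_deriv ?_
    simp only [LieAlg.toEnd_add, toEnd_lieBr]

end Equivariance

/-! ### The algebroid in canonical form and its `G`-structure -/

section CanonicalAlgebroid

variable {n k d : ℕ} {G : ClosedSubgroup (GLn n)} [ChartedSpace (Vec k) G] [LieGroup (𝓡 k) ∞ G]
  {X : Type*} [TopologicalSpace X] [ChartedSpace (Vec d) X] [IsManifold (𝓡 d) ∞ X]
  [MulAction (G)ᵐᵒᵖ X]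

theorem trivial_mk_eq {V : Type*} {x y : X} {v w : V} (hxy : x = y) (hvw : v = w) :
    (⟨x, v⟩ : TotalSpace V (Bundle.Trivial X V)) = ⟨y, w⟩ := by
  subst hxy hvw; rfl

/-- The data in canonical form with a given algebroid. -/
noncomputable def canonicalData
    (L : LieAlgebroid d (Vec n × LieAlg G) (CanonicalBundle G X)) :
    GAlgData G d (Vec n × LieAlg G) (CanonicalBundle G X) where
  alg := L
  act g _ := canonicalAct g
  i _ α := (0, α)
  taut _ := ContinuousLinearMap.fst ℝ (Vec n) (LieAlg G)
  conn _ := ContinuousLinearMap.snd ℝ (Vec n) (LieAlg G)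

theorem canonicalData_isCanonicalForm
    (L : LieAlgebroid d (Vec n × LieAlg G) (CanonicalBundle G X)) :
    (canonicalData L).IsCanonicalForm where
  act_eq _ _ _ _ := rfl
  i_eq _ _ := rfl
  taut_eq _ _ _ := rfl
  conn_eq _ _ _ := rfl

theorem LieAlgebroid.dForm_clm_comp {FA : Type*} [NormedAddCommGroup FA] [NormedSpace ℝ FA]
    {A : X → Type*} [∀ x, AddCommGroup (A x)] [∀ x, Module ℝ (A x)] [∀ x, TopologicalSpace (A x)]
    [TopologicalSpace (TotalSpace FA A)] [FiberBundle FA A] [VectorBundle ℝ FA A]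
    {V W : Type*} [NormedAddCommGroup V] [NormedSpace ℝ V] [NormedAddCommGroup W] [NormedSpace ℝ W]
    (L : LieAlgebroid d FA A) {η : ∀ x, A x →L[ℝ] V} (hη : IsSmoothForm d FA η) (ℓ : V →L[ℝ] W)
    (s t : Sec d FA A) (x : X) :
    L.dForm (fun x => ℓ.comp (η x)) s t x = ℓ (L.dForm η s t x) := by
  simp only [dForm, ContinuousLinearMap.comp_apply, map_sub]
  rw [mvfderiv_clm_comp ℓ (hη.mdifferentiableAt t x), mvfderiv_clm_comp ℓ (hη.mdifferentiableAt s x)]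

variable [SmoothRightAction G k d X]
  (hG : Manifold.IsSmoothEmbedding (𝓡 k) 𝓘(ℝ, Vec n →L[ℝ] Vec n) ∞ (fun g : G => toEnd g))

theorem CartanData.frame_anchor (D : CartanData G d X) (x : X) (v : Vec n × LieAlg G) :
    (D.frame hG).anchor x v = D.F x v.1 + infAct d v.2 x := by
  rw [infAct_eq hG]; rfl

theorem CartanData.frame_br (D : CartanData G d X) (x : X) (v w : Vec n × LieAlg G) :
    (D.frame hG).br x v w = cartanBr (D.c x) (D.R x) v w := rfl

theorem GAlgData.IsDefinedBy.bracket_const {D : CartanData G d X}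
    {S : GAlgData G d (Vec n × LieAlg G) (CanonicalBundle G X)} (h : S.IsDefinedBy D)
    (v w : Vec n × LieAlg G) (x : X) :
    S.alg.bracket (trivSec (fun _ => v) contMDiff_const) (trivSec (fun _ => w) contMDiff_const) x
      = cartanBr (D.c x) (D.R x) v w :=
  h.bracket_eq v.1 w.1 v.2 w.2 x

include hG

theorem GAlgData.IsDefinedBy.anchor_eq_frame {D : CartanData G d X}
    {S : GAlgData G d (Vec n × LieAlg G) (CanonicalBundle G X)} (h : S.IsDefinedBy D)
    (x : X) (v : Vec n × LieAlg G) : S.alg.anchor x v = (D.frame hG).anchor x v := by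
  rw [D.frame_anchor hG]; exact h.anchor_eq x v.1 v.2

theorem GAlgData.IsDefinedBy.bracket_eq_frame {D : CartanData G d X}
    {S : GAlgData G d (Vec n × LieAlg G) (CanonicalBundle G X)} (h : S.IsDefinedBy D) :
    S.alg.bracket = (D.frame hG).bracket :=
  (D.frame hG).bracket_eq S.alg (h.anchor_eq_frame hG) h.bracket_const

theorem GAlgData.IsDefinedBy.dForm_trivForm {D : CartanData G d X}
    {S : GAlgData G d (Vec n × LieAlg G) (CanonicalBundle G X)} (h : S.IsDefinedBy D)
    (s t : Sec d (Vec n × LieAlg G) (CanonicalBundle G X)) (x : X) :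
    S.alg.dForm (trivForm (Vec n) (LieAlg G)) s t x = -cartanBr (D.c x) (D.R x) (s x) (t x) :=
  (D.frame hG).dForm_trivForm S.alg h.bracket_const s t x

theorem hasDerivAt_along_orbit {V : Type*} [NormedAddCommGroup V] [NormedSpace ℝ V]
    {f : X → V} (hf : ContMDiff (𝓡 d) 𝓘(ℝ, V) ∞ f) (α : LieAlg G) (x : X) :
    HasDerivAt (fun t : ℝ => f (x <• lieExp (t • α))) (mvfderiv (𝓡 d) f x (infAct d α x)) 0 := by
  have h0 : x <• lieExp ((0 : ℝ) • α) = x := by rw [zero_smul, act_lieExp_zero]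
  have h1 := mfderiv_comp_apply_of_eq (I := 𝓘(ℝ, ℝ)) (I' := 𝓡 d) (I'' := 𝓘(ℝ, V)) (0 : ℝ)
    (f := fun t : ℝ => x <• lieExp (t • α)) (g := f) (y := x)
    (hf.mdifferentiable (by simp) x) (mdifferentiableAt_orbit_line hG α x 0) h0 (1 : ℝ)
  have h2 : DifferentiableAt ℝ (fun t : ℝ => f (x <• lieExp (t • α))) 0 :=
    ((hf.mdifferentiable (by simp) _).comp (0 : ℝ)
      (mdifferentiableAt_orbit_line hG α x 0)).differentiableAt
  refine h2.hasDerivAt.congr_deriv ?_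
  rw [mfderiv_eq_fderiv] at h1
  exact h1

/-- On anchors this is the equivariance of `F` and of `ψ`. For differentials, `canonicalAct g` is
constant along `X` and so commutes with the differential of the identity form;
`canonicalAct_cartanBr` then gives the structure equation required of a morphism. -/
theorem canonical_act_hom {D : CartanData G d X}
    {S : GAlgData G d (Vec n × LieAlg G) (CanonicalBundle G X)} (hc : S.IsCanonicalForm)
    (h : S.IsDefinedBy D) (g : G) :
    IsLieAlgebroidHom S.alg S.alg (fun x : X => x <• g) (S.act g) := by
  have hact : S.act g = fun x => canonicalAct g := by
    funext x; exact ContinuousLinearMap.ext fun v => hc.act_eq g x v.1 v.2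
  have hsm : IsSmoothForm (X := X) (A := CanonicalBundle G X) d (Vec n × LieAlg G)
      (fun _ => canonicalAct g) :=
    (canonicalAct g).contDiff.contMDiff.comp contMDiff_trivial_snd
  have hbase := contMDiff_act_right (X := X) (d := d) k g
  have hanchor : ∀ x ξ, mfderiv (𝓡 d) (𝓡 d) (fun x : X => x <• g) x (S.alg.anchor x ξ)
      = S.alg.anchor (x <• g) (canonicalAct g ξ) := by
    intro x ξ
    rw [h.anchor_eq_frame hG, h.anchor_eq_frame hG, D.frame_anchor, D.frame_anchor, map_add,
      ← D.F_equivariant, mfderiv_act_infAct hG]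
    rfl
  rw [hact]
  refine ⟨hbase, contMDiff_trivial_totalSpace.2 ⟨hbase.comp (contMDiff_proj _), hsm⟩, hanchor, ?_⟩
  intro η hη s s' x t t' ht ht'
  refine dForm_comm_of_structure_equation S.alg S.alg hbase hsm hanchor
    (fun x => cartanBr (D.c x) (D.R x)) (fun s t x => ?_) (h.dForm_trivForm hG) hη s s' x t t' ht ht'
  have h1 := S.alg.dForm_clm_comp isSmoothForm_trivForm (canonicalAct g) s t x
  refine h1.trans ?_
  rw [h.dForm_trivForm hG, map_neg,
    canonicalAct_cartanBr g (D.c_equivariant g x) (D.R_equivariant g x)]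

end CanonicalAlgebroid

section TrivialBundle

variable {d : ℕ} {X : Type*} [TopologicalSpace X] [ChartedSpace (Vec d) X]
  {V₁ V₂ : Type*} [NormedAddCommGroup V₁] [NormedSpace ℝ V₁] [NormedAddCommGroup V₂]
  [NormedSpace ℝ V₂]
  {E H N : Type*} [NormedAddCommGroup E] [NormedSpace ℝ E] [TopologicalSpace H]
  {J : ModelWithCorners ℝ E H} [TopologicalSpace N] [ChartedSpace H N]

theorem contMDiff_trivial_prod_map {a : X × N → X} (ha : ContMDiff ((𝓡 d).prod J) (𝓡 d) ∞ a)
    {f : (V₁ × V₂) × N → V₁ × V₂}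
    (hf : ContMDiff (𝓘(ℝ, V₁ × V₂).prod J) 𝓘(ℝ, V₁ × V₂) ∞ f) :
    ContMDiff (((𝓡 d).prod 𝓘(ℝ, V₁ × V₂)).prod J) ((𝓡 d).prod 𝓘(ℝ, V₁ × V₂)) ∞
      (fun p : TotalSpace (V₁ × V₂) (Bundle.Trivial X (V₁ × V₂)) × N =>
        (⟨a (p.1.1, p.2), f (p.1.2, p.2)⟩ :
          TotalSpace (V₁ × V₂) (Bundle.Trivial X (V₁ × V₂)))) := by
  have h1 : ContMDiff (((𝓡 d).prod 𝓘(ℝ, V₁ × V₂)).prod J) ((𝓡 d).prod J) ∞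
      (fun p : TotalSpace (V₁ × V₂) (Bundle.Trivial X (V₁ × V₂)) × N => (p.1.1, p.2)) :=
    ((contMDiff_proj _).comp contMDiff_fst).prodMk contMDiff_snd
  have h2 : ContMDiff (((𝓡 d).prod 𝓘(ℝ, V₁ × V₂)).prod J) (𝓘(ℝ, V₁ × V₂).prod J) ∞
      (fun p : TotalSpace (V₁ × V₂) (Bundle.Trivial X (V₁ × V₂)) × N =>
        ((p.1.2, p.2) : (V₁ × V₂) × N)) :=
    (contMDiff_trivial_snd.comp contMDiff_fst).prodMk contMDiff_snd
  exact contMDiff_trivial_totalSpace.2 ⟨ha.comp h1, hf.comp h2⟩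

end TrivialBundle

section CanonicalStructure

variable {n k d : ℕ} {G : ClosedSubgroup (GLn n)} [ChartedSpace (Vec k) G] [LieGroup (𝓡 k) ∞ G]
  {X : Type*} [TopologicalSpace X] [ChartedSpace (Vec d) X] [IsManifold (𝓡 d) ∞ X]
  [MulAction (G)ᵐᵒᵖ X]

/-- Canonical form leaves only the Lie algebroid free, so uniqueness reduces to that of the anchor
and the bracket. -/
theorem GAlgData.IsCanonicalForm.eq_canonicalData
    {S : GAlgData G d (Vec n × LieAlg G) (CanonicalBundle G X)} (hc : S.IsCanonicalForm) :
    S = canonicalData S.alg := by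
  obtain ⟨L, act, i, taut, conn⟩ := S
  have h1 : act = fun g _ => canonicalAct g := by
    funext g x; exact ContinuousLinearMap.ext fun v => hc.act_eq g x v.1 v.2
  have h2 : i = fun _ α => (0, α) := by
    funext x α; exact hc.i_eq x α
  have h3 : taut = fun _ => ContinuousLinearMap.fst ℝ (Vec n) (LieAlg G) := by
    funext x; exact ContinuousLinearMap.ext fun v => hc.taut_eq x v.1 v.2
  have h4 : conn = fun _ => ContinuousLinearMap.snd ℝ (Vec n) (LieAlg G) := by
    funext x; exact ContinuousLinearMap.ext fun v => hc.conn_eq x v.1 v.2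
  subst h1 h2 h3 h4
  rfl

theorem LieAlgebroid.ext_anchor_bracket {FA : Type*} [NormedAddCommGroup FA] [NormedSpace ℝ FA]
    {A : X → Type*} [∀ x, AddCommGroup (A x)] [∀ x, Module ℝ (A x)] [∀ x, TopologicalSpace (A x)]
    [TopologicalSpace (TotalSpace FA A)] [FiberBundle FA A] [VectorBundle ℝ FA A]
    {L L' : LieAlgebroid d FA A} (h : L.anchor = L'.anchor) (h' : L.bracket = L'.bracket) :
    L = L' := by
  cases L; cases L'
  subst h h'
  rfl

theorem canonicalAct_one (v : Vec n × LieAlg G) : canonicalAct (1 : G) v = v := by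
  rw [canonicalAct_apply, inv_one]
  refine Prod.ext rfl (LieAlg.toEnd_injective ?_)
  rw [toEnd_Ad, inv_one]
  rfl

theorem canonicalAct_mul (g h : G) (v : Vec n × LieAlg G) :
    canonicalAct (g * h) v = canonicalAct h (canonicalAct g v) := by
  simp only [canonicalAct_apply, mul_inv_rev, Ad_mul]
  rfl

variable [SmoothRightAction G k d X]
  (hG : Manifold.IsSmoothEmbedding (𝓡 k) 𝓘(ℝ, Vec n →L[ℝ] Vec n) ∞ (fun g : G => toEnd g))

include hG

theorem GAlgData.IsDefinedBy.unique {D : CartanData G d X}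
    {S S' : GAlgData G d (Vec n × LieAlg G) (CanonicalBundle G X)} (hc : S.IsCanonicalForm)
    (h : S.IsDefinedBy D) (hc' : S'.IsCanonicalForm) (h' : S'.IsDefinedBy D) : S = S' := by
  have e : S.alg = S'.alg := by
    refine LieAlgebroid.ext_anchor_bracket ?_ ?_
    · funext x
      exact ContinuousLinearMap.ext fun v =>
        (h.anchor_eq_frame hG x v).trans (h'.anchor_eq_frame hG x v).symm
    · rw [h.bracket_eq_frame hG, h'.bracket_eq_frame hG]
  rw [hc.eq_canonicalData, hc'.eq_canonicalData, e]

theorem contMDiff_canonicalAct :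
    ContMDiff (𝓘(ℝ, Vec n × LieAlg G).prod (𝓡 k)) 𝓘(ℝ, Vec n × LieAlg G) ∞
      (fun p : (Vec n × LieAlg G) × G => canonicalAct p.2 p.1) := by
  have hinv : ContMDiff (𝓘(ℝ, Vec n × LieAlg G).prod (𝓡 k)) (𝓡 k) ∞
      (fun p : (Vec n × LieAlg G) × G => p.2⁻¹) := (contMDiff_inv (𝓡 k) ∞).comp contMDiff_snd
  refine ContMDiff.prodMk_space (f := fun p : (Vec n × LieAlg G) × G => toEnd p.2⁻¹ p.1.1)
    (g := fun p : (Vec n × LieAlg G) × G => Ad p.2⁻¹ p.1.2) ?_ ?_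
  · exact ((contMDiff_toEnd hG).comp hinv).clm_apply (contDiff_fst.contMDiff.comp contMDiff_fst)
  · intro p
    exact contMDiffAt_Ad_inv hG contMDiffAt_snd (contDiff_snd.contMDiff.comp contMDiff_fst p)

theorem canonicalAct_smooth :
    ContMDiff (((𝓡 d).prod 𝓘(ℝ, Vec n × LieAlg G)).prod (𝓡 k))
      ((𝓡 d).prod 𝓘(ℝ, Vec n × LieAlg G)) ∞
      (fun p : TotalSpace (Vec n × LieAlg G) (CanonicalBundle G X) × G =>
        (⟨p.1.1 <• p.2, canonicalAct p.2 p.1.2⟩ :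
          TotalSpace (Vec n × LieAlg G) (CanonicalBundle G X))) :=
  contMDiff_trivial_prod_map SmoothRightAction.contMDiff_act (contMDiff_canonicalAct hG)

theorem canonicalData_i_bracket {D : CartanData G d X}
    {L : LieAlgebroid d (Vec n × LieAlg G) (CanonicalBundle G X)}
    (h : (canonicalData L).IsDefinedBy D)
    (α β : LieAlg G) (σ τ υ : Sec d (Vec n × LieAlg G) (CanonicalBundle G X))
    (hσ : ∀ x, σ x = (0, α)) (hτ : ∀ x, τ x = (0, β)) (hυ : ∀ x, υ x = (0, lieBr α β)) :
    L.bracket σ τ = υ := by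
  have e : ∀ {s : Sec d (Vec n × LieAlg G) (CanonicalBundle G X)} {α : LieAlg G},
      (∀ x, s x = (0, α)) → s = trivSec (fun _ => (0, α)) contMDiff_const := fun h =>
    ContMDiffSection.ext h
  rw [e hσ, e hτ, e hυ]
  refine ContMDiffSection.ext fun x => ?_
  refine (h.bracket_const _ _ x).trans ?_
  rw [cartanBr_vertical_left, map_zero]
  rfl

/-- Differentiating `exp(tα)^* s` gives two terms: the infinitesimal action on the value of `s`, and
the derivative of `s` along `ψ(α)`. These are the terms of the bracket with a constant vertical
section, since the derivative of that section vanishes. -/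
theorem canonicalData_infinitesimal {D : CartanData G d X}
    {L : LieAlgebroid d (Vec n × LieAlg G) (CanonicalBundle G X)}
    (h : (canonicalData L).IsDefinedBy D)
    (α : LieAlg G) (σ : Sec d (Vec n × LieAlg G) (CanonicalBundle G X)) (hσ : ∀ x, σ x = (0, α))
    (s : Sec d (Vec n × LieAlg G) (CanonicalBundle G X)) (x : X) (c : ℝ → Vec n × LieAlg G)
    (hc : ∀ t : ℝ, canonicalAct (lieExp (t • α)) (c t) = s (x <• lieExp (t • α))) :
    HasDerivAt c (L.bracket σ s x : Vec n × LieAlg G) 0 := by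
  have e : σ = trivSec (fun _ => (0, α)) contMDiff_const := ContMDiffSection.ext hσ
  have h1 := hasDerivAt_along_orbit hG (contMDiff_trivial_section s) α x
  have h2 := hasDerivAt_of_canonicalAct α h1 hc
  rw [zero_smul, act_lieExp_zero] at h2
  refine h2.congr_deriv ?_
  have h3 : L.bracket σ s x = (D.frame hG).bracket σ s x := by
    rw [← h.bracket_eq_frame hG]; rfl
  rw [h3, FrameData.bracket_apply, D.frame_br, e]
  have h4 : mvfderiv (𝓡 d) (fun y => (trivSec (d := d) (fun _ : X => ((0 : Vec n), α))
      contMDiff_const y : Vec n × LieAlg G)) x ((D.frame hG).anchor x (s x)) = 0 :=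
    mvfderiv_const_apply _ _
  rw [h4, sub_zero]
  have h5 : (trivSec (d := d) (fun _ : X => ((0 : Vec n), α)) contMDiff_const x :
    Vec n × LieAlg G) = (0, α) := rfl
  rw [h5, cartanBr_vertical_left, D.frame_anchor hG, map_zero, zero_add]

theorem canonicalData_isGPrincipal {D : CartanData G d X}
    {L : LieAlgebroid d (Vec n × LieAlg G) (CanonicalBundle G X)}
    (h : (canonicalData L).IsDefinedBy D) : (canonicalData L).IsGPrincipal k where
  act_one x ξ := trivial_mk_eq (one_smul _ _) (canonicalAct_one ξ)
  act_mul g h x ξ := trivial_mk_eq (act_mul_right x g h) (canonicalAct_mul g h ξ)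
  act_smooth := canonicalAct_smooth hG
  act_hom := canonical_act_hom hG (canonicalData_isCanonicalForm L) h
  i_linear _ := (LinearMap.inr ℝ (Vec n) (LieAlg G)).isLinear
  i_smooth := contMDiff_trivial_totalSpace.2 ⟨contMDiff_fst,
    (ContinuousLinearMap.inr ℝ (Vec n) (LieAlg G)).contDiff.contMDiff.comp contMDiff_snd⟩
  i_injective _ := fun α β h => (Prod.mk.inj h).2
  i_anchor x α := by
    refine (h.anchor_eq x 0 α).trans ?_
    rw [map_zero, zero_add]
  i_bracket := canonicalData_i_bracket hG h
  infinitesimal := canonicalData_infinitesimal hG h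

theorem canonicalData_isGStructureAlgebroid {D : CartanData G d X}
    {L : LieAlgebroid d (Vec n × LieAlg G) (CanonicalBundle G X)}
    (h : (canonicalData L).IsDefinedBy D) : (canonicalData L).IsGStructureAlgebroid k where
  principal := canonicalData_isGPrincipal hG h
  tautological :=
    { smooth := (ContinuousLinearMap.fst ℝ (Vec n) (LieAlg G)).contDiff.contMDiff.comp
        contMDiff_trivial_snd
      surjective := fun _ => Prod.fst_surjective
      horizontal := fun _ ξ => ⟨fun h => ⟨ξ.2, Prod.ext h rfl⟩, fun ⟨_, h⟩ => h ▸ rfl⟩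
      equivariant := fun _ _ _ => rfl }
  connection :=
    { smooth := (ContinuousLinearMap.snd ℝ (Vec n) (LieAlg G)).contDiff.contMDiff.comp
        contMDiff_trivial_snd
      vertical := fun _ _ => rfl
      equivariant := fun _ _ _ => rfl }

/-- If the bracket given by Cartan data is that of a Lie algebroid, the Cartan data define a
`G`-structure algebroid with connection in canonical form. -/
theorem CartanData.exists_canonicalForm (D : CartanData G d X)
    (hJ : ∀ s t u x, (D.frame hG).bracket s ((D.frame hG).bracket t u) x
      = ((D.frame hG).bracket ((D.frame hG).bracket s t) u
        + (D.frame hG).bracket t ((D.frame hG).bracket s u)) x)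
    (hA : ∀ (s t : Sec d (Vec n × LieAlg G) (CanonicalBundle G X)) (x : X),
      (D.frame hG).anchor x ((D.frame hG).bracket s t x)
      = VectorField.mlieBracket (𝓡 d) (fun y => (D.frame hG).anchor y (s y))
        (fun y => (D.frame hG).anchor y (t y)) x) :
    ∃ S : GAlgData G d (Vec n × LieAlg G) (CanonicalBundle G X),
      S.IsGStructureAlgebroid k ∧ S.IsCanonicalForm ∧ S.IsDefinedBy D := by
  have hD : (canonicalData ((D.frame hG).toLieAlgebroid
      (fun s t u => ContMDiffSection.ext (hJ s t u)) hA)).IsDefinedBy D := by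
    refine ⟨fun x u α => D.frame_anchor hG x (u, α), fun u v α β x => ?_⟩
    refine ((D.frame hG).bracket_apply (constSec G d (u, α)) (constSec G d (v, β)) x).trans ?_
    have h4 : ∀ (w : Vec n × LieAlg G) (a : TangentSpace (𝓡 d) x), mvfderiv (𝓡 d)
        (fun y : X => (constSec G d w y : Vec n × LieAlg G)) x a = 0 := fun w a =>
      mvfderiv_const_apply _ _
    rw [h4, h4, add_zero, sub_zero]
    rfl
  exact ⟨_, canonicalData_isGStructureAlgebroid hG hD, canonicalData_isCanonicalForm _, hD⟩

end CanonicalStructure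

/-! ### The coframe `(θ, ω)` -/

section Coframe

/-- The image of `i` is the kernel of `θ`, and `κ` inverts `i` there, so the pair separates
horizontal and vertical parts. -/
theorem bijective_prod_of_splitting {V W Z : Type*} [AddCommGroup V] [Module ℝ V]
    [TopologicalSpace V] [AddCommGroup W] [Module ℝ W] [TopologicalSpace W] [AddCommGroup Z]
    [Module ℝ Z] [TopologicalSpace Z] (θ : Z →L[ℝ] V) (κ : Z →L[ℝ] W) (i : W → Z)
    (hs : Function.Surjective θ) (hh : ∀ ξ, θ ξ = 0 ↔ ∃ α, ξ = i α) (hv : ∀ α, κ (i α) = α) :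
    Function.Bijective (θ.prod κ) := by
  -- No linearity of `i` is assumed: `0` lies in `ker θ`, so it is some `i α`, and applying `κ`
  -- gives `α = 0`.
  have h0 : i 0 = 0 := by
    obtain ⟨α, hα⟩ := (hh 0).1 (map_zero θ)
    have h1 := hv α
    rw [← hα, map_zero] at h1
    rw [hα, h1]
  constructor
  · rw [injective_iff_map_eq_zero]
    intro ξ hξ
    have h1 : (θ ξ, κ ξ) = (0, 0) := hξ
    obtain ⟨α, rfl⟩ := (hh ξ).1 (Prod.mk.inj h1).1
    have h2 := (Prod.mk.inj h1).2
    rw [hv] at h2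
    rw [h2, h0]
  · rintro ⟨u, α⟩
    obtain ⟨ξ, rfl⟩ := hs u
    have h1 : θ (i (α - κ ξ)) = 0 := (hh _).2 ⟨_, rfl⟩
    -- A preimage of `u` under `θ`, corrected by the vertical vector that adjusts `κ` without
    -- changing `θ`.
    refine ⟨ξ + i (α - κ ξ), ?_⟩
    rw [ContinuousLinearMap.prod_apply, map_add, map_add, h1, hv, add_zero, add_sub_cancel]

variable {d : ℕ} {X : Type*} [TopologicalSpace X] [ChartedSpace (Vec d) X] [IsManifold (𝓡 d) ∞ X]
  {FA : Type*} [NormedAddCommGroup FA] [NormedSpace ℝ FA]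
  {A : X → Type*} [∀ x, AddCommGroup (A x)] [∀ x, Module ℝ (A x)] [∀ x, TopologicalSpace (A x)]
  [TopologicalSpace (TotalSpace FA A)] [FiberBundle FA A] [VectorBundle ℝ FA A]
  {V W : Type*} [NormedAddCommGroup V] [NormedSpace ℝ V] [NormedAddCommGroup W] [NormedSpace ℝ W]

theorem IsSmoothForm.prod {θ : ∀ x, A x →L[ℝ] V} {κ : ∀ x, A x →L[ℝ] W}
    (hθ : IsSmoothForm d FA θ) (hκ : IsSmoothForm d FA κ) :
    IsSmoothForm d FA (fun x => (θ x).prod (κ x)) :=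
  ContMDiff.prodMk_space (f := fun v : TotalSpace FA A => θ v.1 v.2)
    (g := fun v : TotalSpace FA A => κ v.1 v.2) hθ hκ

theorem LieAlgebroid.dForm_prod (L : LieAlgebroid d FA A) {θ : ∀ x, A x →L[ℝ] V}
    {κ : ∀ x, A x →L[ℝ] W} (hθ : IsSmoothForm d FA θ) (hκ : IsSmoothForm d FA κ)
    (s t : Sec d FA A) (x : X) :
    L.dForm (fun x => (θ x).prod (κ x)) s t x = (L.dForm θ s t x, L.dForm κ s t x) :=
  Prod.ext (L.dForm_clm_comp (hθ.prod hκ) (ContinuousLinearMap.fst ℝ V W) s t x).symm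
    (L.dForm_clm_comp (hθ.prod hκ) (ContinuousLinearMap.snd ℝ V W) s t x).symm

end Coframe

/-! ### Frame lifts as morphisms of Lie algebroids -/

section FrameLift

variable {n k d d' : ℕ} {G : ClosedSubgroup (GLn n)} [ChartedSpace (Vec k) G]
  [LieGroup (𝓡 k) ∞ G]
  {X : Type*} [TopologicalSpace X] [ChartedSpace (Vec d) X] [IsManifold (𝓡 d) ∞ X]
  [MulAction (G)ᵐᵒᵖ X] [SmoothRightAction G k d X]
  (hG : Manifold.IsSmoothEmbedding (𝓡 k) 𝓘(ℝ, Vec n →L[ℝ] Vec n) ∞ (fun g : G => toEnd g))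
  {Y : Type*} [TopologicalSpace Y] [ChartedSpace (Vec d') Y] [IsManifold (𝓡 d') ∞ Y]
  {FA : Type*} [NormedAddCommGroup FA] [NormedSpace ℝ FA]
  {A : Y → Type*} [∀ x, AddCommGroup (A x)] [∀ x, Module ℝ (A x)] [∀ x, TopologicalSpace (A x)]
  [TopologicalSpace (TotalSpace FA A)] [FiberBundle FA A] [VectorBundle ℝ FA A]
  {L : LieAlgebroid d' FA A} {φ : Y → X} {T : ∀ y, A y →L[ℝ] Vec n × LieAlg G}
  {D : CartanData G d X} {S : GAlgData G d (Vec n × LieAlg G) (CanonicalBundle G X)}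

/-- The coframe and the identity form of the target satisfy the same structure equation, so
`dForm_comm_of_structure_equation` extends compatibility to all forms. -/
theorem IsFrameLift.isLieAlgebroidHom (H : IsFrameLift L (D.frame hG) φ T) (h : S.IsDefinedBy D) :
    IsLieAlgebroidHom L S.alg φ T := by
  have hanchor : ∀ y ξ, mfderiv (𝓡 d') (𝓡 d) φ y (L.anchor y ξ) = S.alg.anchor (φ y) (T y ξ) :=
    fun y ξ => (H.anchor y ξ).trans (h.anchor_eq_frame hG _ _).symm
  refine ⟨H.smooth_base, contMDiff_trivial_totalSpace.2
    ⟨H.smooth_base.comp (contMDiff_proj _), H.smooth⟩, hanchor, ?_⟩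
  intro η hη s s' y t t' ht ht'
  exact dForm_comm_of_structure_equation L S.alg H.smooth_base H.smooth hanchor
    (fun x => cartanBr (D.c x) (D.R x)) H.structure_eq (h.dForm_trivForm hG) hη s s' y t t' ht ht'

theorem IsLieAlgebroidHom.isFrameLift (H : IsLieAlgebroidHom L S.alg φ T) (h : S.IsDefinedBy D)
    (hT : ∀ y, Function.Bijective (T y)) : IsFrameLift L (D.frame hG) φ T := by
  have hsm : IsSmoothForm d' FA T := (contMDiff_trivial_totalSpace.1 H.smooth).2
  refine ⟨H.smooth_base, hsm, hT,
    fun y ξ => (H.anchor_comm y ξ).trans (h.anchor_eq_frame hG _ _), fun s t y => ?_⟩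
  -- The morphism condition concerns real-valued forms, so the vector-valued equation is tested
  -- against functionals `ℓ`. Each gives the constant form `ℓ` on the trivial bundle, and constant
  -- sections serve as extensions of the values at `φ y`.
  refine SeparatingDual.eq_iff_forall_dual_eq (R := ℝ) |>.2 fun ℓ => ?_
  have h1 := H.d_comm (fun x => ℓ.comp (trivForm (Vec n) (LieAlg G) x))
    (ℓ.contDiff.contMDiff.comp contMDiff_trivial_snd) s t y
    (trivSec (fun _ => T y (s y)) contMDiff_const) (trivSec (fun _ => T y (t y)) contMDiff_const)
    rfl rfl
  rw [S.alg.dForm_clm_comp isSmoothForm_trivForm, h.dForm_trivForm hG] at h1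
  rw [← L.dForm_clm_comp hsm]
  exact h1

end FrameLift

/-! ### Solutions and realizations -/

section Solutions

variable {n k d m : ℕ} {G : ClosedSubgroup (GLn n)} [ChartedSpace (Vec k) G]
  [LieGroup (𝓡 k) ∞ G]
  {X : Type*} [TopologicalSpace X] [ChartedSpace (Vec d) X] [IsManifold (𝓡 d) ∞ X]
  [MulAction (G)ᵐᵒᵖ X] [SmoothRightAction G k d X]
  (hG : Manifold.IsSmoothEmbedding (𝓡 k) 𝓘(ℝ, Vec n →L[ℝ] Vec n) ∞ (fun g : G => toEnd g))
  {P : Type*} [TopologicalSpace P] [ChartedSpace (Vec m) P] [IsManifold (𝓡 m) ∞ P]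
  [MulAction (G)ᵐᵒᵖ P] {D : CartanData G d X}
  {S : GAlgData G d (Vec n × LieAlg G) (CanonicalBundle G X)}

/-- The coframe `(θ, ω)` of a `G`-structure with connection. -/
noncomputable abbrev GStructureWithConnection.coframe (Q : GStructureWithConnection G k m P) (p : P) :
    TangentSpace (𝓡 m) p →L[ℝ] Vec n × LieAlg G := (Q.taut p).prod (Q.conn p)

theorem GStructureWithConnection.bijective_coframe (Q : GStructureWithConnection G k m P) (p : P) :
    Function.Bijective (Q.coframe p) :=
  bijective_prod_of_splitting _ _ (fun α => infAct m α p) (Q.taut_surjective p)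
    (Q.taut_horizontal p) (Q.conn_vertical p)

/-- The equations for `dθ` and `dω` are the two components of the structure equation, with the sign
absorbed in `-cartanBr`; the equation for `dh` is the anchor equation. -/
theorem Solution.isFrameLift (sol : Solution k m P D) :
    IsFrameLift (tangentAlgebroid m P) (D.frame hG) sol.h sol.coframe where
  smooth_base := sol.h_smooth
  smooth := IsSmoothForm.prod sol.taut_smooth sol.conn_smooth
  bijective := sol.bijective_coframe
  anchor p ξ := (sol.structure_h p ξ).trans (D.frame_anchor hG _ (sol.coframe p ξ)).symm
  structure_eq s t p := by
    rw [LieAlgebroid.dForm_prod _ sol.taut_smooth sol.conn_smooth, sol.structure_taut,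
      sol.structure_conn, D.frame_br]
    simp only [cartanBr, ContinuousLinearMap.prod_apply, Prod.neg_mk]
    congr 1 <;> abel

include hG in
-- The two missing identities are checked one point at a time, so a different solution, even of a
-- different dimension, may be used for each point.
theorem CartanData.exists_canonicalForm_of_solutions.{v} (D : CartanData G d X)
    (h : ∀ x : X, HasSolutionThrough.{_, v} k D x) :
    ∃ S : GAlgData G d (Vec n × LieAlg G) (CanonicalBundle G X),
      S.IsGStructureAlgebroid k ∧ S.IsCanonicalForm ∧ S.IsDefinedBy D := by
  refine D.exists_canonicalForm hG (fun s t u x => ?_) (fun s t x => ?_)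
  all_goals
    obtain ⟨m, P, _, _, _, _, _, _, sol, p, rfl⟩ := h x
    -- The tangent bundle is one degree less smooth than the manifold; here `∞ + 1` is `∞`, so no
    -- smoothness is lost.
    have : IsManifold (𝓡 m) ((⊤ : ℕ∞) + 1) P := ‹IsManifold (𝓡 m) ∞ P›
    have : ContMDiffVectorBundle ∞ (Vec m) (fun p : P => TangentSpace (𝓡 m) p) (𝓡 m) :=
      TangentBundle.contMDiffVectorBundle
  · exact (sol.isFrameLift hG).jacobi s t u p
  · exact (sol.isFrameLift hG).anchor_bracket s t p

/-- The realization given by a solution. -/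
noncomputable def Solution.toGRealization (sol : Solution k m P D) (hc : S.IsCanonicalForm)
    (h : S.IsDefinedBy D) : GRealization k m P S where
  toGStructureWithConnection := sol.toGStructureWithConnection
  φ := sol.h
  Φ := sol.coframe
  morphism :=
    { hom := (sol.isFrameLift hG).isLieAlgebroidHom hG h
      equivariant := fun g p ξ => trivial_mk_eq (sol.h_equivariant g p)
        ((Prod.ext (sol.taut_equivariant g p ξ) (sol.conn_equivariant g p ξ)).trans
          (hc.act_eq g (sol.h p) (sol.taut p ξ) (sol.conn p ξ)).symm)
      intertwines := fun p α => by
        rw [hc.i_eq]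
        exact Prod.ext ((sol.taut_horizontal p _).2 ⟨α, rfl⟩) (sol.conn_vertical p α)
      preserves_taut := fun p ξ => hc.taut_eq _ _ _
      preserves_conn := fun p ξ => hc.conn_eq _ _ _ }

/-- In canonical form `θ` and `ω` are the two projections, so preserving them fixes both components
of `Φ`. -/
theorem GRealization.Φ_eq_coframe (Q : GRealization k m P S) (hc : S.IsCanonicalForm) :
    Q.Φ = Q.coframe := by
  funext p
  refine ContinuousLinearMap.ext fun ξ => Prod.ext ?_ ?_
  · exact (hc.taut_eq (Q.φ p) _ _).symm.trans (Q.morphism.preserves_taut p ξ)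
  · exact (hc.conn_eq (Q.φ p) _ _).symm.trans (Q.morphism.preserves_conn p ξ)

theorem GRealization.isFrameLift (Q : GRealization k m P S) (hc : S.IsCanonicalForm)
    (h : S.IsDefinedBy D) : IsFrameLift (tangentAlgebroid m P) (D.frame hG) Q.φ Q.coframe := by
  have h1 := Q.morphism.hom
  rw [Q.Φ_eq_coframe hc] at h1
  exact h1.isFrameLift hG h Q.bijective_coframe

/-- The solution given by a realization. -/
noncomputable def GRealization.toSolution (Q : GRealization k m P S) (hc : S.IsCanonicalForm)
    (h : S.IsDefinedBy D) : Solution k m P D where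
  toGStructureWithConnection := Q.toGStructureWithConnection
  h := Q.φ
  h_smooth := Q.morphism.hom.smooth_base
  -- Equivariance of the base map is the base component of the equivariance of `Φ`, taken at the
  -- zero vector.
  h_equivariant g p := congrArg TotalSpace.proj (Q.morphism.equivariant g p 0)
  structure_taut s t p := by
    have h1 := congrArg Prod.fst ((Q.isFrameLift hG hc h).structure_eq s t p)
    rw [LieAlgebroid.dForm_prod _ Q.taut_smooth Q.conn_smooth, D.frame_br] at h1
    refine h1.trans ?_
    simp only [cartanBr, ContinuousLinearMap.prod_apply, Prod.fst_neg]
    abel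
  structure_conn s t p := by
    have h1 := congrArg Prod.snd ((Q.isFrameLift hG hc h).structure_eq s t p)
    rw [LieAlgebroid.dForm_prod _ Q.taut_smooth Q.conn_smooth, D.frame_br] at h1
    refine h1.trans ?_
    simp only [cartanBr, ContinuousLinearMap.prod_apply, Prod.snd_neg]
    abel
  structure_h p ξ := ((Q.isFrameLift hG hc h).anchor p ξ).trans (D.frame_anchor hG _ _)

/-- Solutions are realizations of the algebroid defined by the Cartan data. -/
noncomputable def solutionEquiv (hc : S.IsCanonicalForm) (h : S.IsDefinedBy D) :
    Solution k m P D ≃ GRealization k m P S where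
  toFun sol := sol.toGRealization hG hc h
  invFun Q := Q.toSolution hG hc h
  left_inv _ := rfl
  right_inv Q := by
    obtain ⟨Q, φ, Φ, hΦ⟩ := Q
    have h1 : Φ = Q.coframe := GRealization.Φ_eq_coframe ⟨Q, φ, Φ, hΦ⟩ hc
    subst h1
    rfl

end Solutions

/-- The fibres of `A` are topological vector spaces without a norm, so the derivative is handled by
the little-o relation of such spaces. -/
theorem hasDerivAt_clm_comp {F V : Type*} [AddCommGroup F] [Module ℝ F] [TopologicalSpace F]
    [ContinuousSMul ℝ F] [NormedAddCommGroup V] [NormedSpace ℝ V] {c : ℝ → F} {c' : F} {t : ℝ}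
    (h : HasDerivAt c c' t) (T : F →L[ℝ] V) : HasDerivAt (fun s => T (c s)) (T c') t := by
  refine HasFDerivAtFilter.of_isLittleOTVS ?_
  have h1 := T.isBigOTVS_comp.trans_isLittleOTVS (HasFDerivAtFilter.isLittleOTVS h)
  refine h1.congr_left fun p => ?_
  simp only [Function.comp_apply, map_sub, ContinuousLinearMap.toSpanSingleton_apply, map_smul]

/-- The continuous alternating map given by a skew bilinear map on `ℝⁿ`. -/
noncomputable def alternatingOfSkew {n : ℕ} {W : Type*} [NormedAddCommGroup W] [NormedSpace ℝ W]
    (b : Vec n → Vec n → W) (hadd : ∀ u v w, b (u + v) w = b u w + b v w)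
    (hsmul : ∀ (r : ℝ) u w, b (r • u) w = r • b u w) (hskew : ∀ u v, b u v = -b v u) :
    Vec n [⋀^Fin 2]→L[ℝ] W :=
  have hadd' : ∀ u v w, b u (v + w) = b u v + b u w := fun u v w => by
    rw [hskew, hadd, hskew u v, hskew u w]; abel
  have hsmul' : ∀ (r : ℝ) u w, b u (r • w) = r • b u w := fun r u w => by
    rw [hskew, hsmul, hskew u w, smul_neg]
  { toFun := fun v => b (v 0) (v 1)
    map_update_add' := fun v i x y => by
      fin_cases i
      · simpa using hadd x y (v 1)
      · simpa using hadd' (v 0) x y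
    map_update_smul' := fun v i r x => by
      fin_cases i
      · simpa using hsmul r x (v 1)
      · simpa using hsmul' r (v 0) x
    map_eq_zero_of_eq' := fun v i j hij hne => by
      have h : v 0 = v 1 := by
        fin_cases i <;> fin_cases j
        exacts [absurd rfl hne, hij, hij.symm, absurd rfl hne]
      -- Skew-symmetry gives vanishing on the diagonal because `2` is invertible.
      have h2 : (2 : ℝ) • b (v 1) (v 1) = 0 := by
        rw [two_smul]; exact add_eq_zero_iff_eq_neg.2 (hskew _ _)
      rw [h]
      exact (smul_eq_zero.1 h2).resolve_left two_ne_zero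
    cont := by
      let B : Vec n →L[ℝ] Vec n →L[ℝ] W := LinearMap.toContinuousLinearMap
        ((LinearMap.toContinuousLinearMap (𝕜 := ℝ) (E := Vec n) (F' := W)).toLinearMap ∘ₗ
          LinearMap.mk₂ ℝ b hadd hsmul hadd' hsmul')
      exact (B.continuous.comp (continuous_apply 0)).clm_apply (continuous_apply 1) }

theorem alternating_ext {n : ℕ} {W : Type*} [NormedAddCommGroup W] [NormedSpace ℝ W]
    {c c' : Vec n [⋀^Fin 2]→L[ℝ] W} (h : ∀ u v, c ![u, v] = c' ![u, v]) : c = c' := by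
  ext v
  have e : v = ![v 0, v 1] := by ext1 i; fin_cases i <;> rfl
  rw [e]
  exact h _ _

/-! ### The differential of the coframe of a `G`-structure algebroid -/

section Algebroid

variable {n k d : ℕ} {G : ClosedSubgroup (GLn n)} [ChartedSpace (Vec k) G]
  {X : Type*} [TopologicalSpace X] [ChartedSpace (Vec d) X] [IsManifold (𝓡 d) ∞ X]
  [MulAction (G)ᵐᵒᵖ X]
  {FA : Type*} [NormedAddCommGroup FA] [NormedSpace ℝ FA]
  {A : X → Type*} [∀ x, AddCommGroup (A x)] [∀ x, Module ℝ (A x)] [∀ x, TopologicalSpace (A x)]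
  [∀ x, ContinuousSMul ℝ (A x)]
  [TopologicalSpace (TotalSpace FA A)] [FiberBundle FA A] [VectorBundle ℝ FA A]

/-- The coframe `(θ, ω)` of a `G`-structure algebroid with connection. -/
noncomputable abbrev GAlgData.coframe (S : GAlgData G d FA A) (x : X) :
    A x →L[ℝ] Vec n × LieAlg G := (S.taut x).prod (S.conn x)

/-- A smooth inverse of the coframe. -/
structure GAlgData.InverseCoframe (S : GAlgData G d FA A) where
  inv : ∀ x : X, (Vec n × LieAlg G) →L[ℝ] A x
  inv_coframe : ∀ x ξ, inv x (S.coframe x ξ) = ξ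
  coframe_inv : ∀ x v, S.coframe x (inv x v) = v
  smooth : ContMDiff ((𝓡 d).prod 𝓘(ℝ, Vec n × LieAlg G)) ((𝓡 d).prod 𝓘(ℝ, FA)) ∞
    (fun p : X × (Vec n × LieAlg G) => (⟨p.1, inv p.1 p.2⟩ : TotalSpace FA A))

namespace GAlgData

variable {S : GAlgData G d FA A}

theorem IsGStructureAlgebroid.smooth_coframe (hS : S.IsGStructureAlgebroid k) :
    IsSmoothForm d FA S.coframe := hS.tautological.smooth.prod hS.connection.smooth

theorem IsGStructureAlgebroid.bijective_coframe (hS : S.IsGStructureAlgebroid k) (x : X) :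
    Function.Bijective (S.coframe x) :=
  bijective_prod_of_splitting _ _ (S.i x) (hS.tautological.surjective x)
    (hS.tautological.horizontal x) (hS.connection.vertical x)

theorem IsGStructureAlgebroid.nonempty_inverseCoframe [FiniteDimensional ℝ FA]
    [ContMDiffVectorBundle ∞ FA A (𝓡 d)] (hS : S.IsGStructureAlgebroid k) :
    Nonempty S.InverseCoframe := by
  obtain ⟨Ti, h1, h2, h3⟩ := exists_inverse_form S.coframe hS.smooth_coframe hS.bijective_coframe
  exact ⟨⟨Ti, h1, h2, h3⟩⟩

theorem IsGStructureAlgebroid.coframe_act (hS : S.IsGStructureAlgebroid k) (g : G) (x : X)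
    (ξ : A x) : S.coframe (x <• g) (S.act g x ξ) = canonicalAct g (S.coframe x ξ) :=
  Prod.ext (hS.tautological.equivariant g x ξ) (hS.connection.equivariant g x ξ)

theorem IsGStructureAlgebroid.coframe_i (hS : S.IsGStructureAlgebroid k) (x : X) (α : LieAlg G) :
    S.coframe x (S.i x α) = (0, α) :=
  Prod.ext ((hS.tautological.horizontal x _).2 ⟨α, rfl⟩) (hS.connection.vertical x α)

namespace InverseCoframe

variable (J : S.InverseCoframe)

theorem inv_vertical (hS : S.IsGStructureAlgebroid k) (x : X) (α : LieAlg G) :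
    J.inv x (0, α) = S.i x α := by
  rw [← hS.coframe_i, J.inv_coframe]

theorem act_inv (hS : S.IsGStructureAlgebroid k) (g : G) (x : X) (v : Vec n × LieAlg G) :
    S.act g x (J.inv x v) = J.inv (x <• g) (canonicalAct g v) := by
  rw [← J.inv_coframe (x <• g) (S.act g x _), hS.coframe_act, J.coframe_inv]

/-- The sections with constant value under the coframe. -/
noncomputable def frame (v : Vec n × LieAlg G) : Sec d FA A :=
  ⟨fun x => J.inv x v, J.smooth.comp (contMDiff_id.prodMk contMDiff_const)⟩

theorem coframe_frame (v : Vec n × LieAlg G) (x : X) : S.coframe x (J.frame v x) = v :=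
  J.coframe_inv x v

theorem frame_add (v w : Vec n × LieAlg G) : J.frame (v + w) = J.frame v + J.frame w :=
  ContMDiffSection.ext fun x => map_add (J.inv x) v w

theorem frame_smul (r : ℝ) (v : Vec n × LieAlg G) :
    J.frame (r • v) = smulSec (ContMDiffMap.const r) (J.frame v) :=
  ContMDiffSection.ext fun x => map_smul (J.inv x) r v

/-- The differential of the coframe, evaluated on the frame. -/
noncomputable def torsion (x : X) (v w : Vec n × LieAlg G) : Vec n × LieAlg G :=
  S.alg.dForm S.coframe (J.frame v) (J.frame w) x

theorem torsion_skew (x : X) (v w : Vec n × LieAlg G) : J.torsion x v w = -J.torsion x w v :=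
  S.alg.dForm_skew _ _ _

theorem torsion_add_left (hS : S.IsGStructureAlgebroid k) (x : X) (v v' w : Vec n × LieAlg G) :
    J.torsion x (v + v') w = J.torsion x v w + J.torsion x v' w := by
  rw [torsion_skew, torsion, frame_add, S.alg.dForm_add hS.smooth_coframe, neg_add,
    J.torsion_skew x v, J.torsion_skew x v']
  rfl

theorem torsion_smul_left (hS : S.IsGStructureAlgebroid k) (x : X) (r : ℝ)
    (v w : Vec n × LieAlg G) : J.torsion x (r • v) w = r • J.torsion x v w := by
  rw [torsion_skew, torsion, frame_smul, S.alg.dForm_smul hS.smooth_coframe, J.torsion_skew x v,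
    smul_neg]
  rfl

/-- The coframe is constant on frame sections, so the derivative terms of the differential drop out.
-/
theorem torsion_eq (x : X) (v w : Vec n × LieAlg G) :
    J.torsion x v w = -S.coframe x (S.alg.bracket (J.frame v) (J.frame w) x) := by
  have h : ∀ v, (fun y => S.coframe y (J.frame v y)) = fun _ => v := fun v =>
    funext fun y => J.coframe_frame v y
  rw [torsion, LieAlgebroid.dForm, h, h, mvfderiv_const_apply, mvfderiv_const_apply, sub_zero,
    zero_sub]

theorem contMDiff_torsion (hS : S.IsGStructureAlgebroid k) (v w : Vec n × LieAlg G) :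
    ContMDiff (𝓡 d) 𝓘(ℝ, Vec n × LieAlg G) ∞ (fun x => J.torsion x v w) := by
  refine (hS.smooth_coframe.contMDiff_apply (S.alg.bracket (J.frame v) (J.frame w))).neg.congr
    fun x => J.torsion_eq x v w

/-- The frame section of `(0, α)` is `i(α)`, so the infinitesimal action axiom computes its bracket
with the frame section of `w`. In the coframe, pulling the latter back by `exp(tα)` only moves the
constant `w` by the linear action, whose derivative is known. -/
theorem torsion_vertical_left (hS : S.IsGStructureAlgebroid k) (x : X) (α : LieAlg G)
    (w : Vec n × LieAlg G) : J.torsion x (0, α) w = -(α.toEnd w.1, lieBr α w.2) := by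
  rw [torsion_eq, neg_inj]
  -- The coframe components at `x` of the pulled-back section: acting by `exp(tα)` must return the
  -- constant value `w`.
  let c : ℝ → Vec n × LieAlg G := fun t => canonicalAct (lieExp (t • α))⁻¹ w
  have hact : ∀ t, canonicalAct (lieExp (t • α)) (c t) = w := fun t => by
    rw [← canonicalAct_mul, inv_mul_cancel, canonicalAct_one]
  have h1 := hS.principal.infinitesimal α (J.frame (0, α)) (fun x => J.inv_vertical hS x α)
    (J.frame w) x (fun t => J.inv x (c t)) fun t => by
      rw [J.act_inv hS, hact]; rfl
  have h2 := hasDerivAt_clm_comp h1 (S.coframe x)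
  simp only [J.coframe_inv] at h2
  have h3 := hasDerivAt_of_canonicalAct α (hasDerivAt_const (0 : ℝ) w) hact
  rw [add_zero] at h3
  -- Two computations of the derivative of the same curve: by the axiom and by the linear action.
  exact h2.unique h3

/-- `G` acts by algebroid automorphisms, and pulling the coframe back by `g` composes it with the
constant linear map `canonicalAct g`. Frame sections extend the translated vectors, so the
automorphism condition for each `ℓ ∘ (θ, ω)` gives the claim. -/
theorem torsion_act (hS : S.IsGStructureAlgebroid k) (g : G) (x : X) (v w : Vec n × LieAlg G) :
    J.torsion (x <• g) (canonicalAct g v) (canonicalAct g w) = canonicalAct g (J.torsion x v w) := by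
  refine SeparatingDual.eq_iff_forall_dual_eq (R := ℝ) |>.2 fun ℓ => ?_
  have h1 := (hS.principal.act_hom g).d_comm (fun y => ℓ.comp (S.coframe y))
    (ℓ.contDiff.contMDiff.comp hS.smooth_coframe) (J.frame v) (J.frame w) x
    (J.frame (canonicalAct g v)) (J.frame (canonicalAct g w)) (J.act_inv hS g x v).symm
    (J.act_inv hS g x w).symm
  have e : (fun z => (ℓ.comp (S.coframe (z <• g))).comp (S.act g z))
      = fun z => (ℓ.comp (canonicalAct g)).comp (S.coframe z) := by
    funext z
    exact ContinuousLinearMap.ext fun ξ => congrArg ℓ (hS.coframe_act g z ξ)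
  rw [e, S.alg.dForm_clm_comp hS.smooth_coframe, S.alg.dForm_clm_comp hS.smooth_coframe] at h1
  exact h1.symm

end InverseCoframe

end GAlgData

end Algebroid

/-! ### Cartan data of a `G`-structure algebroid with connection -/

section Algebroid

variable {n k d : ℕ} {G : ClosedSubgroup (GLn n)} [ChartedSpace (Vec k) G]
  {X : Type*} [TopologicalSpace X] [ChartedSpace (Vec d) X] [IsManifold (𝓡 d) ∞ X]
  [MulAction (G)ᵐᵒᵖ X]
  {FA : Type*} [NormedAddCommGroup FA] [NormedSpace ℝ FA]
  {A : X → Type*} [∀ x, AddCommGroup (A x)] [∀ x, Module ℝ (A x)] [∀ x, TopologicalSpace (A x)]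
  [∀ x, ContinuousSMul ℝ (A x)]
  [TopologicalSpace (TotalSpace FA A)] [FiberBundle FA A] [VectorBundle ℝ FA A]
  {S : GAlgData G d FA A}

theorem Ad_zero (g : G) : Ad g (0 : LieAlg G) = 0 := by
  have h := Ad_smul g 0 0
  rwa [zero_smul, zero_smul] at h

theorem canonicalAct_horizontal (g : G) (u : Vec n) :
    canonicalAct g (u, 0) = (toEnd g⁻¹ u, 0) := by
  rw [canonicalAct_apply, Ad_zero]

/-- Recovers `c` and `R` from the bracket, as used both to define the Cartan data of `A` and to
prove them unique. -/
theorem cartanBr_horizontal (c : Vec n [⋀^Fin 2]→L[ℝ] Vec n) (R : Vec n [⋀^Fin 2]→L[ℝ] LieAlg G)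
    (u v : Vec n) : cartanBr c R (u, 0) (v, 0) = -(c ![u, v], R ![u, v]) := by
  have h1 : (0 : LieAlg G).toEnd = 0 := rfl
  have h2 : lieBr (0 : LieAlg G) 0 = 0 := by
    have h := lieBr_smul_left 0 (0 : LieAlg G) 0
    rwa [zero_smul, zero_smul] at h
  simp only [cartanBr, h1, h2, zero_apply, sub_zero, zero_sub, Prod.neg_mk]

theorem horizontal_add_vertical (v : Vec n × LieAlg G) : (v.1, 0) + (0, v.2) = v := by
  rw [Prod.mk_add_mk, add_zero, zero_add]

theorem horizontal_add (u v : Vec n) : ((u + v, 0) : Vec n × LieAlg G) = (u, 0) + (v, 0) := by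
  rw [Prod.mk_add_mk, add_zero]

theorem horizontal_smul (r : ℝ) (u : Vec n) : ((r • u, 0) : Vec n × LieAlg G) = r • (u, 0) := by
  rw [Prod.smul_mk, smul_zero]

/-- Cartan data on the same manifold agree if they pull back to the same structure equations. -/
theorem CartanData.ext_of_frame {D D' : CartanData G d X} (hF : ∀ x u, D.F x u = D'.F x u)
    (hbr : ∀ x v w, cartanBr (D.c x) (D.R x) v w = cartanBr (D'.c x) (D'.R x) v w) : D = D' := by
  have h : ∀ x u v, (D.c x ![u, v], D.R x ![u, v]) = (D'.c x ![u, v], D'.R x ![u, v]) := by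
    intro x u v
    have h1 := hbr x (u, 0) (v, 0)
    rwa [cartanBr_horizontal, cartanBr_horizontal, neg_inj] at h1
  have hF' : D.F = D'.F := funext fun x => ContinuousLinearMap.ext (hF x)
  have hc : D.c = D'.c := funext fun x => alternating_ext fun u v => (Prod.mk.inj (h x u v)).1
  have hR : D.R = D'.R := funext fun x => alternating_ext fun u v => (Prod.mk.inj (h x u v)).2
  cases D; cases D'
  subst hF' hc hR
  rfl

namespace GAlgData.InverseCoframe

variable (J : S.InverseCoframe) (hS : S.IsGStructureAlgebroid k)

/-- The Cartan data of a `G`-structure algebroid with connection. -/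
noncomputable def cartanData : CartanData G d X where
  c x := alternatingOfSkew (fun u v => (J.torsion x (u, 0) (v, 0)).1)
    (fun u v w => by rw [horizontal_add, J.torsion_add_left hS]; rfl)
    (fun r u w => by rw [horizontal_smul, J.torsion_smul_left hS]; rfl)
    (fun u v => by rw [J.torsion_skew]; rfl)
  R x := alternatingOfSkew (fun u v => (J.torsion x (u, 0) (v, 0)).2)
    (fun u v w => by rw [horizontal_add, J.torsion_add_left hS]; rfl)
    (fun r u w => by rw [horizontal_smul, J.torsion_smul_left hS]; rfl)
    (fun u v => by rw [J.torsion_skew]; rfl)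
  F x := (S.alg.anchor x).comp ((J.inv x).comp (ContinuousLinearMap.inl ℝ (Vec n) (LieAlg G)))
  c_smooth x := contMDiffAt_alternating_of_apply fun u v =>
    contDiff_fst.contMDiff.comp (J.contMDiff_torsion hS (u, 0) (v, 0)) x
  R_smooth x := contMDiffAt_alternating_of_apply fun u v =>
    contDiff_snd.contMDiff.comp (J.contMDiff_torsion hS (u, 0) (v, 0)) x
  F_smooth := by
    have h1 : ContMDiff ((𝓡 d).prod 𝓘(ℝ, Vec n)) ((𝓡 d).prod 𝓘(ℝ, Vec n × LieAlg G)) ∞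
        (fun p : X × Vec n => (p.1, ((p.2, 0) : Vec n × LieAlg G))) :=
      contMDiff_fst.prodMk
        ((ContinuousLinearMap.inl ℝ (Vec n) (LieAlg G)).contDiff.contMDiff.comp contMDiff_snd)
    exact S.alg.anchor_smooth.comp (J.smooth.comp h1)
  c_equivariant g x u v := by
    have h := J.torsion_act hS g x (u, 0) (v, 0)
    rw [canonicalAct_horizontal, canonicalAct_horizontal] at h
    exact congrArg Prod.fst h
  R_equivariant g x u v := by
    have h := J.torsion_act hS g x (u, 0) (v, 0)
    rw [canonicalAct_horizontal, canonicalAct_horizontal] at h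
    exact congrArg Prod.snd h
  F_equivariant g x u := by
    have h := J.act_inv hS g x (u, 0)
    rw [canonicalAct_horizontal] at h
    refine Eq.trans ?_ ((hS.principal.act_hom g).anchor_comm x (J.inv x (u, 0))).symm
    rw [h]
    rfl

/-- Both sides are bilinear and skew, so horizontal and vertical arguments can be treated
separately. With a vertical argument the torsion is forced by the group action; on two horizontal
ones equality is the definition of `c` and `R`. -/
theorem torsion_eq_cartanBr (x : X) (v w : Vec n × LieAlg G) :
    J.torsion x v w
      = -cartanBr ((J.cartanData hS).c x) ((J.cartanData hS).R x) v w := by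
  set c := (J.cartanData hS).c x with hc
  set R := (J.cartanData hS).R x with hR
  have hv : ∀ α w, J.torsion x (0, α) w = -cartanBr c R (0, α) w := fun α w => by
    rw [J.torsion_vertical_left hS, cartanBr_vertical_left]
  have hh : ∀ u v, J.torsion x (u, 0) (v, 0) = -cartanBr c R (u, 0) (v, 0) := fun u v => by
    rw [cartanBr_horizontal, neg_neg, hc, hR]; rfl
  have hl : ∀ u w, J.torsion x (u, 0) w = -cartanBr c R (u, 0) w := fun u w => by
    rw [← horizontal_add_vertical w, J.torsion_skew, cartanBr_skew, J.torsion_add_left hS,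
      cartanBr_add_left, hv, J.torsion_skew x (w.1, 0), hh, cartanBr_skew c R (w.1, 0)]
    abel
  rw [← horizontal_add_vertical v, J.torsion_add_left hS, cartanBr_add_left, hv, hl]
  abel

variable [LieGroup (𝓡 k) ∞ G] [SmoothRightAction G k d X]
  (hG : Manifold.IsSmoothEmbedding (𝓡 k) 𝓘(ℝ, Vec n →L[ℝ] Vec n) ∞ (fun g : G => toEnd g))

/-- Here `A` plays the part that `TP` plays for a solution, with the identity of `X` as classifying
map. The descent argument then applies at every point of `X`. -/
theorem isFrameLift : IsFrameLift S.alg ((J.cartanData hS).frame hG) (fun x : X => x) S.coframe where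
  smooth_base := contMDiff_id
  smooth := hS.smooth_coframe
  bijective := hS.bijective_coframe
  anchor x ξ := by
    have h1 : mfderiv (𝓡 d) (𝓡 d) (fun x : X => x) x = ContinuousLinearMap.id ℝ _ := mfderiv_id
    -- The term `ψ(ω ξ)` is the anchor of the vertical part of `ξ` and the term in `F` that of its
    -- horizontal part; they add up to the anchor of `ξ`.
    rw [h1, CartanData.frame_anchor hG, ← hS.principal.i_anchor, ← J.inv_vertical hS]
    have h2 : (J.cartanData hS).F x (S.coframe x ξ).1
      = S.alg.anchor x (J.inv x ((S.coframe x ξ).1, 0)) := rfl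
    rw [h2, ← map_add, ← map_add, horizontal_add_vertical, J.inv_coframe]
    rfl
  structure_eq s t x := by
    refine S.alg.dForm_eq_of_frame hS.smooth_coframe hS.smooth_coframe
      (fun x => (hS.bijective_coframe x).1) J.coframe_frame x
      (-cartanBrₗ ((J.cartanData hS).c x) ((J.cartanData hS).R x)) (fun v w => ?_) s t
    exact J.torsion_eq_cartanBr hS x v w

end GAlgData.InverseCoframe

end Algebroid

/-! ### Isomorphism with the canonical form and uniqueness of the Cartan data -/

section Main

variable {n k d : ℕ} {G : ClosedSubgroup (GLn n)} [ChartedSpace (Vec k) G]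
  [LieGroup (𝓡 k) ∞ G]
  (hG : Manifold.IsSmoothEmbedding (𝓡 k) 𝓘(ℝ, Vec n →L[ℝ] Vec n) ∞ (fun g : G => toEnd g))
  {X : Type*} [TopologicalSpace X] [ChartedSpace (Vec d) X] [IsManifold (𝓡 d) ∞ X]
  [MulAction (G)ᵐᵒᵖ X] [SmoothRightAction G k d X]
  {FA : Type*} [NormedAddCommGroup FA] [NormedSpace ℝ FA]
  {A : X → Type*} [∀ x, AddCommGroup (A x)] [∀ x, Module ℝ (A x)] [∀ x, TopologicalSpace (A x)]
  [∀ x, ContinuousSMul ℝ (A x)]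
  [TopologicalSpace (TotalSpace FA A)] [FiberBundle FA A] [VectorBundle ℝ FA A]
  {S : GAlgData G d FA A} {S' : GAlgData G d (Vec n × LieAlg G) (CanonicalBundle G X)}
  {D D' : CartanData G d X}

include hG

theorem GAlgData.isGMorphism_coframe (hS : S.IsGStructureAlgebroid k) (hc : S'.IsCanonicalForm)
    (hD : S'.IsDefinedBy D) (H : IsFrameLift S.alg (D.frame hG) (fun x : X => x) S.coframe) :
    IsGMorphism S S' (fun x : X => x) S.coframe where
  hom := H.isLieAlgebroidHom hG hD
  equivariant g x ξ := trivial_mk_eq rfl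
    ((hS.coframe_act g x ξ).trans (hc.act_eq g x (S.taut x ξ) (S.conn x ξ)).symm)
  intertwines x α := (hS.coframe_i x α).trans (hc.i_eq x α).symm
  preserves_taut _ _ := hc.taut_eq _ _ _
  preserves_conn _ _ := hc.conn_eq _ _ _

omit hG in
theorem GAlgData.InverseCoframe.isGMorphism_inv (J : S.InverseCoframe)
    (hS : S.IsGStructureAlgebroid k) (hc : S'.IsCanonicalForm)
    (H : IsGMorphism S S' (fun x : X => x) S.coframe) :
    IsGMorphism S' S (fun x : X => x) J.inv where
  hom :=
    { smooth_base := contMDiff_id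
      smooth := J.smooth.comp
        (f := fun v : TotalSpace (Vec n × LieAlg G) (CanonicalBundle G X) =>
          ((v.1, v.2) : X × (Vec n × LieAlg G)))
        ((contMDiff_proj _).prodMk contMDiff_trivial_snd)
      anchor_comm := fun x v => by
        have h1 : mfderiv (𝓡 d) (𝓡 d) (fun x : X => x) x = ContinuousLinearMap.id ℝ _ := mfderiv_id
        have h2 := H.hom.anchor_comm x (J.inv x v)
        rw [J.coframe_inv, h1] at h2
        rw [h1]
        exact h2.symm
      d_comm := fun η hη s s' x t t' ht ht' => by
        have hη' : IsSmoothForm (A := CanonicalBundle G X) d (Vec n × LieAlg G)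
            (fun x => (η x).comp (J.inv x)) :=
          ContMDiff.comp (g := fun v : TotalSpace FA A => η v.1 v.2) hη (J.smooth.comp
            (f := fun v : TotalSpace (Vec n × LieAlg G) (CanonicalBundle G X) =>
              ((v.1, v.2) : X × (Vec n × LieAlg G)))
            ((contMDiff_proj _).prodMk contMDiff_trivial_snd))
        -- The inverse inherits compatibility: the morphism property of the coframe is applied to `η
        -- ∘ J.inv`, whose pull-back along the coframe is `η` again.
        have h1 := H.hom.d_comm _ hη' t t' x s s' (by rw [ht, J.coframe_inv])
          (by rw [ht', J.coframe_inv])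
        have e : (fun z => ((η z).comp (J.inv z)).comp (S.coframe z)) = η := by
          funext z
          exact ContinuousLinearMap.ext fun ξ => congrArg (η z) (J.inv_coframe z ξ)
        rw [e] at h1
        exact h1.symm }
  equivariant g x v := by
    have h : S'.act g x v = canonicalAct g v := hc.act_eq g x v.1 v.2
    rw [h, ← J.act_inv hS]
  intertwines x α := by rw [hc.i_eq, J.inv_vertical hS]
  preserves_taut x v := (congrArg Prod.fst (J.coframe_inv x v)).trans (hc.taut_eq x v.1 v.2).symm
  preserves_conn x v := (congrArg Prod.snd (J.coframe_inv x v)).trans (hc.conn_eq x v.1 v.2).symm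

/-- The coframe takes every value, so the anchor equation on horizontal vectors and the structure
equation on frame sections determine `F` and the bracket. -/
theorem CartanData.eq_of_isFrameLift (J : S.InverseCoframe)
    (H : IsFrameLift S.alg (D.frame hG) (fun x : X => x) S.coframe)
    (H' : IsFrameLift S.alg (D'.frame hG) (fun x : X => x) S.coframe) : D = D' := by
  refine CartanData.ext_of_frame (fun x u => ?_) (fun x v w => ?_)
  · have h1 := (H.anchor x (J.inv x (u, 0))).symm.trans (H'.anchor x (J.inv x (u, 0)))
    rw [J.coframe_inv, D.frame_anchor hG, D'.frame_anchor hG] at h1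
    exact add_right_cancel h1
  · have h1 := (H.structure_eq (J.frame v) (J.frame w) x).symm.trans
      (H'.structure_eq (J.frame v) (J.frame w) x)
    rw [J.coframe_frame, J.coframe_frame, neg_inj] at h1
    exact h1

theorem GAlgData.IsGStructureAlgebroid.existsUnique_cartanData [FiniteDimensional ℝ FA]
    [ContMDiffVectorBundle ∞ FA A (𝓡 d)] (hS : S.IsGStructureAlgebroid k) :
    ∃! D : CartanData G d X, ∃ S' : GAlgData G d (Vec n × LieAlg G) (CanonicalBundle G X),
      S'.IsGStructureAlgebroid k ∧ S'.IsCanonicalForm ∧ S'.IsDefinedBy D ∧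
      ∃ (Φ : ∀ x : X, A x →L[ℝ] CanonicalBundle G X x)
        (Ψ : ∀ x : X, CanonicalBundle G X x →L[ℝ] A x),
        IsGMorphism S S' (fun x : X => x) Φ ∧ IsGMorphism S' S (fun x : X => x) Ψ ∧
        (∀ x ξ, Ψ x (Φ x ξ) = ξ) ∧ (∀ x v, Φ x (Ψ x v) = v) ∧
        ∀ x ξ, Φ x ξ = (S.taut x ξ, S.conn x ξ) := by
  obtain ⟨J⟩ := hS.nonempty_inverseCoframe
  have H := J.isFrameLift hS hG
  refine ⟨J.cartanData hS, ?_, ?_⟩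
  · obtain ⟨S', h1, h2, h3⟩ := (J.cartanData hS).exists_canonicalForm hG H.jacobi H.anchor_bracket
    have hΦ := GAlgData.isGMorphism_coframe hG hS h2 h3 H
    exact ⟨S', h1, h2, h3, S.coframe, J.inv, hΦ, J.isGMorphism_inv hS h2 hΦ, J.inv_coframe,
      J.coframe_inv, fun _ _ => rfl⟩
  · rintro D ⟨S', -, -, h3, Φ, -, hΦ, -, -, -, h4⟩
    -- The prescribed formula makes `Φ` the coframe, so any competing data also have `A` as a frame
    -- lift.
    have e : Φ = S.coframe := by
      funext x
      exact ContinuousLinearMap.ext (h4 x)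
    subst e
    exact CartanData.eq_of_isFrameLift hG J (hΦ.hom.isFrameLift hG h3 hS.bijective_coframe) H

end Main

end CartanProblem

theorem mainTheorem1 {n k d : ℕ}
    (G : ClosedSubgroup (CartanProblem.GLn n))
    [ChartedSpace (CartanProblem.Vec k) G] [LieGroup (𝓡 k) ∞ G]
    (hG : Manifold.IsSmoothEmbedding (𝓡 k) 𝓘(ℝ, CartanProblem.Vec n →L[ℝ] CartanProblem.Vec n) ∞
      (fun g : G => CartanProblem.toEnd g))
    (X : Type uX) [TopologicalSpace X] [T2Space X] [SecondCountableTopology X]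
    [ChartedSpace (CartanProblem.Vec d) X] [IsManifold (𝓡 d) ∞ X] [MulAction (G)ᵐᵒᵖ X]
    [CartanProblem.SmoothRightAction G k d X] :
    -- Cartan data with a solution through every point define an algebroid in canonical form
    (∀ D : CartanProblem.CartanData G d X,
      (∀ x : X, CartanProblem.HasSolutionThrough.{uX, w} k D x) →
      ∃! S : CartanProblem.GAlgData G d (CartanProblem.Vec n × CartanProblem.LieAlg G)
          (CartanProblem.CanonicalBundle G X),
        S.IsGStructureAlgebroid k ∧ S.IsCanonicalForm ∧ S.IsDefinedBy D) ∧
    -- every algebroid arises from unique Cartan data, via the isomorphism `(θ, ω)`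
    (∀ (FA : Type uF) [NormedAddCommGroup FA] [NormedSpace ℝ FA] [FiniteDimensional ℝ FA]
      (A : X → Type uA) [∀ x, AddCommGroup (A x)] [∀ x, Module ℝ (A x)]
      [∀ x, TopologicalSpace (A x)] [∀ x, ContinuousSMul ℝ (A x)]
      [TopologicalSpace (Bundle.TotalSpace FA A)] [FiberBundle FA A] [VectorBundle ℝ FA A]
      [ContMDiffVectorBundle ∞ FA A (𝓡 d)]
      (S : CartanProblem.GAlgData G d FA A), S.IsGStructureAlgebroid k →
      ∃! D : CartanProblem.CartanData G d X,
        ∃ S' : CartanProblem.GAlgData G d (CartanProblem.Vec n × CartanProblem.LieAlg G)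
            (CartanProblem.CanonicalBundle G X),
          S'.IsGStructureAlgebroid k ∧ S'.IsCanonicalForm ∧ S'.IsDefinedBy D ∧
          ∃ (Φ : ∀ x : X, A x →L[ℝ] CartanProblem.CanonicalBundle G X x)
            (Ψ : ∀ x : X, CartanProblem.CanonicalBundle G X x →L[ℝ] A x),
            CartanProblem.IsGMorphism S S' (fun x : X => x) Φ ∧
            CartanProblem.IsGMorphism S' S (fun x : X => x) Ψ ∧
            (∀ x ξ, Ψ x (Φ x ξ) = ξ) ∧ (∀ x v, Φ x (Ψ x v) = v) ∧
            ∀ x ξ, Φ x ξ = (S.taut x ξ, S.conn x ξ)) ∧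
    -- solutions correspond to realizations of the algebroid defined by the Cartan data
    (∀ (D : CartanProblem.CartanData G d X)
      (S : CartanProblem.GAlgData G d (CartanProblem.Vec n × CartanProblem.LieAlg G)
        (CartanProblem.CanonicalBundle G X)),
      S.IsGStructureAlgebroid k → S.IsCanonicalForm → S.IsDefinedBy D →
      ∀ (m : ℕ) (P : Type uP) [TopologicalSpace P] [T2Space P] [SecondCountableTopology P]
        [ChartedSpace (CartanProblem.Vec m) P] [IsManifold (𝓡 m) ∞ P] [MulAction (G)ᵐᵒᵖ P],
        ∃ e : CartanProblem.Solution k m P D ≃ CartanProblem.GRealization k m P S,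
          ∀ sol : CartanProblem.Solution k m P D,
            (e sol).toGStructureWithConnection = sol.toGStructureWithConnection ∧
            (e sol).φ = sol.h ∧
            ∀ p ξ, (e sol).Φ p ξ = (sol.taut p ξ, sol.conn p ξ)) := by
  refine ⟨fun D h => ?_, fun FA _ _ _ A _ _ _ _ _ _ _ _ S hS => hS.existsUnique_cartanData hG,
    fun D S _ hc h m P _ _ _ _ _ _ =>
      ⟨CartanProblem.solutionEquiv hG hc h, fun sol => ⟨rfl, rfl, fun _ _ => rfl⟩⟩⟩
  obtain ⟨S, h1, h2, h3⟩ := D.exists_canonicalForm_of_solutions hG h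
  exact ⟨S, ⟨h1, h2, h3⟩, fun S' h' => h'.2.2.unique hG h'.2.1 h2 h3⟩
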